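/- Let $I$ be a small category, and let $F$ be a covering class of maps in $I$: $F$ is closed under composition, contains all identity maps, and every map $f:i'\to i$ in $F$ admits a pullback along every map $i''\to i$, this pullback again being in $F$. Equip $I$ with the $F$-topology, for which a sieve on $i$ is covering if and only if it contains some map $i'\to i$ in $F$. Let $\mathcal{E}$ be a finitely presentable abelian category, that is, an abelian category that is cocomplete and has a small set of compact (finitely presentable) objects such that every object is a filtered colimit of objects in this set. Let $e:\operatorname{Shv}(I,\mathcal{E})\to\operatorname{Fun}(I^o,\mathcal{E})$ be the embedding of the category of $\mathcal{E}$-valued sheaves on $I$, let $a:\operatorname{Fun}(I^o,\mathcal{E})\to\operatorname{Shv}(I,\mathcal{E})$ be the associated sheaf functor, left adjoint to $e$, and let $R^ne$, $n\ge 0$, be the right derived functors of the left exact functor $e$. For $i\in I$, a hypercovering of $i$ is a simplicial object $X:\Delta^o\to I/i$ such that for every $n\ge 0$ the limit $\operatorname{Hom}(\partial\Delta_n,X)=\lim_{[k]\to[n]\text{ not surjective}}X_k$ exists in $I/i$ and the natural map $X_n\to\operatorname{Hom}(\partial\Delta_n,X)$ is in $F$. Let $\operatorname{HCov}(i)\subset\operatorname{Fun}(\Delta^o,I/i)$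 be the full subcategory spanned by hypercoverings, and let $HC(i)$ be the category with the same objects, whose morphisms are the morphisms of $\operatorname{HCov}(i)$ modulo chain homotopy (two maps are identified if they are connected by a finite chain of simplicial homotopies over $i$, in either direction). For a functor $E:I^o\to\mathcal{E}$ and a hypercovering $X$ of $i$, let $C^\bullet(E(X))$ be the normalized cochain complex of the cosimplicial object $E(X_\bullet)$ of $\mathcal{E}$; its cohomology objects define functors $HC(i)^o\to\mathcal{E}$. The $n$-th Dold-derived functor $D^n(E):I^o\to\mathcal{E}$ is given by $$ D^n(E)(i)=\operatorname{colim}_{X\in HC(i)^o}H^n(C^\bullet(E(X))), $$ where the maps $D^n(E)(i)\to D^n(E)(i')$ for $i'\to i$ are induced by pulling back hypercoverings of $i$ to hypercoverings of $i'$. Then for every $n\ge 0$ there is an isomorphism $$ D^n(E)\cong R^ne(a(E)) $$ in $\operatorname{Fun}(I^o,\mathcal{E})$, functorial in $E\in\operatorname{Fun}(I^o,\mathcal{E})$. -/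

import Mathlib

open CategoryTheory Limits Opposite
open scoped Simplicial

universe w u v

namespace HyperDold

section FinitelyPresentable

variable (E : Type u) [Category.{w} E]

theorem exists_compactGenerator [IsLocallyFinitelyPresentable.{w} E] : ∃ (P : ObjectProperty E), ObjectProperty.Small.{w} P ∧
    (∀ X, P X → IsFinitelyPresentable.{w} X) ∧ P.IsSeparating ∧
    ∀ X : E, ∃ (J : Type w) (_ : SmallCategory J), P.colimitsOfShape J X := by
  have h0 : Fact (Cardinal.aleph0.{w}).IsRegular := Cardinal.fact_isRegular_aleph0
  obtain ⟨P', hP', h'⟩ := HasCardinalFilteredGenerator.exists_generator E Cardinal.aleph0.{w}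
  obtain ⟨P, _, h₁, h₂⟩ := ObjectProperty.EssentiallySmall.exists_small_le P'
  have h : P.IsCardinalFilteredGenerator Cardinal.aleph0.{w} :=
    h'.of_le_isoClosure h₂ (h₁.trans h'.le_isCardinalPresentable)
  refine ⟨P, inferInstance, fun X hX => h.le_isCardinalPresentable X hX,
    h.isStrongGenerator.isSeparating, fun X => ?_⟩
  obtain ⟨J, i, _, hJ⟩ := h.exists_colimitsOfShape X
  exact ⟨J, i, hJ⟩

instance hasColimits_of_lfp [IsLocallyFinitelyPresentable.{w} E] : HasColimitsOfSize.{w, w} E :=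
  IsCardinalLocallyPresentable.toHasColimitsOfSize Cardinal.aleph0.{w}

instance isGrothendieckAbelian_of_lfp [Abelian E] [IsLocallyFinitelyPresentable.{w} E] :
    IsGrothendieckAbelian.{w} E where
  hasFilteredColimitsOfSize := inferInstance
  ab5OfSize := by
    obtain ⟨P, _, hP, hs, _⟩ := exists_compactGenerator E
    refine ⟨fun K _ _ => ?_⟩
    have : (colim (J := K) (C := E)).PreservesMonomorphisms := by
      refine ⟨fun {A B} α hα => ?_⟩
      rw [hs.mono_iff]
      intro G hG g₁ g₂ h
      have := hP G hG
      obtain ⟨j₁, f₁, rfl⟩ :=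
        IsFinitelyPresentable.exists_hom_of_isColimit (colimit.isColimit A) g₁
      obtain ⟨j₂, f₂, rfl⟩ :=
        IsFinitelyPresentable.exists_hom_of_isColimit (colimit.isColimit A) g₂
      obtain ⟨k, u, v, e⟩ := IsFinitelyPresentable.exists_eq_of_isColimit (colimit.isColimit B)
        (f₁ ≫ α.app j₁) (f₂ ≫ α.app j₂) (by simpa using h)
      have e' : f₁ ≫ A.map u = f₂ ≫ A.map v := by
        rw [← cancel_mono (α.app k)]
        simpa using e
      have := congr($e' ≫ colimit.ι A k)
      simpa using this
    exact hasExactColimitsOfShape_of_preservesMono E K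
  hasSeparator := by
    obtain ⟨P, _, hP, hs, _⟩ := exists_compactGenerator E
    let f : Shrink.{w} (Subtype P) → E := fun x => ((equivShrink _).symm x).1
    refine ⟨∐ f, (isSeparator_sigma f).2 (hs.of_le fun X hX => ?_)⟩
    exact (ObjectProperty.ofObj_iff _ _).2 ⟨equivShrink _ ⟨X, hX⟩, by simp [f]⟩

variable {I : Type w} [SmallCategory I] (J : GrothendieckTopology I)

theorem isSheaf_of_compactGenerator {P : ObjectProperty E}
    (hP : ∀ X : E, ∃ (K : Type w) (_ : SmallCategory K), P.colimitsOfShape K X)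
    (Q : Iᵒᵖ ⥤ E) (hQ : ∀ G, P G → Presieve.IsSheaf J (Q ⋙ coyoneda.obj (op G))) :
    Presheaf.IsSheaf J Q := by
  intro X U S hS x hx
  obtain ⟨K, _, ⟨p⟩⟩ := hP X
  have hG (k : K) := hQ _ (p.prop_diag_obj k)
  have hc (k : K) : Presieve.FamilyOfElements.Compatible
      (P := Q ⋙ coyoneda.obj (op (p.diag.obj k))) (R := S.arrows)
      (fun Y f hf => p.ι.app k ≫ x f hf) := by
    intro Y₁ Y₂ Z g₁ g₂ f₁ f₂ h₁ h₂ e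
    have h : x f₁ h₁ ≫ Q.map g₁.op = x f₂ h₂ ≫ Q.map g₂.op := hx g₁ g₂ h₁ h₂ e
    change (p.ι.app k ≫ x f₁ h₁) ≫ Q.map g₁.op = (p.ι.app k ≫ x f₂ h₂) ≫ Q.map g₂.op
    rw [Category.assoc, Category.assoc, h]
  let t (k : K) : p.diag.obj k ⟶ Q.obj (op U) := (hG k S hS).amalgamate _ (hc k)
  have ht (k : K) {Y : I} (f : Y ⟶ U) (hf : S f) : t k ≫ Q.map f.op = p.ι.app k ≫ x f hf :=
    (hG k S hS).valid_glue (hc k) f hf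
  have hsep (k : K) (a b : p.diag.obj k ⟶ Q.obj (op U))
      (h : ∀ {Y : I} (f : Y ⟶ U), S f → a ≫ Q.map f.op = b ≫ Q.map f.op) : a = b :=
    (hG k S hS).isSeparatedFor.ext fun Y f hf => h f hf
  obtain ⟨d, hd⟩ : ∃ d : X ⟶ Q.obj (op U), ∀ k, p.ι.app k ≫ d = t k := by
    refine ⟨p.isColimit.desc ⟨_, ⟨t, ?_⟩⟩, fun k => p.isColimit.fac _ k⟩
    intro k l u
    refine hsep _ _ _ fun f hf => ?_
    simp [ht _ f hf]
  refine ⟨d, ?_, ?_⟩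
  · intro Y f hf
    refine p.isColimit.hom_ext fun k => ?_
    change p.ι.app k ≫ d ≫ Q.map f.op = p.ι.app k ≫ x f hf
    rw [← Category.assoc, hd, ht]
  · intro y hy
    refine p.isColimit.hom_ext fun k => ?_
    refine hsep _ _ _ fun f hf => ?_
    have h : y ≫ Q.map f.op = x f hf := hy f hf
    change (p.ι.app k ≫ y) ≫ Q.map f.op = (p.ι.app k ≫ d) ≫ Q.map f.op
    rw [Category.assoc, h, hd, ht]

variable [Abelian E] [IsLocallyFinitelyPresentable.{w} E]

theorem sheafify_isSheaf_of_lfp (Q : Iᵒᵖ ⥤ E) : Presheaf.IsSheaf J (J.sheafify Q) := by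
  obtain ⟨P, _, hP, _, hc⟩ := exists_compactGenerator E
  refine isSheaf_of_compactGenerator E J hc _ fun G hG => ?_
  have := hP G hG
  have (X : I) : PreservesColimitsOfShape (J.Cover X)ᵒᵖ (coyoneda.obj (op G)) :=
    PreservesFilteredColimitsOfSize.preserves_filtered_colimits _
  refine Presieve.isSheaf_iso J (J.sheafifyCompIso (coyoneda.obj (op G)) Q).symm ?_
  rw [← isSheaf_iff_isSheaf_of_type]
  exact J.sheafify_isSheaf _

instance preservesFiniteLimits_plusFunctor_of_lfp : PreservesFiniteLimits (J.plusFunctor E) := by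
  refine ⟨fun K _ _ => preservesLimitsOfShape_of_evaluation _ _ fun X => ?_⟩
  have : PreservesLimitsOfShape K (J.diagramFunctor E X.unop ⋙ colim) := inferInstance
  exact this

/-- The associated sheaf functor exists for every Grothendieck topology on a small category,
with values in a locally finitely presentable abelian category, and it is exact. -/
instance hasSheafify_of_lfp : HasSheafify J E :=
  let F : (Iᵒᵖ ⥤ E) ⥤ Sheaf J E :=
    { obj P := ⟨J.sheafify P, sheafify_isSheaf_of_lfp E J P⟩
      map η := ⟨J.sheafifyMap η⟩ }
  have : PreservesFiniteLimits (F ⋙ sheafToPresheaf J E) :=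
    comp_preservesFiniteLimits (J.plusFunctor E) (J.plusFunctor E)
  have : PreservesFiniteLimits F :=
    preservesFiniteLimits_of_reflects_of_preserves F (sheafToPresheaf J E)
  HasSheafify.mk' J E (F := F) <| Adjunction.mkOfHomEquiv
    { homEquiv := fun P Q =>
        { toFun := fun e => J.toSheafify P ≫ e.hom
          invFun := fun e => ⟨J.sheafifyLift e Q.2⟩
          left_inv := fun _ => Sheaf.hom_ext <| (J.sheafifyLift_unique _ _ _ rfl).symm
          right_inv := fun _ => J.toSheafify_sheafifyLift _ _ }
      homEquiv_naturality_left_symm := by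
        intro P Q R η γ; ext1; dsimp; symm
        apply J.sheafifyMap_sheafifyLift
      homEquiv_naturality_right := fun η γ => by
        dsimp
        rw [Category.assoc] }


end FinitelyPresentable
/-- The topology defined by a class `F` of maps that contains the identities, is closed under
compositions, and has and is stable under pullbacks: a sieve on `X` is covering if and only if it
contains some map `Y ⟶ X` in `F`. -/
def topology {I : Type u} [Category.{v} I] (F : MorphismProperty I) [F.IsMultiplicative] [F.HasPullbacks]
    [F.IsStableUnderBaseChange] : GrothendieckTopology I where
  sieves X := {S | ∃ (Y : I) (f : Y ⟶ X), F f ∧ S f}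
  top_mem' X := ⟨X, 𝟙 X, F.id_mem X, trivial⟩
  pullback_stable' := by
    rintro X Y S g ⟨Z, f, hf, hS⟩
    have := F.hasPullback g hf
    refine ⟨_, pullback.snd f g, F.pullback_snd _ _ hf, ?_⟩
    change S (pullback.snd f g ≫ g)
    rw [← pullback.condition]
    exact S.downward_closed hS _
  transitive' := by
    rintro X S ⟨Y, f, hf, hS⟩ R h
    obtain ⟨Z, g, hg, hR⟩ := h hS
    exact ⟨Z, g ≫ f, F.comp_mem _ _ hg hf, hR⟩

section Matching
variable {C : Type u} [Category.{v} C]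

/-- The boundary `∂Δ_n ⊂ Δ_n`, as the sieve on `[n]` of all maps that are not surjective. -/
def boundary (n : ℕ) : Sieve ⦋n⦌ where
  arrows _ f := ¬ Epi f
  downward_closed {_ _ f} hf g := fun _ => hf (epi_of_epi g f)

/-- For a simplicial subset `S ⊂ Δ_n` (a sieve on `[n]`), the diagram `([k] ⟶ [n]) ↦ X_k`, indexed
by the opposite of the category of simplices of `S`, whose limit is `Hom(S, X)`. -/
abbrev sieveDiagram (X : SimplicialObject C) {n : ℕ} (S : Sieve ⦋n⦌) :
    (S.arrows.category)ᵒᵖ ⥤ C :=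
  S.arrows.diagram.op ⋙ X

/-- The canonical cone on `X_n` over the diagram that defines `Hom(S, X)`. -/
@[simps]
def sieveCone (X : SimplicialObject C) {n : ℕ} (S : Sieve ⦋n⦌) : Cone (sieveDiagram X S) where
  pt := X.obj (op ⦋n⦌)
  π := { app := fun f => X.map f.unop.obj.hom.op
         naturality := fun f g u => by
          simp [← X.map_comp, ← op_comp] }

/-- The canonical map `X_n ⟶ Hom(S, X)`, for any chosen limit `c` that represents `Hom(S, X)`. -/
def matchingMap {X : SimplicialObject C} {n : ℕ} {S : Sieve ⦋n⦌} {c : Cone (sieveDiagram X S)}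
    (hc : IsLimit c) : X.obj (op ⦋n⦌) ⟶ c.pt :=
  hc.lift (sieveCone X S)

/-- For every `n ≥ 0`, the limit `Hom(∂Δ_n, X)` exists in `C`, and the canonical map
`X_n ⟶ Hom(∂Δ_n, X)` is in `P`. -/
def IsReedy (P : MorphismProperty C) (X : SimplicialObject C) : Prop :=
  ∀ n : ℕ, ∃ (c : Cone (sieveDiagram X (boundary n))) (hc : IsLimit c),
    P (matchingMap hc)

/-- The component at `f : [k] ⟶ [n]` of a cone over `sieveDiagram X S`. -/
def proj {X : SimplicialObject C} {n : ℕ} {S : Sieve ⦋n⦌} (c : Cone (sieveDiagram X S))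
    {k : SimplexCategory} (f : k ⟶ ⦋n⦌) (hf : S f) : c.pt ⟶ X.obj (op k) :=
  c.π.app (op (S.arrows.categoryMk f hf))

theorem proj_w {X : SimplicialObject C} {n : ℕ} {S : Sieve ⦋n⦌}
    (c : Cone (sieveDiagram X S)) {k l : SimplexCategory} (f : k ⟶ ⦋n⦌) (hf : S f) (g : l ⟶ k)
    (h : l ⟶ ⦋n⦌) (hh : S h) (e : g ≫ f = h) :
    proj c f hf ≫ X.map g.op = proj c h hh := by
  subst e
  let u : S.arrows.categoryMk (g ≫ f) hh ⟶ S.arrows.categoryMk f hf :=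
    ObjectProperty.homMk (Over.homMk g)
  exact c.w u.op

theorem proj_hom_ext {X : SimplicialObject C} {n : ℕ} {S : Sieve ⦋n⦌}
    {c : Cone (sieveDiagram X S)} (hc : IsLimit c) {T : C} {a b : T ⟶ c.pt}
    (h : ∀ {k : SimplexCategory} (f : k ⟶ ⦋n⦌) (hf : S f), a ≫ proj c f hf = b ≫ proj c f hf) :
    a = b :=
  hc.hom_ext fun f => h f.unop.obj.hom f.unop.property

/-- A cone over `sieveDiagram X S` given by a compatible family of morphisms. -/
def coneOfFamily (X : SimplicialObject C) {n : ℕ} (S : Sieve ⦋n⦌) (T : C)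
    (x : ∀ {k : SimplexCategory} (f : k ⟶ ⦋n⦌), S f → (T ⟶ X.obj (op k)))
    (hx : ∀ {k l : SimplexCategory} (f : k ⟶ ⦋n⦌) (hf : S f) (g : l ⟶ k),
      x f hf ≫ X.map g.op = x (g ≫ f) (S.downward_closed hf g)) :
    Cone (sieveDiagram X S) where
  pt := T
  π := { app := fun f => x f.unop.obj.hom f.unop.property
         naturality := fun f g u => by
          have e : u.unop.hom.left ≫ f.unop.obj.hom = g.unop.obj.hom := Over.w u.unop.hom
          have := hx f.unop.obj.hom f.unop.property u.unop.hom.left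
          dsimp at this ⊢
          rw [Category.id_comp]
          simp only [e] at this
          exact this.symm }

theorem matchingMap_proj {X : SimplicialObject C} {n : ℕ} {S : Sieve ⦋n⦌}
    {c : Cone (sieveDiagram X S)} (hc : IsLimit c) {k : SimplexCategory} (f : k ⟶ ⦋n⦌)
    (hf : S f) : matchingMap hc ≫ proj c f hf = X.map f.op :=
  hc.fac _ _

theorem exists_lift {X : SimplicialObject C} {n : ℕ} {S : Sieve ⦋n⦌}
    {c : Cone (sieveDiagram X S)} (hc : IsLimit c) {T : C}
    (x : ∀ {k : SimplexCategory} (f : k ⟶ ⦋n⦌), S f → (T ⟶ X.obj (op k)))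
    (hx : ∀ {k l : SimplexCategory} (f : k ⟶ ⦋n⦌) (hf : S f) (g : l ⟶ k),
      x f hf ≫ X.map g.op = x (g ≫ f) (S.downward_closed hf g)) :
    ∃ t : T ⟶ c.pt, ∀ {k : SimplexCategory} (f : k ⟶ ⦋n⦌) (hf : S f),
      t ≫ proj c f hf = x f hf :=
  ⟨hc.lift (coneOfFamily X S T x hx), fun _ _ => hc.fac _ _⟩

theorem exists_isLimit {X : SimplicialObject C} {n : ℕ} {S : Sieve ⦋n⦌} (M : C)
    (x : ∀ {k : SimplexCategory} (f : k ⟶ ⦋n⦌), S f → (M ⟶ X.obj (op k)))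
    (hx : ∀ {k l : SimplexCategory} (f : k ⟶ ⦋n⦌) (hf : S f) (g : l ⟶ k),
      x f hf ≫ X.map g.op = x (g ≫ f) (S.downward_closed hf g))
    (hl : ∀ (s : Cone (sieveDiagram X S)), ∃ t : s.pt ⟶ M,
      ∀ {k : SimplexCategory} (f : k ⟶ ⦋n⦌) (hf : S f), t ≫ x f hf = proj s f hf)
    (hu : ∀ {T : C} (a b : T ⟶ M), (∀ {k : SimplexCategory} (f : k ⟶ ⦋n⦌) (hf : S f),
      a ≫ x f hf = b ≫ x f hf) → a = b) :
    Nonempty (IsLimit (coneOfFamily X S M x hx)) := by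
  choose t ht using hl
  exact ⟨{ lift := t
           fac := fun s f => ht s f.unop.obj.hom f.unop.property
           uniq := fun s q hq => hu _ _ fun f hf =>
            (hq (op (S.arrows.categoryMk f hf))).trans (ht s f hf).symm }⟩

theorem exists_limit_step {P : MorphismProperty C} [P.HasPullbacks]
    [P.IsStableUnderBaseChange] {X : SimplicialObject C} (hX : IsReedy P X)
    {n : ℕ} (S₀ S₁ : Sieve ⦋n⦌) {k : ℕ} (m : ⦋k⦌ ⟶ ⦋n⦌) [Mono m] (hm : ¬ S₀ m)
    (hb : ∀ {l : SimplexCategory} (g : l ⟶ ⦋k⦌), boundary k g → S₀ (g ≫ m))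
    (h₁ : ∀ {l : SimplexCategory} (f : l ⟶ ⦋n⦌), S₁ f ↔ S₀ f ∨ ∃ g, g ≫ m = f)
    (c₀ : Cone (sieveDiagram X S₀)) (hc₀ : IsLimit c₀) :
    ∃ (c₁ : Cone (sieveDiagram X S₁)) (_ : IsLimit c₁) (r : c₁.pt ⟶ c₀.pt), P r := by
  obtain ⟨b, hb', hP⟩ := hX k
  obtain ⟨ρ, hρ⟩ : ∃ ρ : c₀.pt ⟶ b.pt, ∀ {l : SimplexCategory} (g : l ⟶ ⦋k⦌) (hg : boundary k g),
      ρ ≫ proj b g hg = proj c₀ (g ≫ m) (hb g hg) :=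
    exists_lift hb' (fun g hg => proj c₀ (g ≫ m) (hb g hg))
      (fun f hf g => proj_w c₀ _ _ _ _ _ (Category.assoc _ _ _).symm)
  obtain ⟨lam, hP, hlam⟩ : ∃ lam : X.obj (op ⦋k⦌) ⟶ b.pt, P lam ∧
      ∀ {l : SimplexCategory} (g : l ⟶ ⦋k⦌) (hg : boundary k g),
        lam ≫ proj b g hg = X.map g.op :=
    ⟨_, hP, fun g hg => hb'.fac _ _⟩
  have := P.hasPullback ρ hP
  have hsec {l : SimplexCategory} (g : l ⟶ ⦋k⦌) (hg : S₀ (g ≫ m)) : boundary k g := by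
    intro h
    have := isSplitEpi_of_epi g
    exact hm (by simpa using S₀.downward_closed hg (section_ g))
  have key {l : SimplexCategory} (g : l ⟶ ⦋k⦌) (hg : S₀ (g ≫ m)) :
      pullback.snd lam ρ ≫ proj c₀ (g ≫ m) hg = pullback.fst lam ρ ≫ X.map g.op := by
    rw [← hlam g (hsec g hg), ← hρ g (hsec g hg), pullback.condition_assoc]
  classical
  let x {l : SimplexCategory} (f : l ⟶ ⦋n⦌) (hf : S₁ f) : pullback lam ρ ⟶ X.obj (op l) :=
    if h : S₀ f then pullback.snd lam ρ ≫ proj c₀ f h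
    else pullback.fst lam ρ ≫ X.map (((h₁ f).1 hf).resolve_left h).choose.op
  have x₀ {l : SimplexCategory} (f : l ⟶ ⦋n⦌) (hf : S₁ f) (h : S₀ f) :
      x f hf = pullback.snd lam ρ ≫ proj c₀ f h := dif_pos h
  have x₁ {l : SimplexCategory} (g : l ⟶ ⦋k⦌) (hf : S₁ (g ≫ m)) :
      x (g ≫ m) hf = pullback.fst lam ρ ≫ X.map g.op := by
    by_cases h : S₀ (g ≫ m)
    · rw [x₀ _ hf h, key]
    · have e := (((h₁ _).1 hf).resolve_left h).choose_spec
      rw [cancel_mono] at e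
      simp only [x, dif_neg h, e]
  have hS {l : SimplexCategory} (f : l ⟶ ⦋n⦌) (h : S₀ f) : S₁ f := (h₁ f).2 (.inl h)
  have hmS : S₁ m := (h₁ m).2 (.inr ⟨𝟙 _, by simp⟩)
  have xm : x m hmS = pullback.fst lam ρ := by
    have := x₁ (𝟙 _) (by simpa using hmS)
    simpa using this
  obtain ⟨hc₁⟩ := exists_isLimit (X := X) (S := S₁) (pullback lam ρ) x (by
    intro l l' f hf g
    by_cases h : S₀ f
    · rw [x₀ f hf h, x₀ (g ≫ f) (S₁.downward_closed hf g) (S₀.downward_closed h g), Category.assoc,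
        proj_w c₀ f h g _ _ rfl]
    · obtain ⟨f', rfl⟩ := ((h₁ _).1 hf).resolve_left h
      have := x₁ (g ≫ f') (by simpa using S₁.downward_closed hf g)
      simp only [Category.assoc] at this
      rw [this, x₁ f' hf]
      simp) (by
    intro s
    obtain ⟨t, ht⟩ := exists_lift hc₀ (fun f hf => proj s f (hS f hf))
      (fun f hf g => proj_w s _ _ _ _ _ rfl)
    have hcond : proj s m hmS ≫ lam = t ≫ ρ := by
      refine proj_hom_ext hb' fun g hg => ?_
      rw [Category.assoc, Category.assoc, hlam, hρ, ht]
      exact proj_w s m hmS g _ _ rfl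
    refine ⟨pullback.lift _ _ hcond, fun f hf => ?_⟩
    by_cases h : S₀ f
    · rw [x₀ f hf h, pullback.lift_snd_assoc, ht]
    · obtain ⟨g, rfl⟩ := ((h₁ _).1 hf).resolve_left h
      rw [x₁ g hf, pullback.lift_fst_assoc]
      exact proj_w s m hmS g _ _ rfl) (by
    intro T p q h
    refine pullback.hom_ext ?_ ?_
    · rw [← xm, h m hmS]
    · refine proj_hom_ext hc₀ fun f hf => ?_
      rw [Category.assoc, Category.assoc, ← x₀ f (hS f hf), h f (hS f hf)])
  exact ⟨_, hc₁, pullback.snd lam ρ, P.pullback_snd _ _ hP⟩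

theorem exists_missing_face {n : ℕ} {S S₀ : Sieve ⦋n⦌} (hS₀ : S₀ ≤ S) (hne : S₀ ≠ S) :
    ∃ (k : ℕ) (m : ⦋k⦌ ⟶ ⦋n⦌), Mono m ∧ S m ∧ ¬ S₀ m ∧
      ∀ {l : SimplexCategory} (g : l ⟶ ⦋k⦌), boundary k g → S₀ (g ≫ m) := by
  classical
  have hex : ∃ (k : ℕ) (m : ⦋k⦌ ⟶ ⦋n⦌), S m ∧ ¬ S₀ m := by
    by_contra! h
    exact hne (le_antisymm hS₀ fun Y f hf => h Y.len f hf)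
  obtain ⟨m, hm, hm₀⟩ := Nat.find_spec hex
  have hmin {j : ℕ} (hj : j < Nat.find hex) (f : ⦋j⦌ ⟶ ⦋n⦌) (hf : S f) : S₀ f := by
    by_contra h
    exact Nat.find_min hex hj ⟨f, hf, h⟩
  generalize Nat.find hex = k at m hm hm₀ hmin
  refine ⟨k, m, ?_, hm, hm₀, fun {l} g hg => ?_⟩
  · rw [SimplexCategory.mono_iff_injective]
    by_contra h
    cases k with
    | zero => exact h fun a b _ => Subsingleton.elim (α := Fin 1) a b
    | succ k =>
      obtain ⟨i, m', rfl⟩ := SimplexCategory.eq_σ_comp_of_not_injective m h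
      have h' := hmin (Nat.lt_succ_self k) (SimplexCategory.δ i.castSucc ≫ _)
        (S.downward_closed hm (SimplexCategory.δ i.castSucc))
      rw [SimplexCategory.δ_comp_σ_self_assoc] at h'
      exact hm₀ (S₀.downward_closed h' _)
  · have hg' : ¬ Function.Surjective g.toOrderHom := fun h =>
      hg (SimplexCategory.epi_iff_surjective.2 h)
    cases k with
    | zero => exact (hg' fun y => ⟨0, Subsingleton.elim (α := Fin 1) _ _⟩).elim
    | succ k =>
      obtain ⟨i, g', rfl⟩ := SimplexCategory.eq_comp_δ_of_not_surjective g hg'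
      rw [Category.assoc]
      exact S₀.downward_closed (hmin (Nat.lt_succ_self k) _ (S.downward_closed hm _)) _

/-- The simplices of dimension at most `n` that lie in `S` and not in `S₀`. -/
def missingFaces {n : ℕ} (S S₀ : Sieve ⦋n⦌) :
    Set (Sigma fun k : Fin (n + 1) => (⦋(k : ℕ)⦌ ⟶ ⦋n⦌)) :=
  Set.ofPred fun f => S f.2 ∧ ¬ S₀ f.2

theorem exists_limit_aux {P : MorphismProperty C} [P.IsMultiplicative] [P.HasPullbacks]
    [P.IsStableUnderBaseChange] {X : SimplicialObject C} (hX : IsReedy P X)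
    {T : C} (hT : IsTerminal T) {n : ℕ} (S : Sieve ⦋n⦌) (N : ℕ) (S₀ : Sieve ⦋n⦌) (hS₀ : S₀ ≤ S)
    (hN : (missingFaces S S₀).ncard ≤ N)
    (c₀ : Cone (sieveDiagram X S₀)) (hc₀ : IsLimit c₀) (h₀ : P (hT.from c₀.pt)) :
    ∃ (c : Cone (sieveDiagram X S)) (_ : IsLimit c), P (hT.from c.pt) := by
  induction N generalizing S₀ with
  | zero =>
    by_cases hne : S₀ = S
    · subst hne
      exact ⟨c₀, hc₀, h₀⟩
    · obtain ⟨k, m, _, hm, hm₀, -⟩ := exists_missing_face hS₀ hne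
      rw [Nat.le_zero, Set.ncard_eq_zero (Set.toFinite _)] at hN
      have hk : k < n + 1 := Nat.lt_succ_of_le (SimplexCategory.le_of_mono m)
      exact absurd (show Sigma.mk ⟨k, hk⟩ m ∈ missingFaces S S₀
        from ⟨hm, hm₀⟩) (Set.eq_empty_iff_forall_notMem.1 hN _)
  | succ N ih =>
    by_cases hne : S₀ = S
    · subst hne
      exact ⟨c₀, hc₀, h₀⟩
    · obtain ⟨k, m, _, hm, hm₀, hb⟩ := exists_missing_face hS₀ hne
      have hk : k < n + 1 := Nat.lt_succ_of_le (SimplexCategory.le_of_mono m)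
      let S₁ : Sieve ⦋n⦌ :=
        { arrows := fun l f => S₀ f ∨ ∃ g, g ≫ m = f
          downward_closed := by
            rintro Y Z f (hf | ⟨g, rfl⟩) h
            · exact .inl (S₀.downward_closed hf h)
            · exact .inr ⟨h ≫ g, Category.assoc _ _ _⟩ }
      obtain ⟨c₁, hc₁, r, hr⟩ := exists_limit_step hX S₀ S₁ m hm₀ hb (fun _ => Iff.rfl) c₀ hc₀
      refine ih S₁ ?_ ?_ c₁ hc₁ ?_
      · rintro Y f (hf | ⟨g, rfl⟩)
        · exact hS₀ _ hf
        · exact S.downward_closed hm g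
      · refine Nat.le_of_lt_succ (lt_of_lt_of_le (Set.ncard_lt_ncard ?_ (Set.toFinite _)) hN)
        refine ⟨fun f hf => ⟨hf.1, fun h => hf.2 (.inl h)⟩, fun h => ?_⟩
        exact (h (show Sigma.mk ⟨k, hk⟩ m ∈ missingFaces S S₀
          from ⟨hm, hm₀⟩)).2 (.inr ⟨𝟙 _, Category.id_comp _⟩)
      · rw [← hT.hom_ext (r ≫ hT.from c₀.pt) (hT.from c₁.pt)]
        exact P.comp_mem _ _ hr h₀

/-- The limits `Hom(S, X)` exist for all `S ⊂ Δ_n`, with structure map to the terminal object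
in `P`. -/
theorem exists_limit {P : MorphismProperty C} [P.IsMultiplicative] [P.HasPullbacks]
    [P.IsStableUnderBaseChange] {X : SimplicialObject C} (hX : IsReedy P X)
    {T : C} (hT : IsTerminal T) {n : ℕ} (S : Sieve ⦋n⦌) :
    ∃ (c : Cone (sieveDiagram X S)) (_ : IsLimit c), P (hT.from c.pt) := by
  refine exists_limit_aux hX hT S _ ⊥ bot_le le_rfl
    (coneOfFamily X ⊥ T (fun f hf => hf.elim) (fun f hf => hf.elim)) ?_ ?_
  · exact
      { lift := fun s => hT.from _
        fac := fun s f => f.unop.property.elim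
        uniq := fun s q hq => hT.hom_ext _ _ }
  · change P (hT.from T)
    rw [hT.hom_ext (hT.from T) (𝟙 T)]
    exact P.id_mem T

end Matching

section Hypercovering

variable {I : Type u} [Category.{v} I] (F : MorphismProperty I)

/-- The maps of `I/i` whose underlying map in `I` is in `F`. -/
abbrev overClass (i : I) : MorphismProperty (Over i) := F.inverseImage (Over.forget i)

instance overClass_hasPullbacks [F.HasPullbacks] (i : I) : (overClass F i).HasPullbacks where
  hasPullback {X Y Z f} g hf := by
    have : HasPullback f.left g.left := F.hasPullback g.left hf
    have : HasLimit (cospan ((Over.forget i).map f) ((Over.forget i).map g)) := this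
    have : HasLimit (cospan f g ⋙ Over.forget i) :=
      hasLimit_of_iso (cospanCompIso (Over.forget i) f g).symm
    exact hasLimit_of_created (cospan f g) (Over.forget i)

instance overClass_isStable [F.IsStableUnderBaseChange] (i : I) :
    (overClass F i).IsStableUnderBaseChange where
  of_isPullback h hg := F.of_isPullback (h.map (Over.forget i)) hg

/-- If `X` is a hypercovering of `i`, then the augmentations of `X_n` and `Hom(∂Δ_n, X)`
to `i` are in `F`. -/
theorem isReedy_hom_mem [F.IsMultiplicative] [F.HasPullbacks] [F.IsStableUnderBaseChange] {i : I}
    {X : SimplicialObject (Over i)} (hX : IsReedy (overClass F i) X) (n : ℕ) :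
    ∃ (c : Cone (sieveDiagram X (boundary n))) (hc : IsLimit c),
      F c.pt.hom ∧ F (matchingMap hc).left ∧ F (X.obj (op ⦋n⦌)).hom := by
  obtain ⟨c₀, hc₀, h₀⟩ := hX n
  obtain ⟨c, hc, h⟩ := exists_limit hX Over.mkIdTerminal (boundary n)
  have e : (Over.mkIdTerminal.from c.pt).left = c.pt.hom := by
    simp
  have h₁ : F c.pt.hom := by
    rw [← e]; exact h
  have h₂ : (overClass F i) (matchingMap hc) := by
    have := (overClass F i).comp_mem _ (hc₀.conePointUniqueUpToIso hc).hom h₀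
      (MorphismProperty.of_isIso _ _)
    have e : matchingMap hc₀ ≫ (hc₀.conePointUniqueUpToIso hc).hom =
      matchingMap hc := proj_hom_ext hc fun g hg => by
        have e' : (hc₀.conePointUniqueUpToIso hc).hom ≫ proj c g hg = proj c₀ g hg :=
          hc₀.conePointUniqueUpToIso_hom_comp hc _
        rw [Category.assoc, e', matchingMap_proj, matchingMap_proj]
    rwa [e] at this
  refine ⟨c, hc, h₁, h₂, ?_⟩
  rw [← Over.w (matchingMap hc)]
  exact F.comp_mem _ _ h₂ h₁

/-- The simplicial object `Y` in `I/i'`, viewed as a simplicial object in `I/i` via `f : i' ⟶ i`. -/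
abbrev pushforward {i' i : I} (f : i' ⟶ i) (Y : SimplicialObject (Over i')) :
    SimplicialObject (Over i) :=
  ((SimplicialObject.whiskering _ _).obj (Over.map f)).obj Y

/-- A hypercovering of `i` can be pulled back along `f : i' ⟶ i`. -/
theorem exists_baseChange [F.IsMultiplicative] [F.HasPullbacks] [F.IsStableUnderBaseChange]
    {i' i : I} (f : i' ⟶ i) {X : SimplicialObject (Over i)} (hX : IsReedy (overClass F i) X) :
    ∃ (Y : SimplicialObject (Over i')) (_ : IsReedy (overClass F i') Y) (φ : pushforward f Y ⟶ X),
      ∀ (Z : SimplicialObject (Over i')) (ψ : pushforward f Z ⟶ X),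
        ∃! t : Z ⟶ Y, ((SimplicialObject.whiskering _ _).obj (Over.map f)).map t ≫ φ = ψ := by
  have ex (U : Over i) (hU : F U.hom) : ∃ (V : Over i') (e : (Over.map f).obj V ⟶ U),
      IsPullback e.left V.hom U.hom f := by
    have := F.hasPullback f hU
    exact ⟨Over.mk (pullback.snd U.hom f),
      Over.homMk (pullback.fst U.hom f) pullback.condition, IsPullback.of_hasPullback _ _⟩
  choose G ε hε using ex
  have lift {U : Over i} (hU : F U.hom) {Z : Over i'} (z : (Over.map f).obj Z ⟶ U) :
      ∃ t : Z ⟶ G U hU, (Over.map f).map t ≫ ε U hU = z := by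
    refine ⟨Over.homMk ((hε U hU).lift z.left Z.hom (Over.w z)) ((hε U hU).lift_snd _ _ _), ?_⟩
    ext
    exact (hε U hU).lift_fst _ _ _
  choose lift fac using @lift
  have uniq {U : Over i} (hU : F U.hom) {Z : Over i'} {a b : Z ⟶ G U hU}
      (h : (Over.map f).map a ≫ ε U hU = (Over.map f).map b ≫ ε U hU) : a = b := by
    ext
    refine (hε U hU).hom_ext ?_ ?_
    · exact congr_arg CommaMorphism.left h
    · rw [Over.w, Over.w]
  have hXm (m : SimplexCategoryᵒᵖ) : F (X.obj m).hom := by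
    obtain ⟨_, _, _, _, h⟩ := isReedy_hom_mem F hX m.unop.len
    exact h
  let Y : SimplicialObject (Over i') :=
    { obj m := G _ (hXm m)
      map {m m'} θ := lift (hXm m') (ε _ (hXm m) ≫ X.map θ)
      map_id m := uniq _ (by simp [fac])
      map_comp {a b c} θ θ' := uniq _ (by simp [fac, reassoc_of% fac]) }
  have Ymap {m m'} (θ : m ⟶ m') : (Over.map f).map (Y.map θ) ≫ ε _ (hXm m') =
    ε _ (hXm m) ≫ X.map θ := fac _ _
  refine ⟨Y, ?_, { app m := ε _ (hXm m), naturality m m' θ := Ymap θ }, ?_⟩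
  · intro n
    obtain ⟨c, hc, h₁, h₂, -⟩ := isReedy_hom_mem F hX n
    obtain ⟨hl⟩ := exists_isLimit (X := Y) (S := boundary n) (G c.pt h₁)
      (fun g hg => lift (hXm _) (ε _ h₁ ≫ proj c g hg))
      (fun g hg g' => uniq (hXm _) (by
        rw [Functor.map_comp, Category.assoc, Ymap, ← Category.assoc, fac, fac, Category.assoc,
          proj_w c g hg g' _ _ rfl])) (by
        intro s
        obtain ⟨t, ht⟩ := exists_lift hc (T := (Over.map f).obj s.pt)
          (fun g hg => (Over.map f).map (proj s g hg) ≫ ε _ (hXm _))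
          (fun g hg g' => by
            rw [Category.assoc, ← Ymap, ← Category.assoc, ← Functor.map_comp,
              proj_w s g hg g' _ _ rfl])
        refine ⟨lift h₁ t, fun g hg => uniq (hXm _) ?_⟩
        rw [Functor.map_comp, Category.assoc, fac, ← Category.assoc, fac, ht]) (by
        intro T a b h
        refine uniq h₁ (proj_hom_ext hc fun g hg => ?_)
        have := congr((Over.map f).map $(h g hg) ≫ ε _ (hXm _))
        simpa only [Functor.map_comp, Category.assoc, fac] using this)
    refine ⟨_, hl, ?_⟩
    set q : G _ (hXm (op ⦋n⦌)) ⟶ G c.pt h₁ := matchingMap hl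
    have e : (Over.map f).map q ≫ ε _ h₁ =
        ε _ (hXm (op ⦋n⦌)) ≫ matchingMap hc := by
      refine proj_hom_ext hc fun g hg => ?_
      have e₁ : matchingMap hc ≫ proj c g hg = X.map g.op := matchingMap_proj hc g hg
      have e₂ : q ≫ lift (hXm _) (ε _ h₁ ≫ proj c g hg) = Y.map g.op :=
        matchingMap_proj hl g hg
      have := congr((Over.map f).map $e₂ ≫ ε _ (hXm _))
      rw [Category.assoc, Category.assoc, e₁, ← Ymap]
      simpa only [Functor.map_comp, Category.assoc, fac] using this
    have sq : IsPullback (ε _ (hXm (op ⦋n⦌))).left q.left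
        (matchingMap hc).left (ε _ h₁).left := by
      refine IsPullback.of_bot ?_ (congr_arg CommaMorphism.left e).symm (hε _ h₁)
      have := hε _ (hXm (op ⦋n⦌))
      rwa [← Over.w q, ← Over.w (matchingMap hc)] at this
    exact F.of_isPullback sq h₂
  · intro Z ψ
    refine ⟨{ app m := lift (hXm m) (ψ.app m)
              naturality m m' θ := uniq (hXm _) ?_ }, ?_, ?_⟩
    · have e : (Over.map f).map (Z.map θ) ≫ ψ.app m' = ψ.app m ≫ X.map θ := ψ.naturality θ
      rw [Functor.map_comp, Functor.map_comp, Category.assoc, Category.assoc]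
      refine (congr(_ ≫ $(fac (hXm m') (ψ.app m')))).trans (e.trans ?_)
      exact (congr($(fac (hXm m) (ψ.app m)) ≫ X.map θ)).symm.trans
        ((Category.assoc _ _ _).trans (congr(_ ≫ $(Ymap θ))).symm)
    · ext1 m
      exact fac _ _
    · intro t ht
      ext1 m
      exact uniq (hXm m) ((congr_app ht m).trans (fac _ _).symm)

end Hypercovering

noncomputable section Dold

section Cohomology

variable {I : Type w} [SmallCategory I] {E : Type u} [Category.{w} E] [Abelian E]

/-- `H^n(C^•(P(X)))`, where `C^•` is the normalized cochain complex of the cosimplicial object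
`P(X)` of `E`, that is, the normalized chain complex of the simplicial object of `Eᵒᵖ`
given by `X` and `P.rightOp : I ⥤ Eᵒᵖ`. -/
def cohomology (n : ℕ) : (Iᵒᵖ ⥤ E) ⥤ (SimplicialObject I)ᵒᵖ ⥤ E where
  obj P := ((SimplicialObject.whiskering I Eᵒᵖ).obj P.rightOp ⋙
    AlgebraicTopology.normalizedMooreComplex Eᵒᵖ ⋙
      HomologicalComplex.homologyFunctor Eᵒᵖ _ n).leftOp
  map η := NatTrans.leftOp (Functor.whiskerRight
    ((SimplicialObject.whiskering I Eᵒᵖ).map (NatTrans.rightOp η))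
    (AlgebraicTopology.normalizedMooreComplex Eᵒᵖ ⋙
      HomologicalComplex.homologyFunctor Eᵒᵖ _ n))
  map_id P := by
    ext X
    apply Quiver.Hom.op_inj
    exact (AlgebraicTopology.normalizedMooreComplex Eᵒᵖ ⋙
      HomologicalComplex.homologyFunctor Eᵒᵖ _ n).map_id
        (((SimplicialObject.whiskering I Eᵒᵖ).obj P.rightOp).obj X.unop)
  map_comp η θ := by
    ext X
    apply Quiver.Hom.op_inj
    exact (AlgebraicTopology.normalizedMooreComplex Eᵒᵖ ⋙
      HomologicalComplex.homologyFunctor Eᵒᵖ _ n).map_comp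
        (((SimplicialObject.whiskering I Eᵒᵖ).map (NatTrans.rightOp θ)).app X.unop)
        (((SimplicialObject.whiskering I Eᵒᵖ).map (NatTrans.rightOp η)).app X.unop)

theorem moore_homologyMap_eq {A : Type u} [Category.{w} A] [Abelian A] {X Y : SimplicialObject A}
    {f g : X ⟶ Y} (h : SimplicialObject.Homotopy f g) (n : ℕ) :
    (AlgebraicTopology.normalizedMooreComplex A ⋙
      HomologicalComplex.homologyFunctor A _ n).map f =
    (AlgebraicTopology.normalizedMooreComplex A ⋙
      HomologicalComplex.homologyFunctor A _ n).map g := by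
  let G := HomologicalComplex.homologyFunctor A (ComplexShape.down ℕ) n
  have : IsIso (G.map ((AlgebraicTopology.inclusionOfMooreComplex A).app Y)) := by
    have : QuasiIso ((AlgebraicTopology.inclusionOfMooreComplex A).app Y) :=
      (AlgebraicTopology.DoldKan.homotopyEquivNormalizedMooreComplexAlternatingFaceMapComplex
        (A := A) (Y := Y)).quasiIso_hom
    exact inferInstanceAs
      (IsIso (HomologicalComplex.homologyMap ((AlgebraicTopology.inclusionOfMooreComplex A).app Y) n))
  change G.map _ = G.map _
  rw [← cancel_mono (G.map ((AlgebraicTopology.inclusionOfMooreComplex A).app Y)),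
    ← G.map_comp, ← G.map_comp, NatTrans.naturality, NatTrans.naturality, G.map_comp, G.map_comp,
    h.map_homology_eq n]

theorem cohomology_map_eq (n : ℕ) (P : Iᵒᵖ ⥤ E) {X Y : SimplicialObject I} {f g : X ⟶ Y}
    (h : SimplicialObject.Homotopy f g) :
    ((cohomology n).obj P).map f.op = ((cohomology n).obj P).map g.op :=
  Quiver.Hom.op_inj (moore_homologyMap_eq (h.whiskerRight P.rightOp) n)

end Cohomology

section Derived

variable {I : Type w} [SmallCategory I] (F : MorphismProperty I)

/-- Hypercoverings of `i`: simplicial objects `X` of `I/i` (that is, simplicial objects of `I`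
augmented by `i`) such that `X_n ⟶ Hom(∂Δ_n, X)` is in `F` for every `n ≥ 0`, where
`Hom(∂Δ_n, X)` is computed in `I/i`. -/
def IsHypercovering (i : I) : ObjectProperty (SimplicialObject (Over i)) :=
  fun X => IsReedy (overClass F i) X

/-- The category of hypercoverings of `i`, a full subcategory of simplicial objects of `I/i`. -/
abbrev HCov (i : I) : Type w := (IsHypercovering F i).FullSubcategory

/-- Two maps of hypercoverings are related if there is a simplicial homotopy over `i`
from one to the other. -/
def homotopyRel (i : I) : HomRel (HCov F i) :=
  fun _ _ f g => Nonempty (SimplicialObject.Homotopy f.hom g.hom)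

/-- The homotopy category of hypercoverings of `i`: two maps are identified if they are connected
by a chain of simplicial homotopies. -/
abbrev HC (i : I) : Type w := CategoryTheory.Quotient (homotopyRel F i)

/-- The underlying simplicial object of `I` of a simplicial object of `I/i`. -/
abbrev total (i : I) : SimplicialObject (Over i) ⥤ SimplicialObject I :=
  (SimplicialObject.whiskering _ _).obj (Over.forget i)

variable {E : Type u} [Category.{w} E] [Abelian E]

/-- The functor `X ↦ H^n(C^•(P(X)))` on the homotopy category of hypercoverings of `i`. -/
def cohomologyHC (n : ℕ) (P : Iᵒᵖ ⥤ E) (i : I) : (HC F i)ᵒᵖ ⥤ E :=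
  (CategoryTheory.Quotient.lift (homotopyRel F i)
    (((IsHypercovering F i).ι ⋙ total i).op ⋙ (cohomology n).obj P).rightOp
    (fun _ _ _ _ ⟨h⟩ => Quiver.Hom.unop_inj
      (cohomology_map_eq n P (h.whiskerRight (Over.forget i))))).leftOp

variable [HasColimitsOfSize.{w, w} E]

/-- The value `D^n(P)(i)` of the Dold-derived functor: the colimit of `H^n(C^•(P(X)))` over the
opposite of the homotopy category of hypercoverings `X` of `i`. -/
def doldObj (n : ℕ) (P : Iᵒᵖ ⥤ E) (i : I) : E := colimit (cohomologyHC F n P i)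

/-- The canonical map from the cohomology of the hypercovering `X` to the colimit. -/
def doldι (n : ℕ) (P : Iᵒᵖ ⥤ E) {i : I} (X : HCov F i) :
    ((cohomology n).obj P).obj (op ((total i).obj X.obj)) ⟶ doldObj F n P i :=
  colimit.ι (cohomologyHC F n P i) (op ((CategoryTheory.Quotient.functor _).obj X))

variable {F}

theorem doldι_w (n : ℕ) (P : Iᵒᵖ ⥤ E) {i : I} {X Y : HCov F i} (t : Y ⟶ X) :
    ((cohomology n).obj P).map ((total i).map t.hom).op ≫ doldι F n P Y = doldι F n P X :=
  colimit.w (cohomologyHC F n P i) ((CategoryTheory.Quotient.functor _).map t).op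

theorem dold_hom_ext {n : ℕ} {P : Iᵒᵖ ⥤ E} {i : I} {T : E} {a b : doldObj F n P i ⟶ T}
    (h : ∀ X : HCov F i, doldι F n P X ≫ a = doldι F n P X ≫ b) : a = b :=
  colimit.hom_ext fun X => h X.unop.as

/-- The map out of the colimit given by a compatible family. -/
def doldDesc {n : ℕ} {P : Iᵒᵖ ⥤ E} {i : I} {T : E}
    (x : ∀ X : HCov F i, ((cohomology n).obj P).obj (op ((total i).obj X.obj)) ⟶ T)
    (hx : ∀ {X Y : HCov F i} (t : Y ⟶ X),
      ((cohomology n).obj P).map ((total i).map t.hom).op ≫ x Y = x X) :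
    doldObj F n P i ⟶ T :=
  colimit.desc (cohomologyHC F n P i)
    { pt := T
      ι :=
        { app := fun X => x X.unop.as
          naturality := by
            intro X Y t
            obtain ⟨s, hs⟩ := (CategoryTheory.Quotient.functor (homotopyRel F i)).map_surjective
              (X := Y.unop.as) (Y := X.unop.as) t.unop
            have : t = ((CategoryTheory.Quotient.functor (homotopyRel F i)).map s).op :=
              Quiver.Hom.unop_inj hs.symm
            subst this
            exact (hx s).trans (Category.comp_id _).symm } }

/-- The map `D^n(P)(i) ⟶ D^n(Q)(i)` induced by `η : P ⟶ Q`. -/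
def doldMapPresheaf (n : ℕ) {P Q : Iᵒᵖ ⥤ E} (η : P ⟶ Q) (i : I) :
    doldObj F n P i ⟶ doldObj F n Q i :=
  doldDesc (fun X => ((cohomology n).map η).app _ ≫ doldι F n Q X) (fun t => by
    rw [NatTrans.naturality_assoc, doldι_w])

theorem doldι_mapPresheaf (n : ℕ) {P Q : Iᵒᵖ ⥤ E} (η : P ⟶ Q) {i : I} (X : HCov F i) :
    doldι F n P X ≫ doldMapPresheaf n η i = ((cohomology n).map η).app _ ≫ doldι F n Q X :=
  colimit.ι_desc _ _

/-- The map of simplicial objects of `I` underlying a map `Y ⟶ X` over `f : i' ⟶ i`. -/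
def totalMap {i' i : I} {f : i' ⟶ i} {Y : SimplicialObject (Over i')}
    {X : SimplicialObject (Over i)} (φ : pushforward f Y ⟶ X) :
    (total i').obj Y ⟶ (total i).obj X where
  app m := (φ.app m).left
  naturality _ _ θ := congr_arg CommaMorphism.left (φ.naturality θ)

variable [F.IsMultiplicative] [F.HasPullbacks] [F.IsStableUnderBaseChange]

/-- The pullback of a hypercovering of `i` along `f : i' ⟶ i`, a simplicial object of `I/i'` with
the universal property of `exists_baseChange`. -/
def baseChange {i' i : I} (f : i' ⟶ i) (X : HCov F i) : HCov F i' :=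
  ⟨(exists_baseChange F f X.property).choose, (exists_baseChange F f X.property).choose_spec.choose⟩

/-- The projection from the pullback of a hypercovering. -/
def baseChangeMap {i' i : I} (f : i' ⟶ i) (X : HCov F i) :
    pushforward f (baseChange f X).obj ⟶ X.obj :=
  (exists_baseChange F f X.property).choose_spec.choose_spec.choose

theorem exists_baseChange_lift {i' i : I} (f : i' ⟶ i) (X : HCov F i) {Z : HCov F i'}
    (ψ : pushforward f Z.obj ⟶ X.obj) :
    ∃ t : Z ⟶ baseChange f X, (total i').map t.hom ≫ totalMap (baseChangeMap f X) = totalMap ψ := by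
  obtain ⟨t, ht, -⟩ :=
    (exists_baseChange F f X.property).choose_spec.choose_spec.choose_spec Z.obj ψ
  refine ⟨ObjectProperty.homMk t, ?_⟩
  ext m
  exact congr_arg CommaMorphism.left (congr_app ht m)

theorem totalMap_dold {i' i : I} (f : i' ⟶ i) (n : ℕ) (P : Iᵒᵖ ⥤ E) {X : HCov F i} {Z : HCov F i'}
    (ψ : pushforward f Z.obj ⟶ X.obj) :
    ((cohomology n).obj P).map (totalMap ψ).op ≫ doldι F n P Z =
      ((cohomology n).obj P).map (totalMap (baseChangeMap f X)).op ≫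
        doldι F n P (baseChange f X) := by
  obtain ⟨t, ht⟩ := exists_baseChange_lift f X ψ
  rw [← ht, op_comp, Functor.map_comp, Category.assoc, doldι_w]

/-- The map `D^n(P)(i) ⟶ D^n(P)(i')` induced by `f : i' ⟶ i` by pulling back hypercoverings. -/
def doldMap (n : ℕ) (P : Iᵒᵖ ⥤ E) {i' i : I} (f : i' ⟶ i) :
    doldObj F n P i ⟶ doldObj F n P i' :=
  doldDesc (fun X => ((cohomology n).obj P).map (totalMap (baseChangeMap f X)).op ≫
    doldι F n P (baseChange f X)) (by
      intro X Y t
      have e := totalMap_dold f n P (X := X) (baseChangeMap f Y ≫ t.hom)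
      rw [← e, ← Category.assoc, ← Functor.map_comp, ← op_comp]
      rfl)

theorem doldι_map (n : ℕ) (P : Iᵒᵖ ⥤ E) {i' i : I} (f : i' ⟶ i) {X : HCov F i} {Z : HCov F i'}
    (ψ : pushforward f Z.obj ⟶ X.obj) :
    doldι F n P X ≫ doldMap n P f =
      ((cohomology n).obj P).map (totalMap ψ).op ≫ doldι F n P Z := by
  rw [totalMap_dold]
  exact colimit.ι_desc _ _

/-- The composite of a map over `f` and a map over `g`. -/
def overComp {i'' i' i : I} {g : i'' ⟶ i'} {f : i' ⟶ i} {Z : SimplicialObject (Over i'')}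
    {Y : SimplicialObject (Over i')} {X : SimplicialObject (Over i)}
    (φ : pushforward g Z ⟶ Y) (ψ : pushforward f Y ⟶ X) : pushforward (g ≫ f) Z ⟶ X where
  app m := Over.homMk ((φ.app m).left ≫ (ψ.app m).left) (by
    have h₁ := Over.w (φ.app m)
    have h₂ := Over.w (ψ.app m)
    change ((φ.app m).left ≫ (ψ.app m).left) ≫ (X.obj m).hom = (Z.obj m).hom ≫ g ≫ f
    change (φ.app m).left ≫ (Y.obj m).hom = (Z.obj m).hom ≫ g at h₁
    change (ψ.app m).left ≫ (X.obj m).hom = (Y.obj m).hom ≫ f at h₂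
    rw [← Category.assoc, ← h₁]
    exact (Category.assoc _ _ _).trans ((congr(_ ≫ $h₂)).trans (Category.assoc _ _ _).symm))
  naturality a b θ := by
    ext
    exact (totalMap φ ≫ totalMap ψ).naturality θ

/-- The identity as a map over `𝟙 i`. -/
def overId {i : I} (X : SimplicialObject (Over i)) : pushforward (𝟙 i) X ⟶ X where
  app m := Over.homMk (𝟙 (X.obj m).left) ((Category.id_comp _).trans (Category.comp_id _).symm)
  naturality a b θ := by
    ext
    exact (𝟙 ((total i).obj X) : _ ⟶ _).naturality θ

variable (F) in
/-- The functor `D^n(P) : Iᵒᵖ ⥤ E`. -/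
def doldPresheaf (n : ℕ) (P : Iᵒᵖ ⥤ E) : Iᵒᵖ ⥤ E where
  obj i := doldObj F n P i.unop
  map f := doldMap n P f.unop
  map_id i := dold_hom_ext fun X => by
    refine (doldι_map n P (𝟙 i.unop) (overId X.obj)).trans ?_
    have : totalMap (overId X.obj) = 𝟙 _ := rfl
    rw [this]
    simp
  map_comp {i i' i''} f g := dold_hom_ext fun X => by
    have e := doldι_map n P (g.unop ≫ f.unop)
      (overComp (baseChangeMap g.unop (baseChange f.unop X)) (baseChangeMap f.unop X))
    have : totalMap (overComp (baseChangeMap g.unop (baseChange f.unop X))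
      (baseChangeMap f.unop X)) = totalMap (baseChangeMap g.unop (baseChange f.unop X)) ≫
        totalMap (baseChangeMap f.unop X) := rfl
    refine e.trans ?_
    rw [this, ← Category.assoc, doldι_map n P f.unop (baseChangeMap f.unop X), Category.assoc,
      doldι_map n P g.unop (baseChangeMap g.unop (baseChange f.unop X)), op_comp,
      Functor.map_comp, Category.assoc]

theorem doldMap_mapPresheaf (n : ℕ) {P Q : Iᵒᵖ ⥤ E} (η : P ⟶ Q) {i' i : I} (f : i' ⟶ i) :
    doldMap (F := F) n P f ≫ doldMapPresheaf n η i' = doldMapPresheaf n η i ≫ doldMap n Q f :=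
  dold_hom_ext fun X => by
    rw [← Category.assoc, ← Category.assoc, doldι_map n P f (baseChangeMap f X),
      doldι_mapPresheaf, Category.assoc, Category.assoc, doldι_mapPresheaf,
      doldι_map n Q f (baseChangeMap f X), NatTrans.naturality_assoc]

variable (F) (E) in
/-- The `n`-th Dold-derived functor `P ↦ D^n(P)`. -/
def doldDerived (n : ℕ) : (Iᵒᵖ ⥤ E) ⥤ (Iᵒᵖ ⥤ E) where
  obj P := doldPresheaf F n P
  map {P Q} η :=
    { app i := doldMapPresheaf n η i.unop
      naturality _ _ f := doldMap_mapPresheaf n η f.unop }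
  map_id P := by
    ext i
    refine dold_hom_ext fun X => (doldι_mapPresheaf n _ X).trans ?_
    rw [CategoryTheory.Functor.map_id]
    exact (Category.id_comp _).trans (Category.comp_id _).symm
  map_comp η θ := by
    ext i
    refine dold_hom_ext fun X => (doldι_mapPresheaf n _ X).trans ?_
    change _ = doldι F n _ X ≫ doldMapPresheaf n η i.unop ≫ doldMapPresheaf n θ i.unop
    rw [← Category.assoc, doldι_mapPresheaf, Category.assoc, doldι_mapPresheaf, Functor.map_comp,
      NatTrans.comp_app, Category.assoc]

end Derived

end Dold
end HyperDold

/-!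
Call a map of presheaves an `a`-isomorphism if sheafification inverts it. By compactness of a small
set of generators of `E`, every section of a presheaf with zero sheafification dies on a cover in
`F`, so it dies on a refinement of a given hypercovering. Refining hypercoverings one degree at a
time also shows that any two maps `X ⟶ Y` of hypercoverings of `i` induce, after composition with
some refinement of `X`, the same maps on cohomology in a given bounded range of degrees. As products
of hypercoverings exist, the colimits that define `D^n` are therefore filtered, hence exact, once
such maps are identified. So `D^*` is a δ-functor on presheaves, it inverts `a`-isomorphisms, and
`D^n ≅ D^n ∘ e ∘ a`. On sheaves `D^0` is the inclusion `e`. A hypercovering is locally contractible,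
so it resolves `i` after sheafification of the free presheaves, and `D^n(J) = 0` for `n > 0` and `J`
an injective sheaf. Thus `D^* ∘ e` is an effaceable δ-functor extending `e`, and dimension shifting
along injective resolutions identifies it with `R^*e`.
-/

namespace HyperDold

section Refinement

variable {C : Type u} [Category.{v} C]

/-- A limit of the diagram formed by the maps `b j : B ⟶ B₀`, for `j : J`, and one copy of
`c : A ⟶ B₀` for every `j`: a morphism into `pt` is a morphism `t` into `B` together with a lift
of every `t ≫ b j` along `c`. -/
structure MultiPullback {J : Type*} {A B₀ B : C} (c : A ⟶ B₀) (b : J → (B ⟶ B₀)) where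
  pt : C
  base : pt ⟶ B
  coord (j : J) : pt ⟶ A
  coord_comp (j : J) : coord j ≫ c = base ≫ b j
  lift {T : C} (t : T ⟶ B) (x : J → (T ⟶ A)) (h : ∀ j, x j ≫ c = t ≫ b j) : T ⟶ pt
  lift_base {T : C} (t : T ⟶ B) (x : J → (T ⟶ A)) (h : ∀ j, x j ≫ c = t ≫ b j) :
    lift t x h ≫ base = t
  lift_coord {T : C} (t : T ⟶ B) (x : J → (T ⟶ A)) (h : ∀ j, x j ≫ c = t ≫ b j) (j : J) :
    lift t x h ≫ coord j = x j
  hom_ext {T : C} {s s' : T ⟶ pt} (hbase : s ≫ base = s' ≫ base)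
    (hcoord : ∀ j, s ≫ coord j = s' ≫ coord j) : s = s'

namespace MultiPullback

attribute [simp] lift_base lift_coord

variable {J J' : Type*} {A B₀ B B' : C} {c : A ⟶ B₀} {b : J → (B ⟶ B₀)}

@[simp]
theorem lift_base_assoc (W : MultiPullback c b) {T Z : C} (t : T ⟶ B) (x : J → (T ⟶ A))
    (h : ∀ j, x j ≫ c = t ≫ b j) (f : B ⟶ Z) : W.lift t x h ≫ W.base ≫ f = t ≫ f := by
  rw [← Category.assoc, lift_base]

/-- The multiple pullback along an empty family. -/
@[simps] def ofIsEmpty [IsEmpty J] (c : A ⟶ B₀) (b : J → (B ⟶ B₀)) : MultiPullback c b where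
  pt := B
  base := 𝟙 B
  coord := isEmptyElim
  coord_comp := isEmptyElim
  lift t _ _ := t
  lift_base := by simp
  lift_coord _ _ _ := isEmptyElim
  hom_ext h _ := by simpa using h

/-- Reindexing of a multiple pullback along a bijection. -/
@[simps] def reindex (e : J ≃ J') {b : J' → (B ⟶ B₀)} (W : MultiPullback c (b ∘ e)) :
    MultiPullback c b where
  pt := W.pt
  base := W.base
  coord j := W.coord (e.symm j)
  coord_comp j := by simp [W.coord_comp]
  lift t x h := W.lift t (x ∘ e) fun j => h (e j)
  lift_base := by simp
  lift_coord := by simp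
  hom_ext hb h := W.hom_ext hb fun j => by simpa using h (e j)

/-- A multiple pullback along one more map, as an iterated pullback. -/
@[simps] noncomputable def option {b : Option J → (B ⟶ B₀)}
    (W : MultiPullback c fun j => b (some j)) [HasPullback c (W.base ≫ b none)] :
    MultiPullback c b where
  pt := pullback c (W.base ≫ b none)
  base := pullback.snd _ _ ≫ W.base
  coord j := j.elim (pullback.fst _ _) fun j => pullback.snd _ _ ≫ W.coord j
  coord_comp := by
    rintro (_ | j)
    · exact pullback.condition.trans (Category.assoc ..).symm
    · exact (Category.assoc ..).trans <| congr(pullback.snd _ _ ≫ $(W.coord_comp j)).trans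
        (Category.assoc ..).symm
  lift t x h := pullback.lift (x none) (W.lift t (fun j => x (some j)) fun j => h (some j))
    (by simp [h])
  lift_base _ _ _ := (pullback.lift_snd_assoc ..).trans (W.lift_base ..)
  lift_coord t x h := by
    rintro (_ | j)
    · exact pullback.lift_fst ..
    · exact (pullback.lift_snd_assoc ..).trans (W.lift_coord ..)
  hom_ext hb h := pullback.hom_ext (h none)
    (W.hom_ext (by simpa using hb) fun j => by simpa using h (some j))

theorem exists_base_mem {P : MorphismProperty C} [P.IsMultiplicative] [P.HasPullbacks]
    [P.IsStableUnderBaseChange] (hc : P c) [Finite J] (b : J → (B ⟶ B₀)) :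
    ∃ W : MultiPullback c b, P W.base := by
  induction J using Finite.induction_empty_option with
  | of_equiv e ih =>
    obtain ⟨W, hW⟩ := ih (b ∘ e)
    exact ⟨W.reindex e, hW⟩
  | h_empty => exact ⟨ofIsEmpty c b, P.id_mem B⟩
  | h_option ih =>
    obtain ⟨W, hW⟩ := ih fun j => b (some j)
    have := P.hasPullback (W.base ≫ b none) hc
    exact ⟨W.option, P.comp_mem _ _ (P.pullback_snd _ _ hc) hW⟩

theorem base_mem {P : MorphismProperty C} [P.IsMultiplicative] [P.HasPullbacks]
    [P.IsStableUnderBaseChange] (hc : P c) [Finite J] (W : MultiPullback c b) : P W.base := by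
  obtain ⟨V, hV⟩ := exists_base_mem hc b
  obtain ⟨e, he⟩ : ∃ e : W.pt ≅ V.pt, e.hom ≫ V.base = W.base :=
    ⟨{ hom := V.lift W.base W.coord W.coord_comp
       inv := W.lift V.base V.coord V.coord_comp
       hom_inv_id := W.hom_ext (by simp) (by simp)
       inv_hom_id := V.hom_ext (by simp) (by simp) }, V.lift_base ..⟩
  exact he ▸ (P.cancel_left_of_respectsIso e.hom V.base).2 hV

/-- Base change of a multiple pullback along `g : B' ⟶ B`. -/
@[simps] noncomputable def ofIsPullback (W : MultiPullback c b) {V : C} {p : V ⟶ B'}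
    {q : V ⟶ W.pt} {g : B' ⟶ B} (sq : IsPullback p q g W.base) {b' : J → (B' ⟶ B₀)}
    (hb' : ∀ j, g ≫ b j = b' j) : MultiPullback c b' where
  pt := V
  base := p
  coord j := q ≫ W.coord j
  coord_comp j := by simp [W.coord_comp, ← hb', sq.w_assoc]
  lift t x h := sq.lift t (W.lift (t ≫ g) x (by simp [h, ← hb'])) (by simp)
  lift_base := by simp
  lift_coord := by simp
  hom_ext hb h := sq.hom_ext hb (W.hom_ext (by simpa [sq.w] using congr($hb ≫ g))
    (by simpa using h))

/-- A multiple pullback along a family is a multiple pullback, along the rest of the family, over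
the multiple pullback along a subfamily. -/
@[simps] noncomputable def compl (W : MultiPullback c b) {K : J → Prop}
    (V : MultiPullback c fun j : {j // K j} => b j) :
    MultiPullback c fun j : {j // ¬ K j} => V.base ≫ b j where
  pt := W.pt
  base := V.lift W.base (fun j => W.coord j) fun j => W.coord_comp j
  coord j := W.coord j
  coord_comp j := by simp [W.coord_comp]
  lift t x h := by
    classical
    exact W.lift (t ≫ V.base)
      (fun j => if hj : K j then t ≫ V.coord ⟨j, hj⟩ else x ⟨j, hj⟩)
      fun j => by split_ifs with hj <;> simp [V.coord_comp, h]
  lift_base t x h := V.hom_ext (by simp) fun j => by simp [j.2]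
  lift_coord t x h j := by simp [j.2]
  hom_ext {T s s'} hb h := W.hom_ext (by simpa using congr($hb ≫ V.base)) fun j => by
    by_cases hj : K j
    · simpa using congr($hb ≫ V.coord ⟨j, hj⟩)
    · exact h ⟨j, hj⟩

@[simp]
theorem compl_base_base (W : MultiPullback c b) {K : J → Prop}
    (V : MultiPullback c fun j : {j // K j} => b j) : (W.compl V).base ≫ V.base = W.base :=
  V.lift_base ..

@[simp]
theorem compl_base_coord (W : MultiPullback c b) {K : J → Prop}
    (V : MultiPullback c fun j : {j // K j} => b j) (j : {j // K j}) :
    (W.compl V).base ≫ V.coord j = W.coord j :=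
  V.lift_coord ..

end MultiPullback

theorem matchingMap_mem_of_isLimit {P : MorphismProperty C} [P.RespectsIso]
    {X : SimplicialObject C} {n : ℕ} {S : Sieve ⦋n⦌} {c c' : Cone (sieveDiagram X S)}
    {hc : IsLimit c} (h : P (matchingMap hc)) (hc' : IsLimit c') : P (matchingMap hc') := by
  have e : matchingMap hc ≫ (hc.conePointUniqueUpToIso hc').hom = matchingMap hc' :=
    hc'.hom_ext fun j => by
      rw [Category.assoc, hc.conePointUniqueUpToIso_hom_comp hc' j]
      exact (hc.fac _ j).trans (hc'.fac _ j).symm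
  exact e ▸ (P.cancel_right_of_respectsIso _ _).2 h

theorem exists_matchingMap_mem {P : MorphismProperty C} {X : SimplicialObject C} {n : ℕ}
    {S : Sieve ⦋n⦌} {M : C} {x : ∀ {k : SimplexCategory} (f : k ⟶ ⦋n⦌), S f → (M ⟶ X.obj (op k))}
    {hx : ∀ {k l : SimplexCategory} (f : k ⟶ ⦋n⦌) (hf : S f) (g : l ⟶ k),
      x f hf ≫ X.map g.op = x (g ≫ f) (S.downward_closed hf g)}
    (hM : IsLimit (coneOfFamily X S M x hx)) {μ : X.obj (op ⦋n⦌) ⟶ M}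
    (hμ : ∀ {k : SimplexCategory} (f : k ⟶ ⦋n⦌) (hf : S f), μ ≫ x f hf = X.map f.op) (hP : P μ) :
    ∃ (c : Cone (sieveDiagram X S)) (hc : IsLimit c), P (matchingMap hc) := by
  have e : μ = matchingMap hM :=
    hM.hom_ext fun f =>
      (hμ f.unop.obj.hom f.unop.property).trans (hM.fac (sieveCone X S) f).symm
  exact ⟨_, hM, e ▸ hP⟩

section

variable {X : SimplicialObject C} {n : ℕ} {A : C} {c : A ⟶ X.obj (op ⦋n⦌)}

/-- The refinement of `X` along `c : A ⟶ X_n`: an `m`-simplex is an `m`-simplex `x` of `X`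
together with lifts along `c`, chosen independently, of the `n`-simplices `θ^* x` for all
`θ : [n] ⟶ [m]`. -/
def refinement
    (W : ∀ m : SimplexCategoryᵒᵖ, MultiPullback c fun θ : ⦋n⦌ ⟶ m.unop => X.map θ.op) :
    SimplicialObject C where
  obj m := (W m).pt
  map {m m'} τ := (W m').lift ((W m).base ≫ X.map τ) (fun θ => (W m).coord (θ ≫ τ.unop))
    fun θ => by simp [(W m).coord_comp]
  map_id m := (W m).hom_ext (by simp) (by simp)
  map_comp τ τ' := (W _).hom_ext (by simp) (by simp)

variable (W : ∀ m : SimplexCategoryᵒᵖ, MultiPullback c fun θ : ⦋n⦌ ⟶ m.unop => X.map θ.op)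

/-- The projection from the refinement of `X` to `X`. -/
def refinementMap : refinement W ⟶ X where
  app m := (W m).base
  naturality _ m' _ := (W m').lift_base ..

/-- The lift to `A` of the `n`-simplex `θ^* x` that is part of a simplex `x` of the refinement. -/
def refinementCoord {k : SimplexCategory} (θ : ⦋n⦌ ⟶ k) : (refinement W).obj (op k) ⟶ A :=
  (W (op k)).coord θ

variable {W}

theorem refinementCoord_comp {k : SimplexCategory} (θ : ⦋n⦌ ⟶ k) :
    refinementCoord W θ ≫ c = (refinementMap W).app (op k) ≫ X.map θ.op :=
  (W (op k)).coord_comp θ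

@[simp]
theorem map_refinementCoord {k l : SimplexCategory} (g : l ⟶ k) (θ : ⦋n⦌ ⟶ l) :
    (refinement W).map g.op ≫ refinementCoord W θ = refinementCoord W (θ ≫ g) :=
  (W (op l)).lift_coord ..

theorem refinement_hom_ext {T : C} {m : SimplexCategoryᵒᵖ} {s s' : T ⟶ (refinement W).obj m}
    (h : s ≫ (refinementMap W).app m = s' ≫ (refinementMap W).app m)
    (h' : ∀ θ, s ≫ refinementCoord W θ = s' ≫ refinementCoord W θ) : s = s' :=
  (W m).hom_ext h h'

variable {m : ℕ} {d : Cone (sieveDiagram X (boundary m))}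
  (M : MultiPullback c fun θ : {θ : ⦋n⦌ ⟶ ⦋m⦌ // boundary m θ} => proj d θ.1 θ.2)

variable (W) in
/-- The component at `f : [k] ⟶ [m]` of the universal matching family of a refinement. -/
def refinementProj {k : SimplexCategory} (f : k ⟶ ⦋m⦌) (hf : boundary m f) :
    M.pt ⟶ (refinement W).obj (op k) :=
  (W (op k)).lift (M.base ≫ proj d f hf)
    (fun θ => M.coord ⟨θ ≫ f, (boundary m).downward_closed hf θ⟩)
    fun θ => by rw [M.coord_comp, Category.assoc, proj_w d f hf θ _ _ rfl]

@[simp]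
theorem refinementProj_map_app {k : SimplexCategory} (f : k ⟶ ⦋m⦌) (hf : boundary m f) :
    refinementProj W M f hf ≫ (refinementMap W).app (op k) = M.base ≫ proj d f hf :=
  (W (op k)).lift_base ..

@[simp]
theorem refinementProj_coord {k : SimplexCategory} (f : k ⟶ ⦋m⦌) (hf : boundary m f)
    (θ : ⦋n⦌ ⟶ k) : refinementProj W M f hf ≫ refinementCoord W θ =
      M.coord ⟨θ ≫ f, (boundary m).downward_closed hf θ⟩ :=
  (W (op k)).lift_coord ..

theorem refinementProj_comp_map {k l : SimplexCategory} (f : k ⟶ ⦋m⦌) (hf : boundary m f)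
    (g : l ⟶ k) : refinementProj W M f hf ≫ (refinement W).map g.op =
      refinementProj W M (g ≫ f) ((boundary m).downward_closed hf g) :=
  refinement_hom_ext
    (by rw [Category.assoc, (refinementMap W).naturality, ← Category.assoc,
      refinementProj_map_app, Category.assoc, proj_w d f hf g _ _ rfl, refinementProj_map_app])
    (by simp)

theorem nonempty_isLimit_refinement (hd : IsLimit d) :
    Nonempty (IsLimit (coneOfFamily (refinement W) (boundary m) M.pt
      (refinementProj W M) (refinementProj_comp_map M))) := by
  refine exists_isLimit _ _ _ (fun r => ?_) fun {T} t t' h => ?_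
  · obtain ⟨t₀, ht₀⟩ := exists_lift hd (fun f hf => proj r f hf ≫ (refinementMap W).app _)
      fun f hf g => by rw [Category.assoc, ← (refinementMap W).naturality, ← Category.assoc,
        proj_w r f hf g _ _ rfl]
    refine ⟨M.lift t₀ (fun θ => proj r θ.1 θ.2 ≫ refinementCoord W (𝟙 _)) fun θ => ?_,
      fun f hf => refinement_hom_ext ?_ fun θ => ?_⟩
    · simp [refinementCoord_comp, ht₀]
    · simp [ht₀]
    · simp [← proj_w r f hf θ _ _ rfl]
  · refine M.hom_ext (proj_hom_ext hd fun f hf => ?_) fun θ => ?_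
    · simpa using congr($(h f hf) ≫ (refinementMap W).app _)
    · simpa using congr($(h θ.1 θ.2) ≫ refinementCoord W (𝟙 _))

theorem exists_relativeMatching {P : MorphismProperty C} [P.IsMultiplicative] [P.HasPullbacks]
    [P.IsStableUnderBaseChange] {hd : IsLimit d} (hP : P (matchingMap hd)) (hc : P c) :
    ∃ (Q : C) (r : (refinement W).obj (op ⦋m⦌) ⟶ Q) (p : Q ⟶ X.obj (op ⦋m⦌)) (q : Q ⟶ M.pt),
      P r ∧ P q ∧ p ≫ matchingMap hd = q ≫ M.base ∧ r ≫ p = (refinementMap W).app (op ⦋m⦌) ∧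
        ∀ θ, r ≫ q ≫ M.coord θ = refinementCoord W θ.1 := by
  have := P.hasPullback M.base hP
  let V := M.ofIsPullback (IsPullback.of_hasPullback (matchingMap hd) M.base)
    fun θ => matchingMap_proj hd θ.1 θ.2
  exact ⟨_, ((W (op ⦋m⦌)).compl V).base, pullback.fst _ _, pullback.snd _ _,
    MultiPullback.base_mem hc _, P.pullback_snd _ _ hP, pullback.condition,
    (W (op ⦋m⦌)).compl_base_base V, (W (op ⦋m⦌)).compl_base_coord V⟩

/- With `M` the limit `Hom(∂Δ_m, X')`, the `m`-simplices of the refinement `X'` form a multiple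
pullback over `X_m ×_{Hom(∂Δ_m, X)} M`, indexed by the maps `[n] ⟶ [m]` not in the boundary. -/
theorem isReedy_refinement {P : MorphismProperty C} [P.IsMultiplicative] [P.HasPullbacks]
    [P.IsStableUnderBaseChange] (hX : IsReedy P X) (hc : P c) : IsReedy P (refinement W) := by
  intro m
  obtain ⟨d, hd, hP⟩ := hX m
  obtain ⟨M, -⟩ := MultiPullback.exists_base_mem hc
    fun θ : {θ : ⦋n⦌ ⟶ ⦋m⦌ // boundary m θ} => proj d θ.1 θ.2
  obtain ⟨hM⟩ := nonempty_isLimit_refinement (W := W) M hd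
  obtain ⟨Q, r, p, q, hr, hq, hpq, hrp, hrq⟩ := exists_relativeMatching (W := W) M hP hc
  refine exists_matchingMap_mem hM (fun f hf => refinement_hom_ext ?_ fun θ => ?_)
    (P.comp_mem r q hr hq)
  · calc
      ((r ≫ q) ≫ refinementProj W M f hf) ≫ (refinementMap W).app _ =
          r ≫ (q ≫ M.base) ≫ proj d f hf := by simp
      _ = (refinementMap W).app _ ≫ X.map f.op := by
        rw [← hpq, Category.assoc, matchingMap_proj, ← hrp, Category.assoc]
      _ = _ := ((refinementMap W).naturality _).symm
  · rw [Category.assoc, refinementProj_coord, Category.assoc, hrq, map_refinementCoord]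

end

end Refinement

section Product

variable {C : Type u} [Category.{v} C]

theorem isPullback_prod_map_id_left (A : C) {B B' : C} (g : B ⟶ B') [HasBinaryProduct A B]
    [HasBinaryProduct A B'] : IsPullback prod.snd (prod.map (𝟙 A) g) g prod.snd :=
  .mk' (by simp)
    (fun _ φ φ' h h' => prod.hom_ext (by simpa using congr($h' ≫ prod.fst)) h)
    fun _ a b h => ⟨prod.lift (b ≫ prod.fst) a, prod.lift_snd .., by
      rw [prod.lift_map, Category.comp_id, h]
      exact prod.hom_ext (prod.lift_fst ..) (prod.lift_snd ..)⟩

theorem prod_map_mem {P : MorphismProperty C} [P.IsMultiplicative] [P.IsStableUnderBaseChange]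
    {A A' B B' : C} {f : A ⟶ A'} {g : B ⟶ B'} [HasBinaryProduct A B] [HasBinaryProduct A' B]
    [HasBinaryProduct A' B'] (hf : P f) (hg : P g) : P (prod.map f g) := by
  have e : prod.map f (𝟙 B) ≫ prod.map (𝟙 A') g = prod.map f g := by simp
  exact e ▸ P.comp_mem _ _ (P.of_isPullback (IsPullback.of_prod_fst_with_id f B) hf)
    (P.of_isPullback (isPullback_prod_map_id_left A' g) hg)

theorem hasBinaryProduct_of_mem {P : MorphismProperty C} [P.HasPullbacks] {T : C}
    (hT : IsTerminal T) {A : C} (hA : P (hT.from A)) (B : C) : HasBinaryProduct A B := by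
  have := P.hasPullback (hT.from B) hA
  exact ⟨_, isProductOfIsTerminalIsPullback _ _ _ _ hT
    (pullbackIsPullback (hT.from A) (hT.from B))⟩

variable (X Y : SimplicialObject C) [∀ m, HasBinaryProduct (X.obj m) (Y.obj m)]

/-- The levelwise product of two simplicial objects. -/
noncomputable def levelwiseProd : SimplicialObject C where
  obj m := X.obj m ⨯ Y.obj m
  map τ := prod.map (X.map τ) (Y.map τ)

/-- The first projection from the levelwise product. -/
noncomputable def levelwiseFst : levelwiseProd X Y ⟶ X where
  app _ := prod.fst
  naturality _ _ _ := prod.map_fst ..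

/-- The second projection from the levelwise product. -/
noncomputable def levelwiseSnd : levelwiseProd X Y ⟶ Y where
  app _ := prod.snd
  naturality _ _ _ := prod.map_snd ..

variable {X Y}

theorem levelwiseProd_hom_ext {T : C} {m : SimplexCategoryᵒᵖ}
    {s s' : T ⟶ (levelwiseProd X Y).obj m}
    (h : s ≫ (levelwiseFst X Y).app m = s' ≫ (levelwiseFst X Y).app m)
    (h' : s ≫ (levelwiseSnd X Y).app m = s' ≫ (levelwiseSnd X Y).app m) : s = s' :=
  prod.hom_ext h h'

variable {n : ℕ} {S : Sieve ⦋n⦌} (c : Cone (sieveDiagram X S)) (c' : Cone (sieveDiagram Y S))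
  [HasBinaryProduct c.pt c'.pt]

/-- The product of two matching families. -/
noncomputable def levelwiseProj {k : SimplexCategory} (f : k ⟶ ⦋n⦌) (hf : S f) :
    c.pt ⨯ c'.pt ⟶ (levelwiseProd X Y).obj (op k) :=
  prod.map (proj c f hf) (proj c' f hf)

@[simp]
theorem levelwiseProj_fst {k : SimplexCategory} (f : k ⟶ ⦋n⦌) (hf : S f) :
    levelwiseProj c c' f hf ≫ (levelwiseFst X Y).app (op k) = prod.fst ≫ proj c f hf :=
  prod.map_fst ..

@[simp]
theorem levelwiseProj_snd {k : SimplexCategory} (f : k ⟶ ⦋n⦌) (hf : S f) :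
    levelwiseProj c c' f hf ≫ (levelwiseSnd X Y).app (op k) = prod.snd ≫ proj c' f hf :=
  prod.map_snd ..

theorem levelwiseProj_comp_map {k l : SimplexCategory} (f : k ⟶ ⦋n⦌) (hf : S f) (g : l ⟶ k) :
    levelwiseProj c c' f hf ≫ (levelwiseProd X Y).map g.op =
      levelwiseProj c c' (g ≫ f) (S.downward_closed hf g) :=
  (prod.map_map ..).trans <| congr_arg₂ prod.map (proj_w c f hf g _ _ rfl)
    (proj_w c' f hf g _ _ rfl)

variable {c c'}

theorem nonempty_isLimit_levelwiseProd (hc : IsLimit c) (hc' : IsLimit c') :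
    Nonempty (IsLimit (coneOfFamily (levelwiseProd X Y) S (c.pt ⨯ c'.pt)
      (levelwiseProj c c') (levelwiseProj_comp_map c c'))) := by
  refine exists_isLimit _ _ _ (fun r => ?_) fun {T} t t' h => ?_
  · obtain ⟨t, ht⟩ := exists_lift hc (fun f hf => proj r f hf ≫ (levelwiseFst X Y).app _)
      fun f hf g => by
        rw [Category.assoc, ← NatTrans.naturality, ← Category.assoc, proj_w r f hf g _ _ rfl]
    obtain ⟨t', ht'⟩ := exists_lift hc' (fun f hf => proj r f hf ≫ (levelwiseSnd X Y).app _)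
      fun f hf g => by
        rw [Category.assoc, ← NatTrans.naturality, ← Category.assoc, proj_w r f hf g _ _ rfl]
    exact ⟨prod.lift t t', fun f hf => levelwiseProd_hom_ext
      (by rw [Category.assoc, levelwiseProj_fst, prod.lift_fst_assoc, ht])
      (by rw [Category.assoc, levelwiseProj_snd, prod.lift_snd_assoc, ht'])⟩
  · exact prod.hom_ext
      (proj_hom_ext hc fun f hf => by simpa using congr($(h f hf) ≫ (levelwiseFst X Y).app _))
      (proj_hom_ext hc' fun f hf => by simpa using congr($(h f hf) ≫ (levelwiseSnd X Y).app _))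

theorem isReedy_levelwiseProd {P : MorphismProperty C} [P.IsMultiplicative] [P.HasPullbacks]
    [P.IsStableUnderBaseChange] {T : C} (hT : IsTerminal T) (hX : IsReedy P X)
    (hY : IsReedy P Y) : IsReedy P (levelwiseProd X Y) := by
  intro n
  obtain ⟨c, hc, hP⟩ := hX n
  obtain ⟨c', hc', hP'⟩ := hY n
  obtain ⟨d, hd, hdT⟩ := exists_limit hX hT (boundary n)
  have hcT : P (hT.from c.pt) := by
    rw [← hT.hom_ext ((hc.conePointUniqueUpToIso hd).hom ≫ hT.from d.pt) (hT.from c.pt)]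
    exact (P.cancel_left_of_respectsIso _ _).2 hdT
  have (B : C) : HasBinaryProduct c.pt B := hasBinaryProduct_of_mem hT hcT B
  obtain ⟨h⟩ := nonempty_isLimit_levelwiseProd hc hc'
  refine exists_matchingMap_mem h (μ := prod.map (matchingMap hc) (matchingMap hc'))
    (fun f hf => ?_) (prod_map_mem hP hP')
  exact (prod.map_map ..).trans
    (congr_arg₂ prod.map (matchingMap_proj hc f hf) (matchingMap_proj hc' f hf))

end Product

section Faces

variable {C : Type u} [Category.{v} C]

/-- The faces of a map `∂Δ_{k+1} ⟶ X` over `T`: the `y j : T ⟶ X_k`, which agree on the common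
faces of the `j`-th and `j'`-th facet of the simplex. -/
def IsBoundaryFamily (X : SimplicialObject C) {k : ℕ} {T : C}
    (y : Fin (k + 2) → (T ⟶ X.obj (op ⦋k⦌))) : Prop :=
  ∀ {l : SimplexCategory} (θ θ' : l ⟶ ⦋k⦌) (j j' : Fin (k + 2)),
    θ ≫ SimplexCategory.δ j = θ' ≫ SimplexCategory.δ j' →
      y j ≫ X.map θ.op = y j' ≫ X.map θ'.op

theorem comp_δ_apply_ne {k : ℕ} {l : SimplexCategory} (θ : l ⟶ ⦋k⦌) (j : Fin (k + 2))
    (a : Fin (l.len + 1)) : (θ ≫ SimplexCategory.δ j).toOrderHom a ≠ j := by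
  change (SimplexCategory.δ j).toOrderHom (θ.toOrderHom a) ≠ j
  exact Fin.succAbove_ne _ _

theorem isBoundaryFamily_zero (X : SimplicialObject C) {T : C}
    (y : Fin 2 → (T ⟶ X.obj (op ⦋0⦌))) : IsBoundaryFamily X (k := 0) y := by
  intro l θ θ' j j' h
  have hj := comp_δ_apply_ne θ j 0
  have hj' := comp_δ_apply_ne θ' j' 0
  rw [h] at hj
  obtain rfl : j = j' := by
    generalize (θ' ≫ SimplexCategory.δ j').toOrderHom 0 = z at hj hj'
    have : (z : ℕ) < 2 := z.2
    omega
  rw [(cancel_mono _).1 h]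

theorem exists_eq_comp_δ_of_comp_δ_eq {k : ℕ} {l : SimplexCategory} {θ θ' : l ⟶ ⦋k + 1⦌}
    {i j : Fin (k + 2)} (hij : i ≤ j)
    (h : θ ≫ SimplexCategory.δ i.castSucc = θ' ≫ SimplexCategory.δ j.succ) :
    ∃ ρ : l ⟶ ⦋k⦌, θ = ρ ≫ SimplexCategory.δ j ∧ θ' = ρ ≫ SimplexCategory.δ i := by
  obtain ⟨ρ, rfl⟩ := SimplexCategory.eq_comp_δ_of_not_surjective' θ' i fun a ha => by
    refine comp_δ_apply_ne θ i.castSucc a (h ▸ ?_)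
    change (SimplexCategory.δ j.succ).toOrderHom (θ'.toOrderHom a) = _
    rw [ha]
    exact Fin.succAbove_of_castSucc_lt _ _ (Fin.castSucc_lt_succ_iff.2 hij)
  rw [Category.assoc, SimplexCategory.δ_comp_δ hij, ← Category.assoc, cancel_mono] at h
  exact ⟨ρ, h, rfl⟩

theorem isBoundaryFamily_succ (X : SimplicialObject C) {k : ℕ} {T : C}
    (y : Fin (k + 3) → (T ⟶ X.obj (op ⦋k + 1⦌)))
    (hy : ∀ i j : Fin (k + 2), i ≤ j → y j.succ ≫ X.δ i = y i.castSucc ≫ X.δ j) :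
    IsBoundaryFamily X y := by
  have of_lt {l : SimplexCategory} (θ θ' : l ⟶ ⦋k + 1⦌) (j j' : Fin (k + 3)) (hj : j < j')
      (h : θ ≫ SimplexCategory.δ j = θ' ≫ SimplexCategory.δ j') :
      y j ≫ X.map θ.op = y j' ≫ X.map θ'.op := by
    obtain ⟨i, rfl⟩ := Fin.exists_castSucc_eq.2 (Fin.ne_last_of_lt hj)
    obtain ⟨j, rfl⟩ := Fin.exists_succ_eq.2 (Fin.ne_zero_of_lt hj)
    have hij : i ≤ j := Fin.castSucc_lt_succ_iff.1 hj
    obtain ⟨ρ, rfl, rfl⟩ := exists_eq_comp_δ_of_comp_δ_eq hij h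
    simpa [SimplicialObject.δ] using congr($((hy i j hij).symm) ≫ X.map ρ.op)
  intro l θ θ' j j' h
  rcases lt_trichotomy j j' with hj | rfl | hj
  · exact of_lt _ _ _ _ hj h
  · rw [(cancel_mono _).1 h]
  · exact (of_lt _ _ _ _ hj h.symm).symm

theorem boundary_δ {k : ℕ} (j : Fin (k + 2)) : boundary (k + 1) (SimplexCategory.δ j) := by
  intro h
  obtain ⟨a, ha⟩ := SimplexCategory.epi_iff_surjective.1 h j
  exact Fin.succAbove_ne _ _ ha

theorem IsBoundaryFamily.exists_matching {X : SimplicialObject C} {k : ℕ} {T : C}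
    {y : Fin (k + 2) → (T ⟶ X.obj (op ⦋k⦌))} (hy : IsBoundaryFamily X y)
    {M : Cone (sieveDiagram X (boundary (k + 1)))} (hM : IsLimit M) :
    ∃ t : T ⟶ M.pt, ∀ j, t ≫ proj M (SimplexCategory.δ j) (boundary_δ j) = y j := by
  have factor {l : SimplexCategory} (f : l ⟶ ⦋k + 1⦌) (hf : boundary (k + 1) f) :
      ∃ (j : Fin (k + 2)) (θ : l ⟶ ⦋k⦌), f = θ ≫ SimplexCategory.δ j :=
    SimplexCategory.eq_comp_δ_of_not_surjective f fun h =>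
      hf (SimplexCategory.epi_iff_surjective.2 h)
  choose j θ hθ using @factor
  obtain ⟨t, ht⟩ := exists_lift hM (fun f hf => y (j f hf) ≫ X.map (θ f hf).op) fun f hf g => by
    rw [Category.assoc, ← X.map_comp, ← op_comp]
    exact hy _ _ _ _ (by rw [Category.assoc, ← hθ, ← hθ])
  refine ⟨t, fun i => (ht _ _).trans ?_⟩
  simpa using hy (θ _ (boundary_δ i)) (𝟙 _) (j _ (boundary_δ i)) i
    (by rw [← hθ, Category.id_comp])

theorem IsReedy.exists_filling {P : MorphismProperty C} [P.HasPullbacks]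
    [P.IsStableUnderBaseChange] {X : SimplicialObject C} (hX : IsReedy P X) {k : ℕ} {T : C}
    {y : Fin (k + 2) → (T ⟶ X.obj (op ⦋k⦌))} (hy : IsBoundaryFamily X y) :
    ∃ (T' : C) (c : T' ⟶ T) (x : T' ⟶ X.obj (op ⦋k + 1⦌)), P c ∧
      ∀ j, x ≫ X.δ j = c ≫ y j := by
  obtain ⟨M, hM, hP⟩ := hX (k + 1)
  obtain ⟨t, ht⟩ := hy.exists_matching hM
  have := P.hasPullback t hP
  refine ⟨pullback (matchingMap hM) t, pullback.snd _ _, pullback.fst _ _, P.pullback_snd _ _ hP,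
    fun j => ?_⟩
  rw [← ht, ← pullback.condition_assoc, matchingMap_proj, SimplicialObject.δ]

end Faces

section LocalCones

variable {C : Type u} [Category.{v} C]

theorem exists_common_cover {P : MorphismProperty C} [P.IsMultiplicative] [P.HasPullbacks]
    [P.IsStableUnderBaseChange] {T : C} {ι : Type*} {A : Set ι} (hA : A.Finite)
    (R : ι → ∀ {T' : C}, (T' ⟶ T) → Prop)
    (hR : ∀ a {T' T'' : C} (d : T'' ⟶ T') (c : T' ⟶ T), R a c → R a (d ≫ c))
    (h : ∀ a ∈ A, ∃ (T' : C) (c : T' ⟶ T), P c ∧ R a c) :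
    ∃ (T' : C) (c : T' ⟶ T), P c ∧ ∀ a ∈ A, R a c := by
  induction A, hA using Set.Finite.induction_on with
  | empty => exact ⟨T, 𝟙 T, P.id_mem T, by simp⟩
  | @insert a A _ _ ih =>
    obtain ⟨T₁, c₁, h₁, hA⟩ := ih fun b hb => h b (.inr hb)
    obtain ⟨T₂, c₂, h₂, ha⟩ := h a (.inl rfl)
    have := P.hasPullback c₁ h₂
    refine ⟨pullback c₂ c₁, pullback.snd _ _ ≫ c₁,
      P.comp_mem _ _ (P.pullback_snd _ _ h₂) h₁, ?_⟩
    rintro b (rfl | hb)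
    · exact pullback.condition (f := c₂) (g := c₁) ▸ hR _ _ _ ha
    · exact hR _ _ _ (hA b hb)

theorem IsReedy.terminal_from_mem {P : MorphismProperty C} [P.IsMultiplicative] [P.HasPullbacks]
    [P.IsStableUnderBaseChange] {X : SimplicialObject C} (hX : IsReedy P X) {T₀ : C}
    (hT₀ : IsTerminal T₀) (n : ℕ) : P (hT₀.from (X.obj (op ⦋n⦌))) := by
  obtain ⟨c, hc, hP⟩ := hX n
  obtain ⟨d, hd, hdT⟩ := exists_limit hX hT₀ (boundary n)
  rw [← hT₀.hom_ext (matchingMap hd ≫ hT₀.from d.pt) (hT₀.from (X.obj (op ⦋n⦌)))]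
  exact P.comp_mem _ _ (matchingMap_mem_of_isLimit hP hd) hdT

variable {X : SimplicialObject C} {T T' T'' : C}

/-- The face opposite to the vertex `j` of `x` in the cone over the simplex `x` with apex `v`,
where `s` sends a simplex to the cone over it. -/
def coneFace (v : T' ⟶ X.obj (op ⦋0⦌))
    (s : ∀ k : ℕ, (T ⟶ X.obj (op ⦋k⦌)) → (T' ⟶ X.obj (op ⦋k + 1⦌))) (k : ℕ) :
    (T ⟶ X.obj (op ⦋k⦌)) → Fin (k + 1) → (T' ⟶ X.obj (op ⦋k⦌)) :=
  match k with
  | 0 => fun _ _ => v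
  | k + 1 => fun x j => s k (x ≫ X.δ j)

theorem coneFace_comp (d : T'' ⟶ T') (v : T' ⟶ X.obj (op ⦋0⦌))
    (s : ∀ k : ℕ, (T ⟶ X.obj (op ⦋k⦌)) → (T' ⟶ X.obj (op ⦋k + 1⦌))) {k : ℕ}
    (x : T ⟶ X.obj (op ⦋k⦌)) (j : Fin (k + 1)) :
    coneFace (d ≫ v) (fun k x => d ≫ s k x) k x j = d ≫ coneFace v s k x j := by
  cases k <;> rfl

theorem coneFace_congr {v : T' ⟶ X.obj (op ⦋0⦌)}
    {s s' : ∀ k : ℕ, (T ⟶ X.obj (op ⦋k⦌)) → (T' ⟶ X.obj (op ⦋k + 1⦌))} {n : ℕ}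
    (h : ∀ k < n, s k = s' k) (x : T ⟶ X.obj (op ⦋n⦌)) (j : Fin (n + 1)) :
    coneFace v s n x j = coneFace v s' n x j := by
  cases n with
  | zero => rfl
  | succ n => exact congr_fun (h n n.lt_succ_self) _

/-- The map `s` sends every simplex of `X(T)` of dimension less than `n` that is in `S` to a simplex
of `X(T')` that is a cone with apex `v` over its restriction along `c`. -/
structure IsLocalCone (S : ∀ k : ℕ, Set (T ⟶ X.obj (op ⦋k⦌))) (n : ℕ) (c : T' ⟶ T)
    (v : T' ⟶ X.obj (op ⦋0⦌))
    (s : ∀ k : ℕ, (T ⟶ X.obj (op ⦋k⦌)) → (T' ⟶ X.obj (op ⦋k + 1⦌))) : Prop where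
  δ_zero {k : ℕ} (hk : k < n) {x : T ⟶ X.obj (op ⦋k⦌)} (hx : x ∈ S k) : s k x ≫ X.δ 0 = c ≫ x
  δ_succ {k : ℕ} (hk : k < n) {x : T ⟶ X.obj (op ⦋k⦌)} (hx : x ∈ S k) (j : Fin (k + 1)) :
    s k x ≫ X.δ j.succ = coneFace v s k x j

namespace IsLocalCone

variable {S : ∀ k : ℕ, Set (T ⟶ X.obj (op ⦋k⦌))} {n : ℕ} {c : T' ⟶ T}
  {v : T' ⟶ X.obj (op ⦋0⦌)} {s : ∀ k : ℕ, (T ⟶ X.obj (op ⦋k⦌)) → (T' ⟶ X.obj (op ⦋k + 1⦌))}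

theorem comp_left (h : IsLocalCone S n c v s) (d : T'' ⟶ T') :
    IsLocalCone S n (d ≫ c) (d ≫ v) fun k x => d ≫ s k x where
  δ_zero hk _ hx := by simp [h.δ_zero hk hx]
  δ_succ hk _ hx j := by rw [Category.assoc, h.δ_succ hk hx, coneFace_comp]

theorem update (h : IsLocalCone S n c v s) {t : (T ⟶ X.obj (op ⦋n⦌)) → (T' ⟶ X.obj (op ⦋n + 1⦌))}
    (ht₀ : ∀ x ∈ S n, t x ≫ X.δ 0 = c ≫ x)
    (ht : ∀ x ∈ S n, ∀ j, t x ≫ X.δ j.succ = coneFace v s n x j) :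
    IsLocalCone S (n + 1) c v (Function.update s n t) := by
  have e {k : ℕ} (hk : k < n) : Function.update s n t k = s k :=
    Function.update_of_ne hk.ne _ _
  have e' {k : ℕ} (hk : k ≤ n) (x : T ⟶ X.obj (op ⦋k⦌)) (j : Fin (k + 1)) :
      coneFace v (Function.update s n t) k x j = coneFace v s k x j :=
    coneFace_congr (fun l hl => e (hl.trans_le hk)) x j
  constructor
  · intro k hk x hx
    obtain hk | rfl := Nat.lt_succ_iff_lt_or_eq.1 hk
    · rw [e hk, h.δ_zero hk hx]
    · rw [Function.update_self, ht₀ x hx]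
  · intro k hk x hx j
    rw [e' (Nat.lt_succ_iff.1 hk)]
    obtain hk | rfl := Nat.lt_succ_iff_lt_or_eq.1 hk
    · rw [e hk, h.δ_succ hk hx]
    · rw [Function.update_self, ht x hx]

theorem coneFace_comp_δ (h : IsLocalCone S (n + 1) c v s)
    (hS : ∀ k, ∀ x ∈ S (k + 1), ∀ j, x ≫ X.δ j ∈ S k) {x : T ⟶ X.obj (op ⦋n + 1⦌)}
    (hx : x ∈ S (n + 1)) {a b : Fin (n + 1)} (hab : a ≤ b) :
    coneFace v s (n + 1) x b.succ ≫ X.δ a.succ =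
      coneFace v s (n + 1) x a.castSucc ≫ X.δ b.succ := by
  refine (h.δ_succ n.lt_succ_self (hS _ _ hx _) _).trans
    (Eq.trans ?_ (h.δ_succ n.lt_succ_self (hS _ _ hx _) _).symm)
  cases n with
  | zero => rfl
  | succ n => simp only [coneFace, Category.assoc, X.δ_comp_δ hab]

theorem isBoundaryFamily (h : IsLocalCone S n c v s)
    (hS : ∀ k, ∀ x ∈ S (k + 1), ∀ j, x ≫ X.δ j ∈ S k) {x : T ⟶ X.obj (op ⦋n⦌)} (hx : x ∈ S n) :
    IsBoundaryFamily X (Fin.cons (c ≫ x) (coneFace v s n x) :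
      Fin (n + 2) → (T' ⟶ X.obj (op ⦋n⦌))) := by
  cases n with
  | zero => exact isBoundaryFamily_zero X _
  | succ n =>
    refine isBoundaryFamily_succ X _ fun a b hab => ?_
    cases a using Fin.cases with
    | zero => exact (h.δ_zero n.lt_succ_self (hS _ _ hx b)).trans (Category.assoc ..).symm
    | succ a =>
      cases b using Fin.cases with
      | zero => simp at hab
      | succ b => exact h.coneFace_comp_δ hS hx (Fin.succ_le_succ_iff.1 hab)

theorem comp_boundary_add {k : ℕ} {B B' : Type*} [AddCommGroup B] [AddCommGroup B']
    {β : (T' ⟶ X.obj (op ⦋k⦌)) → B} {β' : (T' ⟶ X.obj (op ⦋k + 1⦌)) → B'} {d : B' →+ B}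
    (hd : ∀ x, d (β' x) = ∑ j : Fin (k + 2), (-1 : ℤ) ^ (j : ℕ) • β (x ≫ X.δ j))
    (h : IsLocalCone S n c v s) (hk : k < n) {x : T ⟶ X.obj (op ⦋k⦌)} (hx : x ∈ S k) :
    d (β' (s k x)) + ∑ j : Fin (k + 1), (-1 : ℤ) ^ (j : ℕ) • β (coneFace v s k x j) =
      β (c ≫ x) := by
  rw [hd, Fin.sum_univ_succ, h.δ_zero hk hx, add_assoc, ← Finset.sum_add_distrib]
  simp [h.δ_succ hk hx, pow_succ]

end IsLocalCone

section

variable {P : MorphismProperty C} [P.IsMultiplicative] [P.HasPullbacks]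
  [P.IsStableUnderBaseChange] {T₀ : C}

/- By induction on `n`: the faces of the cone over `x` form the boundary of a simplex, which can be
filled after passing to a cover. -/
theorem exists_isLocalCone_of_finite (hX : IsReedy P X) (hT₀ : IsTerminal T₀)
    (S : ∀ k : ℕ, Set (T ⟶ X.obj (op ⦋k⦌))) (hfin : ∀ k, (S k).Finite)
    (hS : ∀ k, ∀ x ∈ S (k + 1), ∀ j, x ≫ X.δ j ∈ S k) (n : ℕ) :
    ∃ (T' : C) (c : T' ⟶ T) (v : T' ⟶ X.obj (op ⦋0⦌))
      (s : ∀ k : ℕ, (T ⟶ X.obj (op ⦋k⦌)) → (T' ⟶ X.obj (op ⦋k + 1⦌))),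
      P c ∧ IsLocalCone S n c v s := by
  induction n with
  | zero =>
    have h := hX.terminal_from_mem hT₀ 0
    have := P.hasPullback (hT₀.from T) h
    let v := pullback.fst (hT₀.from (X.obj (op ⦋0⦌))) (hT₀.from T)
    exact ⟨_, pullback.snd _ _, v, fun k _ => v ≫ X.map (SimplexCategory.const ⦋k + 1⦌ ⦋0⦌ 0).op,
      P.pullback_snd _ _ h, ⟨fun hk => (Nat.not_lt_zero _ hk).elim,
        fun hk => (Nat.not_lt_zero _ hk).elim⟩⟩
  | succ n ih =>
    obtain ⟨T', c, v, s, hc, h⟩ := ih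
    obtain ⟨T'', d, hd, hfill⟩ := exists_common_cover (P := P) (T := T') (hfin n)
      (fun x T'' d => ∃ t : T'' ⟶ X.obj (op ⦋n + 1⦌), t ≫ X.δ 0 = d ≫ c ≫ x ∧
        ∀ j, t ≫ X.δ j.succ = d ≫ coneFace v s n x j)
      (fun x T' T'' a d ⟨t, ht₀, ht⟩ => ⟨a ≫ t, by simp [ht₀], by simp [ht]⟩) fun x hx => by
        obtain ⟨T'', d, t, hd, ht⟩ := hX.exists_filling (h.isBoundaryFamily hS hx)
        exact ⟨T'', d, hd, t, ht 0, fun j => ht j.succ⟩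
    have hfill (x) : ∃ t : T'' ⟶ X.obj (op ⦋n + 1⦌), x ∈ S n → t ≫ X.δ 0 = d ≫ c ≫ x ∧
        ∀ j, t ≫ X.δ j.succ = d ≫ coneFace v s n x j := by
      by_cases hx : x ∈ S n
      · obtain ⟨t, ht⟩ := hfill x hx
        exact ⟨t, fun _ => ht⟩
      · exact ⟨d ≫ s n x, fun h => (hx h).elim⟩
    choose t ht using hfill
    exact ⟨T'', d ≫ c, d ≫ v, _, P.comp_mem _ _ hd hc, (h.comp_left d).update
      (fun x hx => by rw [(ht x hx).1, Category.assoc])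
      fun x hx j => by rw [(ht x hx).2, coneFace_comp]⟩

theorem exists_isLocalCone (hX : IsReedy P X) (hT₀ : IsTerminal T₀) {n : ℕ}
    {A : Set (T ⟶ X.obj (op ⦋n⦌))} (hA : A.Finite) :
    ∃ (S : ∀ k : ℕ, Set (T ⟶ X.obj (op ⦋k⦌))) (_ : A ⊆ S n) (T' : C) (c : T' ⟶ T)
      (v : T' ⟶ X.obj (op ⦋0⦌))
      (s : ∀ k : ℕ, (T ⟶ X.obj (op ⦋k⦌)) → (T' ⟶ X.obj (op ⦋k + 1⦌))),
      P c ∧ IsLocalCone S (n + 1) c v s := by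
  refine ⟨fun k => {y | ∃ x ∈ A, ∃ θ : ⦋k⦌ ⟶ ⦋n⦌, x ≫ X.map θ.op = y},
    fun x hx => ⟨x, hx, 𝟙 _, by simp⟩,
    exists_isLocalCone_of_finite hX hT₀ _ (fun k => ?_) ?_ (n + 1)⟩
  · refine ((hA.prod (Set.finite_univ (α := ⦋k⦌ ⟶ ⦋n⦌))).image
      fun p => p.1 ≫ X.map p.2.op).subset ?_
    rintro _ ⟨x, hx, θ, rfl⟩
    exact ⟨(x, θ), ⟨hx, trivial⟩, rfl⟩
  · rintro k _ ⟨x, hx, θ, rfl⟩ j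
    exact ⟨x, hx, SimplexCategory.δ j ≫ θ, by simp [SimplicialObject.δ]⟩

end

end LocalCones

noncomputable section Chains

variable {C : Type u} [Category.{v} C]

/-- The embedding of `C` into the free preadditive category on `C`, whose morphisms are the formal
linear combinations of morphisms of `C`. -/
abbrev lin : C ⥤ Free ℤ C := Free.embedding ℤ C

theorem lin_hom_eq_sum {T A : C} (z : lin.obj T ⟶ lin.obj A) :
    ∃ (S : Finset (T ⟶ A)) (a : (T ⟶ A) → ℤ), z = ∑ x ∈ S, a x • lin.map x := by
  let z' : (T ⟶ A) →₀ ℤ := z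
  refine ⟨z'.support, z', (Finsupp.sum_single z').symm.trans (Finset.sum_congr rfl fun x _ => ?_)⟩
  change Finsupp.single x (z' x) = z' x • Finsupp.single x (1 : ℤ)
  simp

/-- The additive extension of a function on morphisms of `C` to formal linear combinations. -/
def linExtend {T A : C} {B : Type*} [AddCommGroup B] (σ : (T ⟶ A) → B) :
    (lin.obj T ⟶ lin.obj A) →+ B :=
  (Finsupp.liftAddHom fun x => zmultiplesHom B (σ x) : ((T ⟶ A) →₀ ℤ) →+ B)

@[simp]
theorem linExtend_map {T A : C} {B : Type*} [AddCommGroup B] (σ : (T ⟶ A) → B) (x : T ⟶ A) :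
    linExtend σ (lin.map x) = σ x :=
  (Finsupp.liftAddHom_apply_single ..).trans (one_zsmul (σ x))

/-- The differential of the chain complex of `X` in the free preadditive category. -/
def linD (X : SimplicialObject C) (k : ℕ) :
    lin.obj (X.obj (op ⦋k + 1⦌)) ⟶ lin.obj (X.obj (op ⦋k⦌)) :=
  ∑ j : Fin (k + 2), (-1 : ℤ) ^ (j : ℕ) • lin.map (X.δ j)

theorem linD_comp_linD (X : SimplicialObject C) (k : ℕ) : linD X (k + 1) ≫ linD X k = 0 :=
  AlgebraicTopology.AlternatingFaceMapComplex.d_squared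
    (((SimplicialObject.whiskering C (Free ℤ C)).obj lin).obj X) k

theorem linD_naturality {X Y : SimplicialObject C} (f : X ⟶ Y) (k : ℕ) :
    linD X k ≫ lin.map (f.app _) = lin.map (f.app _) ≫ linD Y k := by
  simp only [linD, Preadditive.sum_comp, Preadditive.comp_sum, Preadditive.zsmul_comp,
    Preadditive.comp_zsmul, ← Functor.map_comp]
  exact Finset.sum_congr rfl fun j _ => congr((-1 : ℤ) ^ (j : ℕ) • lin.map $(f.naturality _))

theorem lin_comp_linD {T : C} (X : SimplicialObject C) (k : ℕ) (x : T ⟶ X.obj (op ⦋k + 1⦌)) :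
    lin.map x ≫ linD X k = ∑ j : Fin (k + 2), (-1 : ℤ) ^ (j : ℕ) • lin.map (x ≫ X.δ j) := by
  simp only [linD, Preadditive.comp_sum, Preadditive.comp_zsmul, Functor.map_comp]

theorem IsLocalCone.boundary_sum {X : SimplicialObject C} {T T' : C}
    {S : ∀ k : ℕ, Set (T ⟶ X.obj (op ⦋k⦌))} {n k : ℕ} {c : T' ⟶ T} {v : T' ⟶ X.obj (op ⦋0⦌)}
    {s : ∀ k : ℕ, (T ⟶ X.obj (op ⦋k⦌)) → (T' ⟶ X.obj (op ⦋k + 1⦌))} (h : IsLocalCone S n c v s)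
    (hk : k < n) {A : Finset (T ⟶ X.obj (op ⦋k⦌))} (hA : ↑A ⊆ S k)
    {a : (T ⟶ X.obj (op ⦋k⦌)) → ℤ}
    (ha : ∑ x ∈ A, a x • ∑ j : Fin (k + 1), (-1 : ℤ) ^ (j : ℕ) • lin.map (coneFace v s k x j) =
      0) :
    (∑ x ∈ A, a x • lin.map (s k x)) ≫ linD X k = lin.map c ≫ ∑ x ∈ A, a x • lin.map x := by
  rw [Preadditive.sum_comp, Preadditive.comp_sum, ← add_zero (∑ x ∈ A, _ ≫ _), ← ha,
    ← Finset.sum_add_distrib]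
  refine Finset.sum_congr rfl fun x hx => ?_
  rw [Preadditive.zsmul_comp, Preadditive.comp_zsmul, ← Functor.map_comp, ← smul_add]
  exact congr(a x • $(h.comp_boundary_add (d := Preadditive.rightComp _ (linD X k))
    (lin_comp_linD X k) hk (hA hx)))

variable {P : MorphismProperty C} [P.IsMultiplicative] [P.HasPullbacks]
  [P.IsStableUnderBaseChange] {T₀ : C} {X Y : SimplicialObject C}

theorem exists_linD_eq_zero (hX : IsReedy P X) (hT₀ : IsTerminal T₀) {T : C}
    (z : lin.obj T ⟶ lin.obj (X.obj (op ⦋0⦌))) (hz : z ≫ lin.map (hT₀.from _) = 0) :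
    ∃ (T' : C) (c : T' ⟶ T) (y : lin.obj T' ⟶ lin.obj (X.obj (op ⦋1⦌))), P c ∧
      y ≫ linD X 0 = lin.map c ≫ z := by
  obtain ⟨A, a, rfl⟩ := lin_hom_eq_sum z
  obtain ⟨S, hA, T', c, v, s, hc, h⟩ := exists_isLocalCone hX hT₀ A.finite_toSet
  refine ⟨T', c, _, hc, h.boundary_sum (Nat.lt_succ_self 0) hA ?_⟩
  have e := congr_arg (linExtend fun _ : T ⟶ T₀ => lin.map v) hz
  simp only [Preadditive.sum_comp, Preadditive.zsmul_comp, ← Functor.map_comp, map_sum,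
    map_zsmul, map_zero, linExtend_map] at e
  refine Eq.trans (Finset.sum_congr rfl fun x _ => ?_) e
  congr 1
  exact (Fin.sum_univ_one _).trans (one_zsmul _)

theorem exists_linD_eq_succ (hX : IsReedy P X) (hT₀ : IsTerminal T₀) {T : C} {k : ℕ}
    (z : lin.obj T ⟶ lin.obj (X.obj (op ⦋k + 1⦌))) (hz : z ≫ linD X k = 0) :
    ∃ (T' : C) (c : T' ⟶ T) (y : lin.obj T' ⟶ lin.obj (X.obj (op ⦋k + 2⦌))), P c ∧
      y ≫ linD X (k + 1) = lin.map c ≫ z := by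
  obtain ⟨A, a, rfl⟩ := lin_hom_eq_sum z
  obtain ⟨S, hA, T', c, v, s, hc, h⟩ := exists_isLocalCone hX hT₀ A.finite_toSet
  refine ⟨T', c, _, hc, h.boundary_sum (Nat.lt_succ_self _) hA ?_⟩
  have e := congr_arg (linExtend fun x => lin.map (s k x)) hz
  simp only [Preadditive.sum_comp, Preadditive.zsmul_comp, lin_comp_linD, map_sum,
    map_zsmul, map_zero, linExtend_map] at e
  exact e

theorem exists_refinement (hX : IsReedy P X) {n : ℕ} {A : C} {c : A ⟶ X.obj (op ⦋n⦌)}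
    (hc : P c) : ∃ (X' : SimplicialObject C) (_ : IsReedy P X') (φ : X' ⟶ X)
      (a : X'.obj (op ⦋n⦌) ⟶ A), a ≫ c = φ.app (op ⦋n⦌) := by
  choose W _ using fun m : SimplexCategoryᵒᵖ =>
    MultiPullback.exists_base_mem hc fun θ : ⦋n⦌ ⟶ m.unop => X.map θ.op
  exact ⟨refinement W, isReedy_refinement hX hc, refinementMap W, refinementCoord W (𝟙 _),
    by rw [refinementCoord_comp, op_id, X.map_id, Category.comp_id]⟩

/-- The degree `k` part of `d ≫ H`, for a homotopy `H` between the chain complexes of `X`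
and `Y` in the free preadditive category. -/
def linDComp (H : ∀ k : ℕ, lin.obj (X.obj (op ⦋k⦌)) ⟶ lin.obj (Y.obj (op ⦋k + 1⦌))) (k : ℕ) :
    lin.obj (X.obj (op ⦋k⦌)) ⟶ lin.obj (Y.obj (op ⦋k⦌)) :=
  match k with
  | 0 => 0
  | k + 1 => linD X k ≫ H k

theorem linDComp_congr
    {H H' : ∀ k : ℕ, lin.obj (X.obj (op ⦋k⦌)) ⟶ lin.obj (Y.obj (op ⦋k + 1⦌))} {k : ℕ}
    (h : ∀ j < k, H j = H' j) : linDComp H k = linDComp H' k := by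
  cases k with
  | zero => rfl
  | succ k => exact congr(linD X k ≫ $(h k k.lt_succ_self))

theorem comp_linDComp {X' : SimplicialObject C} (φ : X' ⟶ X)
    (H : ∀ k : ℕ, lin.obj (X.obj (op ⦋k⦌)) ⟶ lin.obj (Y.obj (op ⦋k + 1⦌))) (k : ℕ) :
    lin.map (φ.app _) ≫ linDComp H k = linDComp (fun k => lin.map (φ.app _) ≫ H k) k := by
  cases k with
  | zero => exact comp_zero
  | succ k =>
    change _ ≫ linD X k ≫ H k = linD X' k ≫ _ ≫ H k
    rw [← Category.assoc, ← Category.assoc, linD_naturality]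

/-- In degrees less than `n`, the maps `H` form a homotopy between the maps of chain complexes
induced by `f` and `g`. -/
def IsLinHomotopy (f g : X ⟶ Y)
    (H : ∀ k : ℕ, lin.obj (X.obj (op ⦋k⦌)) ⟶ lin.obj (Y.obj (op ⦋k + 1⦌))) (n : ℕ) : Prop :=
  ∀ k < n, lin.map (f.app (op ⦋k⦌)) - lin.map (g.app (op ⦋k⦌)) = H k ≫ linD Y k + linDComp H k

namespace IsLinHomotopy

variable {f g : X ⟶ Y} {H : ∀ k : ℕ, lin.obj (X.obj (op ⦋k⦌)) ⟶ lin.obj (Y.obj (op ⦋k + 1⦌))}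
  {n : ℕ}

theorem sub_comp_linD (h : IsLinHomotopy f g H (n + 1)) :
    (lin.map (f.app (op ⦋n + 1⦌)) - lin.map (g.app (op ⦋n + 1⦌)) - linDComp H (n + 1)) ≫
      linD Y n = 0 := by
  change (_ - _ - linD X n ≫ H n) ≫ linD Y n = 0
  rw [Preadditive.sub_comp, Preadditive.sub_comp, ← linD_naturality, ← linD_naturality,
    ← Preadditive.comp_sub, h n n.lt_succ_self, Category.assoc, ← Preadditive.comp_sub,
    add_sub_cancel_left]
  cases n with
  | zero => exact comp_zero
  | succ n =>
    change _ ≫ linD X n ≫ _ = _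
    rw [← Category.assoc, linD_comp_linD, zero_comp]

theorem exists_linD_eq (h : IsLinHomotopy f g H n) (hY : IsReedy P Y) (hT₀ : IsTerminal T₀) :
    ∃ (T : C) (c : T ⟶ X.obj (op ⦋n⦌)) (y : lin.obj T ⟶ lin.obj (Y.obj (op ⦋n + 1⦌))), P c ∧
      y ≫ linD Y n = lin.map c ≫
        (lin.map (f.app (op ⦋n⦌)) - lin.map (g.app (op ⦋n⦌)) - linDComp H n) := by
  cases n with
  | zero =>
    refine exists_linD_eq_zero hY hT₀ _ ?_
    change (_ - _ - 0) ≫ _ = _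
    rw [sub_zero, Preadditive.sub_comp, ← Functor.map_comp, ← Functor.map_comp, sub_eq_zero]
    exact congr(lin.map $(hT₀.hom_ext _ _))
  | succ n => exact exists_linD_eq_succ hY hT₀ _ h.sub_comp_linD

theorem update (h : IsLinHomotopy f g H n) {X' : SimplicialObject C} (φ : X' ⟶ X)
    {y : lin.obj (X'.obj (op ⦋n⦌)) ⟶ lin.obj (Y.obj (op ⦋n + 1⦌))}
    (hy : y ≫ linD Y n = lin.map (φ.app (op ⦋n⦌)) ≫
      (lin.map (f.app (op ⦋n⦌)) - lin.map (g.app (op ⦋n⦌)) - linDComp H n)) :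
    IsLinHomotopy (φ ≫ f) (φ ≫ g)
      (Function.update (fun k => lin.map (φ.app (op ⦋k⦌)) ≫ H k) n y) (n + 1) := by
  intro k hk
  have hprev : linDComp (Function.update (fun k => lin.map (φ.app (op ⦋k⦌)) ≫ H k) n y) k =
      lin.map (φ.app (op ⦋k⦌)) ≫ linDComp H k := by
    rw [comp_linDComp]
    exact linDComp_congr fun j hj => Function.update_of_ne (by omega) _ _
  rw [hprev, NatTrans.comp_app, NatTrans.comp_app, Functor.map_comp, Functor.map_comp,
    ← Preadditive.comp_sub]
  obtain hk | rfl := Nat.lt_succ_iff_lt_or_eq.1 hk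
  · rw [Function.update_of_ne hk.ne, h k hk, Preadditive.comp_add, Category.assoc]
  · rw [Function.update_self, hy, ← Preadditive.comp_add, sub_add_cancel]

end IsLinHomotopy

theorem exists_isLinHomotopy (hX : IsReedy P X) (hY : IsReedy P Y) (hT₀ : IsTerminal T₀)
    (f g : X ⟶ Y) (n : ℕ) :
    ∃ (Z : SimplicialObject C) (_ : IsReedy P Z) (h : Z ⟶ X)
      (H : ∀ k : ℕ, lin.obj (Z.obj (op ⦋k⦌)) ⟶ lin.obj (Y.obj (op ⦋k + 1⦌))),
      IsLinHomotopy (h ≫ f) (h ≫ g) H n := by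
  induction n with
  | zero => exact ⟨X, hX, 𝟙 X, fun k => 0, fun k hk => (Nat.not_lt_zero k hk).elim⟩
  | succ n ih =>
    obtain ⟨Z, hZ, h, H, hH⟩ := ih
    obtain ⟨T, c, y, hc, hy⟩ := hH.exists_linD_eq hY hT₀
    obtain ⟨Z', hZ', φ, a, ha⟩ := exists_refinement hZ hc
    refine ⟨Z', hZ', φ ≫ h, Function.update (fun k => lin.map (φ.app (op ⦋k⦌)) ≫ H k) n
      (lin.map a ≫ y), ?_⟩
    rw [Category.assoc, Category.assoc]
    exact hH.update φ (by rw [Category.assoc, hy, ← Category.assoc, ← Functor.map_comp, ha])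

end Chains

noncomputable section Cochains

section Moore

instance isIso_homologyMap_inclusionOfMooreComplex {A : Type*} [Category* A] [Abelian A]
    (S : SimplicialObject A) (n : ℕ) : IsIso ((HomologicalComplex.homologyFunctor A _ n).map
      ((AlgebraicTopology.inclusionOfMooreComplex A).app S)) := by
  have : QuasiIso ((AlgebraicTopology.inclusionOfMooreComplex A).app S) :=
    (AlgebraicTopology.DoldKan.homotopyEquivNormalizedMooreComplexAlternatingFaceMapComplex
      (A := A) (Y := S)).quasiIso_hom
  exact inferInstanceAs (IsIso (HomologicalComplex.homologyMap _ n))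

/-- The homology of a complex in the opposite category is that of the opposite complex. -/
def homologyUnopIso (E : Type*) [Category* E] [Abelian E] {ι : Type*} (c : ComplexShape ι)
    (n : ι) : HomologicalComplex.unopFunctor E c ⋙ HomologicalComplex.homologyFunctor E c.symm n ≅
      (HomologicalComplex.homologyFunctor Eᵒᵖ c n).leftOp :=
  NatIso.ofComponents (fun K => K.unop.homologyUnop n) fun f => Quiver.Hom.op_inj
    (HomologicalComplex.homologyOp_hom_naturality
      ((HomologicalComplex.unopFunctor E c).map f) n).symm

/-- The alternating and the normalized cochain complexes of a cosimplicial object of `E`, encoded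
as a simplicial object of `Eᵒᵖ`, have the same cohomology. -/
def mooreCohomologyIso (E : Type*) [Category* E] [Abelian E] (n : ℕ) :
    (AlgebraicTopology.alternatingFaceMapComplex Eᵒᵖ).op ⋙
        HomologicalComplex.unopFunctor E (ComplexShape.down ℕ) ⋙
          HomologicalComplex.homologyFunctor E _ n ≅
      (AlgebraicTopology.normalizedMooreComplex Eᵒᵖ ⋙
        HomologicalComplex.homologyFunctor Eᵒᵖ _ n).leftOp :=
  Functor.isoWhiskerLeft _ (homologyUnopIso E _ n) ≪≫
    NatIso.ofComponents (fun S => (asIso ((HomologicalComplex.homologyFunctor Eᵒᵖ _ n).map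
      ((AlgebraicTopology.inclusionOfMooreComplex Eᵒᵖ).app S.unop))).unop) fun f =>
        Quiver.Hom.op_inj (((Functor.whiskerRight (AlgebraicTopology.inclusionOfMooreComplex Eᵒᵖ)
          (HomologicalComplex.homologyFunctor Eᵒᵖ _ n)).naturality f.unop).symm)

end Moore

variable {I : Type w} [SmallCategory I] {E : Type u} [Category.{w} E] [Abelian E]

/-- The unnormalized cochain complexes of the cosimplicial objects `P(X)`. -/
def cochains : (Iᵒᵖ ⥤ E) ⥤ (SimplicialObject I)ᵒᵖ ⥤
    HomologicalComplex E (ComplexShape.down ℕ).symm where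
  obj P := ((SimplicialObject.whiskering I Eᵒᵖ).obj P.rightOp ⋙
    AlgebraicTopology.alternatingFaceMapComplex Eᵒᵖ).op ⋙ HomologicalComplex.unopFunctor E _
  map η := Functor.whiskerRight (NatTrans.op (Functor.whiskerRight
    ((SimplicialObject.whiskering I Eᵒᵖ).map (NatTrans.rightOp η))
    (AlgebraicTopology.alternatingFaceMapComplex Eᵒᵖ))) (HomologicalComplex.unopFunctor E _)
  map_id P := by
    ext X n
    rfl
  map_comp η θ := by
    ext X n
    rfl

theorem cochains_d (P : Iᵒᵖ ⥤ E) (X : SimplicialObject I) (k : ℕ) :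
    ((cochains.obj P).obj (op X)).d k (k + 1) =
      ∑ j : Fin (k + 2), (-1 : ℤ) ^ (j : ℕ) • P.map (X.δ j).op := by
  have h := AlgebraicTopology.alternatingFaceMapComplex_obj_d
    (((SimplicialObject.whiskering I Eᵒᵖ).obj P.rightOp).obj X) k
  refine (congr_arg Quiver.Hom.unop h).trans ?_
  simp only [AlgebraicTopology.AlternatingFaceMapComplex.objD, unop_sum, unop_zsmul]
  rfl

/-- The cohomology of the unnormalized cochain complexes of the cosimplicial objects `P(X)`. -/
abbrev cochainCohomology (n : ℕ) : (Iᵒᵖ ⥤ E) ⥤ (SimplicialObject I)ᵒᵖ ⥤ E :=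
  cochains ⋙ (Functor.whiskeringRight _ _ _).obj (HomologicalComplex.homologyFunctor E _ n)

/-- The normalized and the unnormalized cochain complexes have the same cohomology. -/
def cohomologyIso (n : ℕ) : cochainCohomology (I := I) (E := E) n ≅ cohomology n :=
  NatIso.ofComponents (fun P => Functor.isoWhiskerLeft
    ((SimplicialObject.whiskering I Eᵒᵖ).obj P.rightOp).op (mooreCohomologyIso E n)) fun η => by
      ext X
      exact (mooreCohomologyIso E n).hom.naturality
        (((SimplicialObject.whiskering I Eᵒᵖ).map (NatTrans.rightOp η)).app X.unop).op

theorem homologyMap_eq_of_sub_eq {C : Type*} [Category* C] [Abelian C] {ι : Type*}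
    {c : ComplexShape ι} {K L : HomologicalComplex C c} (φ ψ : K ⟶ L) {n m : ι}
    {a : K.X m ⟶ L.X n} {b : K.X n ⟶ L.X n} (h : φ.f n - ψ.f n = K.d n m ≫ a + b)
    (hb : b = 0 ∨ ∃ (l : ι) (s : K.X n ⟶ L.X l), b = s ≫ L.d l n) :
    HomologicalComplex.homologyMap φ n = HomologicalComplex.homologyMap ψ n := by
  have hb' : b ≫ L.pOpcycles n = 0 := by
    obtain rfl | ⟨l, s, rfl⟩ := hb
    · exact zero_comp
    · rw [Category.assoc, HomologicalComplex.d_pOpcycles, comp_zero]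
  rw [← cancel_epi (HomologicalComplex.homologyπ _ n),
    ← cancel_mono (HomologicalComplex.homologyι _ n)]
  simp only [Category.assoc, HomologicalComplex.homologyι_naturality,
    HomologicalComplex.homology_π_ι_assoc, HomologicalComplex.p_opcyclesMap]
  rw [← sub_eq_zero, ← Preadditive.comp_sub, ← Preadditive.sub_comp, h, Preadditive.add_comp, hb',
    add_zero, Category.assoc, HomologicalComplex.iCycles_d_assoc, zero_comp]

section linEval

variable (P : Iᵒᵖ ⥤ E) {A B D : I}

/-- The contravariant additive extension of a presheaf `P` to the free preadditive category. -/
def linEval : (lin.obj A ⟶ lin.obj B) →+ (P.obj (op B) ⟶ P.obj (op A)) :=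
  linExtend fun f => P.map f.op

@[simp]
theorem linEval_map (f : A ⟶ B) : linEval P (lin.map f) = P.map f.op :=
  linExtend_map _ f

theorem linEval_comp (y : lin.obj A ⟶ lin.obj B) (z : lin.obj B ⟶ lin.obj D) :
    linEval P (y ≫ z) = linEval P z ≫ linEval P y := by
  obtain ⟨S, a, rfl⟩ := lin_hom_eq_sum y
  obtain ⟨T, b, rfl⟩ := lin_hom_eq_sum z
  simp only [Preadditive.sum_comp, Preadditive.comp_sum, Preadditive.zsmul_comp,
    Preadditive.comp_zsmul, map_sum, map_zsmul, linEval_map, ← Functor.map_comp, op_comp,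
    Finset.smul_sum]
  rw [Finset.sum_comm]
  exact Finset.sum_congr rfl fun x _ => Finset.sum_congr rfl fun y _ => smul_comm _ _ _

theorem linEval_linD (X : SimplicialObject I) (k : ℕ) :
    linEval P (linD X k) = ((cochains.obj P).obj (op X)).d k (k + 1) := by
  simp only [cochains_d, linD, map_sum, map_zsmul, linEval_map]

end linEval

theorem IsLinHomotopy.cohomology_map_eq {X Y : SimplicialObject I} {f g : X ⟶ Y}
    {H : ∀ k : ℕ, lin.obj (X.obj (op ⦋k⦌)) ⟶ lin.obj (Y.obj (op ⦋k + 1⦌))} {N n : ℕ}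
    (h : IsLinHomotopy f g H N) (hn : n < N) (P : Iᵒᵖ ⥤ E) :
    ((cohomology n).obj P).map f.op = ((cohomology n).obj P).map g.op := by
  rw [← cancel_epi (((cohomologyIso n).hom.app P).app _), ← NatTrans.naturality,
    ← NatTrans.naturality]
  congr 1
  have e := congr_arg (linEval P) (h n hn)
  rw [map_sub, map_add, linEval_comp, linEval_linD, linEval_map, linEval_map] at e
  refine homologyMap_eq_of_sub_eq _ _ e ?_
  cases n with
  | zero => exact .inl (map_zero (linEval P))
  | succ n =>
    exact .inr ⟨n, linEval P (H n), (linEval_comp P _ _).trans congr(_ ≫ $(linEval_linD P X n))⟩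

end Cochains

theorem isReedy_const {C : Type u} [Category.{v} C] (P : MorphismProperty C) [P.ContainsIdentities]
    {T : C} (hT : IsTerminal T) : IsReedy P ((Functor.const _).obj T : SimplicialObject C) := by
  intro n
  obtain ⟨h⟩ := exists_isLimit (X := ((Functor.const _).obj T : SimplicialObject C))
    (S := boundary n) T (fun _ _ => 𝟙 T) (fun _ _ _ => hT.hom_ext _ _)
    (fun s => ⟨hT.from _, fun _ _ => hT.hom_ext _ _⟩) (fun a b _ => hT.hom_ext _ _)
  refine ⟨_, h, ?_⟩
  rw [show matchingMap h = 𝟙 T from hT.hom_ext _ _]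
  exact P.id_mem T

theorem exact_of_forall_evaluation {J : Type*} [Category* J] {C : Type*} [Category* C] [Abelian C]
    (S : ShortComplex (J ⥤ C)) (h : ∀ j, (S.map ((evaluation J C).obj j)).Exact) : S.Exact := by
  rw [ShortComplex.exact_iff_isZero_homology]
  refine Functor.isZero _ fun j => ?_
  have hj := h j
  rw [ShortComplex.exact_iff_isZero_homology] at hj
  exact hj.of_iso (S.mapHomologyIso ((evaluation J C).obj j)).symm

noncomputable section Filtered

variable {I : Type w} [SmallCategory I] (F : MorphismProperty I)
  (E : Type u) [Category.{w} E] [Abelian E]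

section Exists

variable {F} [F.IsMultiplicative] [F.HasPullbacks] [F.IsStableUnderBaseChange] {i : I}

theorem exists_cohomology_map_eq {X Y : HCov F i} (f g : X ⟶ Y) (N : ℕ) :
    ∃ (Z : HCov F i) (h : Z ⟶ X), ∀ (P : Iᵒᵖ ⥤ E), ∀ n < N,
      ((cohomology n).obj P).map ((total i).map (h ≫ f).hom).op =
        ((cohomology n).obj P).map ((total i).map (h ≫ g).hom).op := by
  obtain ⟨Z, hZ, h, H, hH⟩ :=
    exists_isLinHomotopy X.property Y.property Over.mkIdTerminal f.hom g.hom N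
  exact ⟨⟨Z, hZ⟩, ObjectProperty.homMk h, fun P n hn =>
    hH.cohomology_map_eq hn ((Over.forget i).op ⋙ P)⟩

end Exists

/-- Two maps of hypercoverings are related if they induce the same maps on all cohomology objects
of degree less than `N`. -/
def cohRel (N : ℕ) (i : I) : HomRel (HCov F i) := fun _ _ f g =>
  ∀ (P : Iᵒᵖ ⥤ E), ∀ n < N, ((cohomology n).obj P).map ((total i).map f.hom).op =
    ((cohomology n).obj P).map ((total i).map g.hom).op

/-- The category of hypercoverings of `i`, modulo the equality of maps on cohomology objects of
degree less than `N`. It replaces `HC F i` in exactness arguments, since it is evidently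
cofiltered. -/
abbrev HCTrunc (N : ℕ) (i : I) : Type w := CategoryTheory.Quotient (cohRel F E N i)

/-- The projection from hypercoverings to the category `HCTrunc F E N i`. -/
abbrev toHCTrunc (N : ℕ) (i : I) : HCov F i ⥤ HCTrunc F E N i :=
  CategoryTheory.Quotient.functor (cohRel F E N i)

theorem HCTrunc.exists_map_eq {N : ℕ} {i : I} {X Y : HCTrunc F E N i} (f : X ⟶ Y) :
    ∃ s : X.as ⟶ Y.as, (toHCTrunc F E N i).map s = f :=
  (toHCTrunc F E N i).map_surjective (X := X.as) (Y := Y.as) f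

instance isCofiltered_HCTrunc [F.IsMultiplicative] [F.HasPullbacks] [F.IsStableUnderBaseChange]
    (N : ℕ) (i : I) : IsCofiltered (HCTrunc F E N i) where
  nonempty := ⟨⟨⟨_, isReedy_const (overClass F i) Over.mkIdTerminal⟩⟩⟩
  cone_objs X Y := by
    have (m : SimplexCategoryᵒᵖ) : HasBinaryProduct (X.as.obj.obj m) (Y.as.obj.obj m) :=
      hasBinaryProduct_of_mem Over.mkIdTerminal
        (X.as.property.terminal_from_mem Over.mkIdTerminal m.unop.len) _
    let W : HCov F i :=
      ⟨_, isReedy_levelwiseProd Over.mkIdTerminal X.as.property Y.as.property⟩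
    exact ⟨⟨W⟩,
      (toHCTrunc F E N i).map (ObjectProperty.homMk (levelwiseFst _ _) : W ⟶ X.as),
      (toHCTrunc F E N i).map (ObjectProperty.homMk (levelwiseSnd _ _) : W ⟶ Y.as), trivial⟩
  cone_maps X Y f g := by
    obtain ⟨f, rfl⟩ := HCTrunc.exists_map_eq F E f
    obtain ⟨g, rfl⟩ := HCTrunc.exists_map_eq F E g
    obtain ⟨Z, h, hh⟩ := exists_cohomology_map_eq E f g N
    refine ⟨⟨Z⟩, (toHCTrunc F E N i).map h, ?_⟩
    exact ((toHCTrunc F E N i).map_comp _ _).symm.trans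
      ((CategoryTheory.Quotient.sound _ hh).trans ((toHCTrunc F E N i).map_comp _ _))

variable {F E}

/-- The functor `X ↦ H^n(P(X))` on hypercoverings of `i`. -/
abbrev hcovCohomology (F : MorphismProperty I) (n : ℕ) (P : Iᵒᵖ ⥤ E) (i : I) :
    (HCov F i)ᵒᵖ ⥤ E :=
  ((IsHypercovering F i).ι ⋙ total i).op ⋙ (cohomology n).obj P

/-- The functor `X ↦ H^n(P(X))` on the category `HCTrunc F E N i`, for `n < N`. -/
def cohomologyTrunc {N n : ℕ} (hn : n < N) (P : Iᵒᵖ ⥤ E) (i : I) : (HCTrunc F E N i)ᵒᵖ ⥤ E :=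
  (CategoryTheory.Quotient.lift (cohRel F E N i) (hcovCohomology F n P i).rightOp
    (fun _ _ _ _ h => Quiver.Hom.unop_inj (h P n hn))).leftOp

/-- The natural transformation between cohomology functors on `HCTrunc F E N i` induced by a
natural transformation on hypercoverings. -/
def truncHom {N n m : ℕ} (hn : n < N) (hm : m < N) {P Q : Iᵒᵖ ⥤ E} {i : I}
    (α : hcovCohomology F n P i ⟶ hcovCohomology F m Q i) :
    cohomologyTrunc (F := F) hn P i ⟶ cohomologyTrunc hm Q i where
  app X := α.app (op X.unop.as)
  naturality X Y t := by
    obtain ⟨s, hs⟩ := HCTrunc.exists_map_eq F E t.unop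
    obtain rfl : ((toHCTrunc F E N i).map s).op = t := Quiver.Hom.unop_inj hs
    exact α.naturality s.op

variable [HasColimitsOfSize.{w, w} E]

theorem doldι_desc {n : ℕ} {P : Iᵒᵖ ⥤ E} {i : I} {T : E}
    (x : ∀ X : HCov F i, ((cohomology n).obj P).obj (op ((total i).obj X.obj)) ⟶ T)
    (hx : ∀ {X Y : HCov F i} (t : Y ⟶ X),
      ((cohomology n).obj P).map ((total i).map t.hom).op ≫ x Y = x X) (X : HCov F i) :
    doldι F n P X ≫ doldDesc x hx = x X :=
  colimit.ι_desc _ _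

/-- The cocone given by the maps to `D^n(P)(i)`. -/
def truncCocone {N n : ℕ} (hn : n < N) (P : Iᵒᵖ ⥤ E) (i : I) :
    Cocone (cohomologyTrunc (F := F) hn P i) where
  pt := doldObj F n P i
  ι :=
    { app := fun X => doldι F n P X.unop.as
      naturality := by
        intro X Y t
        obtain ⟨s, hs⟩ := HCTrunc.exists_map_eq F E t.unop
        obtain rfl : ((toHCTrunc F E N i).map s).op = t := Quiver.Hom.unop_inj hs
        exact (doldι_w n P s).trans (Category.comp_id _).symm }

/-- `D^n(P)(i)` is the colimit of cohomology objects over `HCTrunc F E N i`. -/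
def isColimitTruncCocone {N n : ℕ} (hn : n < N) (P : Iᵒᵖ ⥤ E) (i : I) :
    IsColimit (truncCocone (F := F) hn P i) where
  desc s := doldDesc (fun X => s.ι.app (op ((toHCTrunc F E N i).obj X)))
    (fun t => s.w ((toHCTrunc F E N i).map t).op)
  fac _ _ := colimit.ι_desc _ _
  uniq s _ hm := dold_hom_ext fun X => (hm (op ((toHCTrunc F E N i).obj X))).trans
    (doldι_desc (fun X : HCov F i => s.ι.app (op ((toHCTrunc F E N i).obj X)))
      (fun t => s.w ((toHCTrunc F E N i).map t).op) X).symm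

/-- The map of Dold-derived functors at `i` induced by a natural transformation of cohomology
functors on the hypercoverings of `i`. -/
def doldTrans {n m : ℕ} {P Q : Iᵒᵖ ⥤ E} {i : I}
    (α : hcovCohomology F n P i ⟶ hcovCohomology F m Q i) : doldObj F n P i ⟶ doldObj F m Q i :=
  doldDesc (fun X => α.app (op X) ≫ doldι F m Q X) fun t => by
    exact (α.naturality_assoc t.op _).trans congr(_ ≫ $(doldι_w m Q t))

theorem doldι_trans {n m : ℕ} {P Q : Iᵒᵖ ⥤ E} {i : I}
    (α : hcovCohomology F n P i ⟶ hcovCohomology F m Q i) (X : HCov F i) :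
    doldι F n P X ≫ doldTrans α = α.app (op X) ≫ doldι F m Q X :=
  colimit.ι_desc _ _

theorem doldTrans_comp_eq_zero {n₁ n₂ n₃ : ℕ} {P₁ P₂ P₃ : Iᵒᵖ ⥤ E} {i : I}
    {α : hcovCohomology F n₁ P₁ i ⟶ hcovCohomology F n₂ P₂ i}
    {β : hcovCohomology F n₂ P₂ i ⟶ hcovCohomology F n₃ P₃ i} (h : α ≫ β = 0) :
    doldTrans α ≫ doldTrans β = 0 :=
  dold_hom_ext fun X => by
    have hX : α.app (op X) ≫ β.app (op X) = 0 := congr_app h (op X)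
    rw [← Category.assoc, doldι_trans, Category.assoc, doldι_trans, reassoc_of% hX, zero_comp,
      comp_zero]

theorem doldTrans_exact [F.IsMultiplicative] [F.HasPullbacks] [F.IsStableUnderBaseChange]
    [AB5OfSize.{w, w} E]
    {n₁ n₂ n₃ : ℕ} {P₁ P₂ P₃ : Iᵒᵖ ⥤ E} {i : I}
    {α : hcovCohomology F n₁ P₁ i ⟶ hcovCohomology F n₂ P₂ i}
    {β : hcovCohomology F n₂ P₂ i ⟶ hcovCohomology F n₃ P₃ i} (h : α ≫ β = 0)
    (hex : (ShortComplex.mk α β h).Exact) :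
    (ShortComplex.mk (doldTrans α) (doldTrans β) (doldTrans_comp_eq_zero h)).Exact := by
  obtain ⟨N, h₁, h₂, h₃⟩ : ∃ N, n₁ < N ∧ n₂ < N ∧ n₃ < N :=
    ⟨n₁ + n₂ + n₃ + 1, by omega, by omega, by omega⟩
  let S : ShortComplex ((HCTrunc F E N i)ᵒᵖ ⥤ E) :=
    ShortComplex.mk (truncHom h₁ h₂ α) (truncHom h₂ h₃ β) (by
      ext X
      exact congr_app h (op X.unop.as))
  have hS : S.Exact := exact_of_forall_evaluation S fun X =>
    hex.map ((evaluation _ E).obj (op X.unop.as))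
  exact colim.exact_mapShortComplex hS (isColimitTruncCocone h₁ P₁ i)
    (isColimitTruncCocone h₂ P₂ i) (isColimitTruncCocone h₃ P₃ i) _ _
    (fun X => doldι_trans α X.unop.as) (fun X => doldι_trans β X.unop.as)

end Filtered

section DeltaFunctor

variable {C : Type*} [Category* C] [HasZeroMorphisms C] {D : Type*} [Category* D]
  [HasZeroMorphisms D]

/-- A cohomological δ-functor: natural connecting maps that turn each short exact sequence in `C`
into a long exact sequence `0 ⟶ G⁰(X₁) ⟶ G⁰(X₂) ⟶ G⁰(X₃) ⟶ G¹(X₁) ⟶ ⋯`. -/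
structure DeltaFunctor (G : ℕ → C ⥤ D) where
  /-- The connecting map. -/
  δ {S : ShortComplex C} (hS : S.ShortExact) (n : ℕ) : (G n).obj S.X₃ ⟶ (G (n + 1)).obj S.X₁
  δ_naturality {S S' : ShortComplex C} (hS : S.ShortExact) (hS' : S'.ShortExact) (φ : S ⟶ S')
    (n : ℕ) : (G n).map φ.τ₃ ≫ δ hS' n = δ hS n ≫ (G (n + 1)).map φ.τ₁
  δ_comp {S : ShortComplex C} (hS : S.ShortExact) (n : ℕ) : δ hS n ≫ (G (n + 1)).map S.f = 0
  map_comp {S : ShortComplex C} (hS : S.ShortExact) (n : ℕ) :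
    (G n).map S.f ≫ (G n).map S.g = 0
  comp_δ {S : ShortComplex C} (hS : S.ShortExact) (n : ℕ) : (G n).map S.g ≫ δ hS n = 0
  exact₁ {S : ShortComplex C} (hS : S.ShortExact) (n : ℕ) :
    (ShortComplex.mk _ _ (δ_comp hS n)).Exact
  exact₂ {S : ShortComplex C} (hS : S.ShortExact) (n : ℕ) :
    (ShortComplex.mk _ _ (map_comp hS n)).Exact
  exact₃ {S : ShortComplex C} (hS : S.ShortExact) (n : ℕ) :
    (ShortComplex.mk _ _ (comp_δ hS n)).Exact
  mono_zero {S : ShortComplex C} (hS : S.ShortExact) : Mono ((G 0).map S.f)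

namespace DeltaFunctor

variable {G H : ℕ → C ⥤ D}

/-- The transport of a δ-functor along isomorphisms of functors. -/
def ofIso (d : DeltaFunctor G) (e : ∀ n, G n ≅ H n) : DeltaFunctor H where
  δ {S} hS n := (e n).inv.app S.X₃ ≫ d.δ hS n ≫ (e (n + 1)).hom.app S.X₁
  δ_naturality {S S'} hS hS' φ n := by
    have h := d.δ_naturality hS hS' φ n
    simp only [NatTrans.naturality_assoc, reassoc_of% h, Category.assoc, NatTrans.naturality]
  δ_comp hS n := by
    have h := d.δ_comp hS n
    simp only [Category.assoc, ← NatTrans.naturality, reassoc_of% h, zero_comp, comp_zero]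
  map_comp {S} hS n := by
    have h := d.map_comp hS n
    rw [← cancel_epi ((e n).hom.app S.X₁), ← NatTrans.naturality_assoc, ← NatTrans.naturality,
      reassoc_of% h, zero_comp, comp_zero]
  comp_δ hS n := by
    have h := d.comp_δ hS n
    rw [NatTrans.naturality_assoc, reassoc_of% h, zero_comp, comp_zero]
  exact₁ {S} hS n := ShortComplex.exact_of_iso (ShortComplex.isoMk ((e n).app S.X₃)
    ((e (n + 1)).app S.X₁) ((e (n + 1)).app S.X₂)) (d.exact₁ hS n)
  exact₂ {S} hS n := ShortComplex.exact_of_iso (ShortComplex.isoMk ((e n).app S.X₁)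
    ((e n).app S.X₂) ((e n).app S.X₃)) (d.exact₂ hS n)
  exact₃ {S} hS n := ShortComplex.exact_of_iso (ShortComplex.isoMk ((e n).app S.X₂)
    ((e n).app S.X₃) ((e (n + 1)).app S.X₁)) (d.exact₃ hS n)
  mono_zero {S} hS := by
    have := d.mono_zero hS
    rw [← NatIso.naturality_1 (e 0) S.f]
    infer_instance

end DeltaFunctor

end DeltaFunctor

noncomputable section LongExact

section Homology

variable {A : Type*} [Category* A] [Abelian A]

variable {C : Type*} [Category* C] [HasZeroMorphisms C] {J : Type*} [Category* J]
  (K : C ⥤ J ⥤ HomologicalComplex A (ComplexShape.down ℕ).symm) [K.PreservesZeroMorphisms]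

/-- The long exact sequences in cohomology of an exact functor to diagrams of complexes. -/
def DeltaFunctor.homology
    (hK : ∀ {S : ShortComplex C}, S.ShortExact → ∀ X,
      (S.map (K ⋙ (evaluation J _).obj X)).ShortExact) :
    DeltaFunctor fun n => K ⋙
      (Functor.whiskeringRight J _ A).obj (HomologicalComplex.homologyFunctor A _ n) where
  δ hS n :=
    { app X := (hK hS X).δ n (n + 1) rfl
      naturality X Y f := (HomologicalComplex.HomologySequence.δ_naturality
        (ShortComplex.mapNatTrans _ (Functor.whiskerLeft K ((evaluation J _).map f)))
        (hK hS X) (hK hS Y) n (n + 1) rfl).symm }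
  δ_naturality hS hS' φ n := by
    ext X
    exact (HomologicalComplex.HomologySequence.δ_naturality
      ((K ⋙ (evaluation J _).obj X).mapShortComplex.map φ) (hK hS X) (hK hS' X)
      n (n + 1) rfl).symm
  δ_comp hS n := by
    ext X
    exact (hK hS X).δ_comp n (n + 1) rfl
  map_comp {S} _ n := by
    ext X
    exact ((S.map (K ⋙ (evaluation J _).obj X)).map
      (HomologicalComplex.homologyFunctor A _ n)).zero
  comp_δ hS n := by
    ext X
    exact (hK hS X).comp_δ n (n + 1) rfl
  exact₁ hS n := exact_of_forall_evaluation _ fun X =>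
    (hK hS X).homology_exact₁ n (n + 1) rfl
  exact₂ hS n := exact_of_forall_evaluation _ fun X =>
    (hK hS X).homology_exact₂ n
  exact₃ hS n := exact_of_forall_evaluation _ fun X =>
    (hK hS X).homology_exact₃ n (n + 1) rfl
  mono_zero {S} hS := by
    rw [NatTrans.mono_iff_mono_app]
    intro X
    have : Mono (((K.map S.f).app X).f 0) :=
      ((hK hS X).map_of_exact (HomologicalComplex.eval _ _ 0)).mono_f
    exact HomologicalComplex.mono_homologyMap_of_mono_of_not_rel ((K.map S.f).app X) 0
      Nat.succ_ne_zero

end Homology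

variable {I : Type w} [SmallCategory I] {E : Type u} [Category.{w} E] [Abelian E]

instance : (cochains (I := I) (E := E)).PreservesZeroMorphisms where
  map_zero P Q := by
    ext X n
    rfl

variable (I E) in
/-- The long exact sequences of cochain cohomology. -/
def cohomologyDelta : DeltaFunctor (cohomology (I := I) (E := E)) :=
  (DeltaFunctor.homology cochains fun hS X =>
    HomologicalComplex.shortExact_of_degreewise_shortExact _ fun k =>
      hS.map_of_exact ((evaluation Iᵒᵖ E).obj (op (X.unop.obj (op ⦋k⦌))))).ofIso cohomologyIso

end LongExact

noncomputable section DoldLongExact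

variable {I : Type w} [SmallCategory I] (F : MorphismProperty I)
  [F.IsMultiplicative] [F.HasPullbacks] [F.IsStableUnderBaseChange]
  {E : Type u} [Category.{w} E] [Abelian E]

section doldHom

variable [HasColimitsOfSize.{w, w} E] {n₁ n₂ n₃ : ℕ} {P₁ P₂ P₃ : Iᵒᵖ ⥤ E}
  (α : (cohomology n₁).obj P₁ ⟶ (cohomology n₂).obj P₂)
  (β : (cohomology n₂).obj P₂ ⟶ (cohomology n₃).obj P₃)

/-- The map of Dold-derived functors induced by a natural transformation of cohomology functors on
simplicial objects. -/
def doldHom : (doldDerived F E n₁).obj P₁ ⟶ (doldDerived F E n₂).obj P₂ where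
  app i := doldTrans (Functor.whiskerLeft ((IsHypercovering F i.unop).ι ⋙ total i.unop).op α)
  naturality i i' f := dold_hom_ext fun X => by
    change doldι F n₁ P₁ X ≫ doldMap n₁ P₁ f.unop ≫ doldTrans _ =
      doldι F n₁ P₁ X ≫ doldTrans _ ≫ doldMap n₂ P₂ f.unop
    rw [← Category.assoc, ← Category.assoc, doldι_map n₁ P₁ f.unop (baseChangeMap f.unop X),
      doldι_trans, Category.assoc, doldι_trans, Category.assoc,
      doldι_map n₂ P₂ f.unop (baseChangeMap f.unop X)]
    exact α.naturality_assoc _ _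

theorem doldHom_map (n : ℕ) (η : P₁ ⟶ P₂) :
    doldHom F ((cohomology n).map η) = (doldDerived F E n).map η := rfl

theorem doldHom_comp : doldHom F (α ≫ β) = doldHom F α ≫ doldHom F β := by
  ext i
  refine dold_hom_ext fun X => (doldι_trans _ X).trans ?_
  change _ = doldι F n₁ P₁ X ≫ doldTrans _ ≫ doldTrans _
  rw [← Category.assoc, doldι_trans, Category.assoc, doldι_trans]
  exact Category.assoc _ _ _

theorem doldHom_zero :
    doldHom F (0 : (cohomology n₁).obj P₁ ⟶ (cohomology n₂).obj P₂) = 0 := by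
  ext i
  exact dold_hom_ext fun X => (doldι_trans _ X).trans (zero_comp.trans comp_zero.symm)

variable {α β} in
theorem doldHom_exact [AB5OfSize.{w, w} E] {w : α ≫ β = 0} (h : (ShortComplex.mk α β w).Exact)
    (w' : doldHom F α ≫ doldHom F β = 0) : (ShortComplex.mk _ _ w').Exact :=
  exact_of_forall_evaluation _ fun i => doldTrans_exact _
    (h.map ((Functor.whiskeringLeft _ _ E).obj
      ((IsHypercovering F i.unop).ι ⋙ total i.unop).op))

theorem mono_doldHom [AB5OfSize.{w, w} E] [Mono α] : Mono (doldHom F α) := by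
  have hα : (ShortComplex.mk (0 : (cohomology n₁).obj P₁ ⟶ _) α zero_comp).Exact :=
    (ShortComplex.exact_iff_mono _ rfl).2 inferInstance
  exact (doldHom_exact F hα (by rw [doldHom_zero, zero_comp])).mono_g (doldHom_zero F)

end doldHom

variable (E) in
/-- The long exact sequences of Dold-derived functors. -/
def doldDelta [IsLocallyFinitelyPresentable.{w} E] : DeltaFunctor (doldDerived F E) :=
  let d := cohomologyDelta I E
  { δ hS n := doldHom F (d.δ hS n)
    δ_naturality hS hS' φ n := by
      rw [← doldHom_map, ← doldHom_map, ← doldHom_comp, ← doldHom_comp, d.δ_naturality hS hS']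
    δ_comp hS n := by
      rw [← doldHom_map, ← doldHom_comp, d.δ_comp, doldHom_zero]
    map_comp hS n := by
      rw [← doldHom_map, ← doldHom_map, ← doldHom_comp, d.map_comp hS, doldHom_zero]
    comp_δ hS n := by
      rw [← doldHom_map, ← doldHom_comp, d.comp_δ, doldHom_zero]
    exact₁ hS n := doldHom_exact F (d.exact₁ hS n) _
    exact₂ hS n := doldHom_exact F (d.exact₂ hS n) _
    exact₃ hS n := doldHom_exact F (d.exact₃ hS n) _
    mono_zero {S} hS :=
      have := d.mono_zero hS
      mono_doldHom F ((cohomology 0).map S.f) }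

end DoldLongExact

section DeltaFunctor

namespace DeltaFunctor

variable {D : Type*} [Category* D] [Abelian D]

theorem isIso_map_f {C : Type*} [Category* C] [HasZeroMorphisms C] {G : ℕ → C ⥤ D}
    (d : DeltaFunctor G) {S : ShortComplex C} (hS : S.ShortExact)
    (h : ∀ n, IsZero ((G n).obj S.X₃)) (n : ℕ) : IsIso ((G n).map S.f) := by
  have : Epi ((G n).map S.f) := (d.exact₂ hS n).epi_f ((h n).eq_of_tgt _ _)
  have : Mono ((G n).map S.f) := by
    cases n with
    | zero => exact d.mono_zero hS
    | succ n => exact (d.exact₁ hS n).mono_g ((h n).eq_of_src _ _)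
  exact isIso_of_mono_of_epi _

theorem isIso_map_g {C : Type*} [Category* C] [HasZeroMorphisms C] {G : ℕ → C ⥤ D}
    (d : DeltaFunctor G) {S : ShortComplex C} (hS : S.ShortExact)
    (h : ∀ n, IsZero ((G n).obj S.X₁)) (n : ℕ) : IsIso ((G n).map S.g) := by
  have : Epi ((G n).map S.g) := (d.exact₃ hS n).epi_f ((h _).eq_of_tgt _ _)
  have : Mono ((G n).map S.g) := (d.exact₂ hS n).mono_g ((h n).eq_of_src _ _)
  exact isIso_of_mono_of_epi _

theorem isIso_map_of_exact {B : Type*} [Category* B] [Abelian B] {G : ℕ → B ⥤ D}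
    (d : DeltaFunctor G) {A : Type*} [Category* A] [Abelian A] (a : B ⥤ A)
    [a.PreservesZeroMorphisms] [PreservesFiniteLimits a] [PreservesFiniteColimits a]
    (h : ∀ P, IsZero (a.obj P) → ∀ n, IsZero ((G n).obj P)) {P Q : B} (f : P ⟶ Q)
    [IsIso (a.map f)] (n : ℕ) : IsIso ((G n).map f) := by
  have hf : Abelian.factorThruImage f ≫ Abelian.image.ι f = f := Abelian.image.fac f
  have haf : a.map (Abelian.factorThruImage f) ≫ a.map (Abelian.image.ι f) = a.map f := by
    rw [← a.map_comp, hf]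
  have : Epi (a.map (Abelian.image.ι f)) := epi_of_epi_fac haf
  have hι : IsIso (a.map (Abelian.image.ι f)) := isIso_of_mono_of_epi _
  have hπ : IsIso (a.map (Abelian.factorThruImage f)) := by
    rw [← IsIso.eq_comp_inv] at haf
    rw [haf]
    infer_instance
  have hS : (ShortComplex.mk (Abelian.image.ι f) _ (cokernel.condition _)).ShortExact :=
    { exact := ShortComplex.exact_cokernel _ }
  have hS' : (ShortComplex.mk _ (Abelian.factorThruImage f) (kernel.condition _)).ShortExact :=
    { exact := ShortComplex.exact_kernel _ }
  have hι' := d.isIso_map_f hS (h _ ((hS.map_of_exact a).isIso_f_iff.1 hι)) n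
  have hπ' := d.isIso_map_g hS' (h _ ((hS'.map_of_exact a).isIso_g_iff.1 hπ)) n
  rw [← hf, Functor.map_comp]
  exact IsIso.comp_isIso' hπ' hι'

end DeltaFunctor

end DeltaFunctor

noncomputable section Cocycles

variable {I : Type w} [SmallCategory I] {E : Type u} [Category.{w} E] [Abelian E]
  (P : Iᵒᵖ ⥤ E) (X : SimplicialObject I) (n : ℕ)

/-- The differential on the unnormalized cochains of the cosimplicial object `P(X)`. -/
def coboundary : P.obj (op (X.obj (op ⦋n⦌))) ⟶ P.obj (op (X.obj (op ⦋n + 1⦌))) :=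
  ∑ j : Fin (n + 2), (-1 : ℤ) ^ (j : ℕ) • P.map (X.δ j).op

theorem coboundary_zero : coboundary P X 0 = P.map (X.δ 0).op - P.map (X.δ 1).op := by
  simp [coboundary, Fin.sum_univ_two, sub_eq_add_neg]

/-- The object of unnormalized `n`-cocycles of the cosimplicial object `P(X)`. -/
abbrev cocycles : E := ((cochains.obj P).obj (op X)).cycles n

/-- The inclusion of cocycles into cochains. -/
def cocyclesι : cocycles P X n ⟶ P.obj (op (X.obj (op ⦋n⦌))) :=
  ((cochains.obj P).obj (op X)).iCycles n

instance : Mono (cocyclesι P X n) :=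
  inferInstanceAs (Mono (((cochains.obj P).obj (op X)).iCycles n))

theorem cocyclesι_coboundary : cocyclesι P X n ≫ coboundary P X n = 0 :=
  congr(_ ≫ $(cochains_d P X n)).symm.trans (HomologicalComplex.iCycles_d _ n (n + 1))

/-- The cohomology class of a cocycle. -/
def cocycleClass : cocycles P X n ⟶ ((cohomology n).obj P).obj (op X) :=
  HomologicalComplex.homologyπ _ n ≫ (((cohomologyIso n).app P).app (op X)).hom

instance : Epi (cocycleClass P X n) :=
  epi_comp' (inferInstanceAs (Epi (((cochains.obj P).obj (op X)).homologyπ n)))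
    (inferInstanceAs (Epi (((cohomologyIso n).app P).app (op X)).hom))

instance : IsIso (cocycleClass P X 0) :=
  IsIso.comp_isIso' (CochainComplex.isIso_homologyπ₀ ((cochains.obj P).obj (op X)))
    (inferInstanceAs (IsIso (((cohomologyIso 0).app P).app (op X)).hom))

theorem comp_cocycleClass_eq_zero {P : Iᵒᵖ ⥤ E} {X : SimplicialObject I} {n : ℕ} {A : E}
    {y : A ⟶ cocycles P X (n + 1)} {z : A ⟶ P.obj (op (X.obj (op ⦋n⦌)))}
    (h : z ≫ coboundary P X n = y ≫ cocyclesι P X (n + 1)) : y ≫ cocycleClass P X (n + 1) = 0 := by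
  let K := (cochains.obj P).obj (op X)
  let z' : A ⟶ K.X n := z
  have hy : y ≫ K.homologyπ (n + 1) = 0 := by
    have hz : y ≫ K.iCycles (n + 1) = z' ≫ K.d n (n + 1) :=
      h.symm.trans congr(z ≫ $((cochains_d P X n).symm))
    rw [← cancel_mono (K.homologyι (n + 1)), Category.assoc, K.homology_π_ι, reassoc_of% hz,
      K.d_pOpcycles, comp_zero, zero_comp]
  exact (Category.assoc _ _ _).symm.trans (congr($hy ≫ _).trans zero_comp)

section

variable {P X n} {A : E} (y : A ⟶ P.obj (op (X.obj (op ⦋n⦌)))) (hy : y ≫ coboundary P X n = 0)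

/-- The factorization through the cocycles of a map whose coboundary vanishes. -/
def cocyclesLift : A ⟶ cocycles P X n :=
  HomologicalComplex.liftCycles _ y (n + 1) (ComplexShape.next_eq' _ rfl)
    (congr(y ≫ $(cochains_d P X n)).trans hy)

theorem cocyclesLift_ι : cocyclesLift y hy ≫ cocyclesι P X n = y :=
  HomologicalComplex.liftCycles_i _ _ _ _ _

end

variable {X} in
theorem cyclesMap_cocyclesι {Y : SimplicialObject I} (f : Y ⟶ X) :
    HomologicalComplex.cyclesMap ((cochains.obj P).map f.op) n ≫ cocyclesι P Y n =
      cocyclesι P X n ≫ P.map (f.app (op ⦋n⦌)).op :=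
  HomologicalComplex.cyclesMap_i _ _

variable {X} in
theorem cyclesMap_cocycleClass {Y : SimplicialObject I} (f : Y ⟶ X) :
    HomologicalComplex.cyclesMap ((cochains.obj P).map f.op) n ≫ cocycleClass P Y n =
      cocycleClass P X n ≫ ((cohomology n).obj P).map f.op := by
  have h := ((cohomologyIso n).hom.app P).naturality f.op
  exact (HomologicalComplex.homologyπ_naturality_assoc ((cochains.obj P).map f.op) n _).symm.trans
    ((congr(HomologicalComplex.homologyπ _ n ≫ $h)).trans (Category.assoc _ _ _).symm)

variable {P} {Q : Iᵒᵖ ⥤ E} (η : P ⟶ Q)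

theorem cyclesMap_app_cocyclesι :
    HomologicalComplex.cyclesMap ((cochains.map η).app (op X)) n ≫ cocyclesι Q X n =
      cocyclesι P X n ≫ η.app _ :=
  HomologicalComplex.cyclesMap_i _ _

theorem cyclesMap_app_cocycleClass :
    HomologicalComplex.cyclesMap ((cochains.map η).app (op X)) n ≫ cocycleClass Q X n =
      cocycleClass P X n ≫ ((cohomology n).map η).app (op X) := by
  have h := congr_app ((cohomologyIso n).hom.naturality η) (op X)
  exact (HomologicalComplex.homologyπ_naturality_assoc ((cochains.map η).app (op X)) n _).symm.trans
    ((congr(HomologicalComplex.homologyπ _ n ≫ $h)).trans (Category.assoc _ _ _).symm)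

end Cocycles

section LocallyZero

variable {I : Type w} [SmallCategory I] {F : MorphismProperty I}
  [F.IsMultiplicative] [F.HasPullbacks] [F.IsStableUnderBaseChange]
  {E : Type u} [Category.{w} E] [Abelian E] [IsLocallyFinitelyPresentable.{w} E]
  {P : Iᵒᵖ ⥤ E}

theorem toSheafify_eq_zero (hP : IsZero ((presheafToSheaf (topology F) E).obj P)) :
    (topology F).toSheafify P = 0 := by
  have : IsZero (sheafify (topology F) P) := (sheafToPresheaf (topology F) E).map_isZero hP
  rw [← toSheafify_sheafifyLift (topology F) ((topology F).toSheafify P)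
    (sheafify_isSheaf_of_lfp E _ P), this.eq_of_src (sheafifyLift _ _ _) 0, comp_zero]

theorem exists_cover_comp_eq_zero (hP : IsZero ((presheafToSheaf (topology F) E).obj P)) {G : E}
    [IsFinitelyPresentable.{w} G] {T : I} (x : G ⟶ P.obj (op T)) :
    ∃ (T' : I) (c : T' ⟶ T), F c ∧ x ≫ P.map c.op = 0 := by
  have (X : I) : PreservesColimitsOfShape ((topology F).Cover X)ᵒᵖ (coyoneda.obj (op G)) :=
    PreservesFilteredColimitsOfSize.preserves_filtered_colimits _
  let Q := P ⋙ coyoneda.obj (op G)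
  have toSheafify_apply (y z : G ⟶ P.obj (op T)) :
      ((topology F).toSheafify Q).app (op T) y = ((topology F).toSheafify Q).app (op T) z := by
    rw [← (topology F).whiskerRight_toSheafify_sheafifyCompIso_hom]
    change ((topology F).sheafifyCompIso (coyoneda.obj (op G)) P).hom.app (op T)
      (y ≫ ((topology F).toSheafify P).app (op T)) = ((topology F).sheafifyCompIso
        (coyoneda.obj (op G)) P).hom.app (op T) (z ≫ ((topology F).toSheafify P).app (op T))
    rw [toSheafify_eq_zero hP]
    exact congr_arg _ (comp_zero.trans comp_zero.symm)
  obtain ⟨T', c, hc, h⟩ := Presheaf.equalizerSieve_mem (topology F)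
    ((topology F).toSheafify Q) x (0 : G ⟶ _) (toSheafify_apply x 0)
  have hx : x ≫ P.map c.op = (0 : G ⟶ _) ≫ P.map c.op := h
  exact ⟨T', c, hc, hx.trans zero_comp⟩

theorem exists_hypercovering_refinement {i : I} (X : HCov F i) {n : ℕ} {T : I}
    {c : T ⟶ ((total i).obj X.obj).obj (op ⦋n⦌)} (hc : F c) :
    ∃ (X' : HCov F i) (φ : X' ⟶ X) (a : ((total i).obj X'.obj).obj (op ⦋n⦌) ⟶ T),
      a ≫ c = ((total i).map φ.hom).app (op ⦋n⦌) := by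
  obtain ⟨X', hX', φ, a, h⟩ := exists_refinement X.property
    (A := Over.mk (c ≫ (X.obj.obj (op ⦋n⦌)).hom)) (c := Over.homMk c) hc
  exact ⟨⟨X', hX'⟩, ObjectProperty.homMk φ, a.left, congr_arg CommaMorphism.left h⟩

/- A class in `H^n(P(X))` is tested on maps `x` from compact objects to the cocycles; such an `x`
vanishes on some cover of `X_n`, and `X` has a refinement that factors through this cover. -/
theorem doldι_eq_zero (hP : IsZero ((presheafToSheaf (topology F) E).obj P)) (n : ℕ) {i : I}
    (X : HCov F i) : doldι F n P X = 0 := by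
  obtain ⟨Q, _, hQ, hs, _⟩ := exists_compactGenerator E
  rw [← cancel_epi (cocycleClass P _ n), comp_zero]
  refine hs _ _ fun G hG x => ?_
  have := hQ G hG
  obtain ⟨T', c, hc, h⟩ := exists_cover_comp_eq_zero hP (T := ((total i).obj X.obj).obj (op ⦋n⦌))
    (x ≫ cocyclesι P _ n)
  rw [Category.assoc] at h
  obtain ⟨X', φ, a, ha⟩ := exists_hypercovering_refinement X hc
  have hx : x ≫ HomologicalComplex.cyclesMap ((cochains.obj P).map ((total i).map φ.hom).op) n
      = 0 := by
    rw [← cancel_mono (cocyclesι _ _ _), Category.assoc, cyclesMap_cocyclesι, ← ha, op_comp,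
      P.map_comp, reassoc_of% h, zero_comp, zero_comp]
  rw [← doldι_w n P φ, ← Category.assoc (cocycleClass _ _ _), ← cyclesMap_cocycleClass,
    Category.assoc, reassoc_of% hx, zero_comp, comp_zero]

theorem isZero_doldDerived (hP : IsZero ((presheafToSheaf (topology F) E).obj P)) (n : ℕ) :
    IsZero ((doldDerived F E n).obj P) :=
  Functor.isZero _ fun _ => (IsZero.iff_id_eq_zero _).2 <| dold_hom_ext fun X => by
    rw [doldι_eq_zero hP]
    exact zero_comp.trans zero_comp.symm

end LocallyZero

noncomputable section DegreeZero

section Gluing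

variable {I : Type w} [SmallCategory I] {F : MorphismProperty I}
  [F.IsMultiplicative] [F.HasPullbacks] [F.IsStableUnderBaseChange]
  {E : Type u} [Category.{w} E] {P : Iᵒᵖ ⥤ E} {T T' : I} {c : T' ⟶ T} {A : E}

theorem existsUnique_gluing (hP : Presheaf.IsSheaf (topology F) P) (hc : F c)
    (y : A ⟶ P.obj (op T'))
    (hy : ∀ {Z : I} (p₁ p₂ : Z ⟶ T'), p₁ ≫ c = p₂ ≫ c → y ≫ P.map p₁.op = y ≫ P.map p₂.op) :
    ∃! x : A ⟶ P.obj (op T), x ≫ P.map c.op = y :=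
  Presieve.isSheafFor_singleton.1 ((Presieve.isSheafFor_iff_generate _).2
    (hP A _ ⟨T', c, hc, Sieve.le_generate _ _ _ (Presieve.singleton_self c)⟩)) y hy

theorem eq_of_comp_cover_eq (hP : Presheaf.IsSheaf (topology F) P) (hc : F c)
    {x y : A ⟶ P.obj (op T)} (h : x ≫ P.map c.op = y ≫ P.map c.op) : x = y := by
  refine (existsUnique_gluing hP hc (y ≫ P.map c.op) fun p₁ p₂ e => ?_).unique h rfl
  rw [Category.assoc, Category.assoc, ← P.map_comp, ← P.map_comp, ← op_comp, ← op_comp, e]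

end Gluing

variable {I : Type w} [SmallCategory I]

section Augmentation

variable {i : I}

/-- The augmentation `X_k ⟶ i` of a simplicial object of `I/i`. -/
def augmentation (X : SimplicialObject (Over i)) (k : ℕ) :
    ((total i).obj X).obj (op ⦋k⦌) ⟶ i :=
  (X.obj (op ⦋k⦌)).hom

theorem δ_augmentation (X : SimplicialObject (Over i)) (k : ℕ) (j : Fin (k + 2)) :
    ((total i).obj X).δ j ≫ augmentation X k = augmentation X (k + 1) :=
  Over.w (X.δ j)

variable {E : Type u} [Category.{w} E] [Abelian E] (P : Iᵒᵖ ⥤ E)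

/-- The map from `P(i)` to the zero-cocycles of `P(X)` given by the augmentation of `X`. -/
def augmentationCocycle (X : SimplicialObject (Over i)) :
    P.obj (op i) ⟶ cocycles P ((total i).obj X) 0 :=
  cocyclesLift (P.map (augmentation X 0).op) (by
    rw [coboundary_zero, Preadditive.comp_sub, ← P.map_comp, ← P.map_comp, ← op_comp, ← op_comp,
      δ_augmentation, δ_augmentation, sub_self])

theorem augmentationCocycle_ι (X : SimplicialObject (Over i)) :
    augmentationCocycle P X ≫ cocyclesι P _ 0 = P.map (augmentation X 0).op :=
  cocyclesLift_ι _ _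

/-- The map from `P(i)` to the zeroth cohomology of `P(X)` given by the augmentation of `X`. -/
def augmentationMap (X : SimplicialObject (Over i)) :
    P.obj (op i) ⟶ ((cohomology 0).obj P).obj (op ((total i).obj X)) :=
  augmentationCocycle P X ≫ cocycleClass P _ 0

theorem augmentationMap_comp {i' : I} {f : i' ⟶ i} {X : SimplicialObject (Over i)}
    {Z : SimplicialObject (Over i')} (ψ : (total i').obj Z ⟶ (total i).obj X)
    (hψ : ψ.app (op ⦋0⦌) ≫ augmentation X 0 = augmentation Z 0 ≫ f) :
    augmentationMap P X ≫ ((cohomology 0).obj P).map ψ.op = P.map f.op ≫ augmentationMap P Z := by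
  have h : augmentationCocycle P X ≫
      HomologicalComplex.cyclesMap ((cochains.obj P).map ψ.op) 0 =
        P.map f.op ≫ augmentationCocycle P Z := by
    rw [← cancel_mono (cocyclesι _ _ _), Category.assoc, Category.assoc, cyclesMap_cocyclesι,
      augmentationCocycle_ι, ← P.map_comp, ← op_comp, ← hψ, op_comp, P.map_comp,
      ← Category.assoc, augmentationCocycle_ι]
  rw [augmentationMap, augmentationMap, Category.assoc, ← cyclesMap_cocycleClass, reassoc_of% h]

theorem augmentationMap_map {X Y : SimplicialObject (Over i)} (t : Y ⟶ X) :
    augmentationMap P X ≫ ((cohomology 0).obj P).map ((total i).map t).op =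
      augmentationMap P Y := by
  rw [augmentationMap_comp P (f := 𝟙 i) ((total i).map t)
    ((Over.w (t.app (op ⦋0⦌))).trans (Category.comp_id _).symm), op_id, P.map_id,
    Category.id_comp]

theorem augmentationMap_naturality {P Q : Iᵒᵖ ⥤ E} (η : P ⟶ Q) (X : SimplicialObject (Over i)) :
    augmentationMap P X ≫ ((cohomology 0).map η).app _ = η.app (op i) ≫ augmentationMap Q X := by
  have h : augmentationCocycle P X ≫
      HomologicalComplex.cyclesMap ((cochains.map η).app (op ((total i).obj X))) 0 =
        η.app (op i) ≫ augmentationCocycle Q X := by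
    rw [← cancel_mono (cocyclesι _ _ _), Category.assoc, Category.assoc, cyclesMap_app_cocyclesι,
      augmentationCocycle_ι, ← η.naturality, ← Category.assoc, augmentationCocycle_ι]
  rw [augmentationMap, augmentationMap, Category.assoc, ← cyclesMap_app_cocycleClass,
    reassoc_of% h]

variable {F : MorphismProperty I} [F.HasPullbacks] [F.IsStableUnderBaseChange]

theorem augmentation_mem [F.IsMultiplicative] (X : HCov F i) : F (augmentation X.obj 0) := by
  obtain ⟨_, _, _, _, h⟩ := isReedy_hom_mem F X.property 0
  exact h

theorem exists_edge (X : HCov F i) {Z : I} (p : Fin 2 → (Z ⟶ ((total i).obj X.obj).obj (op ⦋0⦌)))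
    (hp : p 0 ≫ augmentation X.obj 0 = p 1 ≫ augmentation X.obj 0) :
    ∃ (T : I) (c : T ⟶ Z) (x : T ⟶ ((total i).obj X.obj).obj (op ⦋1⦌)), F c ∧
      ∀ j, x ≫ ((total i).obj X.obj).δ j = c ≫ p j := by
  let y (j : Fin 2) : Over.mk (p 0 ≫ augmentation X.obj 0) ⟶ X.obj.obj (op ⦋0⦌) :=
    Over.homMk (p j) (by
      fin_cases j
      · rfl
      · exact hp.symm)
  obtain ⟨T, c, x, hc, hx⟩ := X.property.exists_filling (isBoundaryFamily_zero X.obj y)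
  exact ⟨T.left, c.left, x.left, hc, fun j => congr_arg CommaMorphism.left (hx j)⟩

variable {P} [F.IsMultiplicative]

/- A zero-cocycle on `X` glues along `X_0 ⟶ i`, because any two maps to `X_0` that agree over `i`
are locally the faces of a map to `X_1`. -/
theorem exists_comp_augmentation_eq (hP : Presheaf.IsSheaf (topology F) P) (X : HCov F i) :
    ∃ r, r ≫ P.map (augmentation X.obj 0).op = cocyclesι P ((total i).obj X.obj) 0 := by
  have hd := cocyclesι_coboundary P ((total i).obj X.obj) 0
  rw [coboundary_zero, Preadditive.comp_sub, sub_eq_zero] at hd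
  refine (existsUnique_gluing hP (augmentation_mem X) _ fun p₁ p₂ hp => ?_).exists
  obtain ⟨T', c, x, hc, hx⟩ := exists_edge X ![p₁, p₂] hp
  have h₀ : c ≫ p₁ = x ≫ ((total i).obj X.obj).δ 0 := (hx 0).symm
  have h₁ : c ≫ p₂ = x ≫ ((total i).obj X.obj).δ 1 := (hx 1).symm
  refine eq_of_comp_cover_eq hP hc ?_
  rw [Category.assoc, Category.assoc, ← P.map_comp, ← P.map_comp, ← op_comp, ← op_comp, h₀, h₁,
    op_comp, op_comp, P.map_comp, P.map_comp, reassoc_of% hd]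

theorem isIso_augmentationMap (hP : Presheaf.IsSheaf (topology F) P) (X : HCov F i) :
    IsIso (augmentationMap P X.obj) := by
  obtain ⟨r, hr⟩ := exists_comp_augmentation_eq hP X
  have : IsIso (augmentationCocycle P X.obj) := by
    refine ⟨r, eq_of_comp_cover_eq hP (augmentation_mem X) ?_, ?_⟩
    · rw [Category.assoc, hr, Category.id_comp, augmentationCocycle_ι]
    · rw [← cancel_mono (cocyclesι _ _ _), Category.assoc, Category.id_comp,
        augmentationCocycle_ι, hr]
  exact inferInstanceAs (IsIso (augmentationCocycle P X.obj ≫ cocycleClass P _ 0))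

end Augmentation

variable (F : MorphismProperty I) [F.IsMultiplicative] {E : Type u} [Category.{w} E] [Abelian E]
  [HasColimitsOfSize.{w, w} E]

/-- The constant hypercovering, which is terminal among the hypercoverings of `i`. -/
def constHCov (i : I) : HCov F i := ⟨_, isReedy_const (overClass F i) Over.mkIdTerminal⟩

/-- The canonical map from `P(i)` to `D^0(P)(i)`. -/
def toDoldObj (P : Iᵒᵖ ⥤ E) (i : I) : P.obj (op i) ⟶ doldObj F 0 P i :=
  augmentationMap P (constHCov F i).obj ≫ doldι F 0 P (constHCov F i)

variable {F}

theorem augmentationMap_doldι (P : Iᵒᵖ ⥤ E) {i : I} (X : HCov F i) :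
    augmentationMap P X.obj ≫ doldι F 0 P X = toDoldObj F P i := by
  let t : X ⟶ constHCov F i := ObjectProperty.homMk
    { app := fun m => Over.mkIdTerminal.from (X.obj.obj m)
      naturality := fun _ _ _ => Over.mkIdTerminal.hom_ext _ _ }
  rw [toDoldObj, ← doldι_w 0 P t, ← Category.assoc, augmentationMap_map]

theorem toDoldObj_mapPresheaf {P Q : Iᵒᵖ ⥤ E} (η : P ⟶ Q) (i : I) :
    η.app (op i) ≫ toDoldObj F Q i = toDoldObj F P i ≫ doldMapPresheaf 0 η i := by
  rw [toDoldObj, toDoldObj, Category.assoc, doldι_mapPresheaf, ← Category.assoc,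
    ← Category.assoc, augmentationMap_naturality]

variable [F.HasPullbacks] [F.IsStableUnderBaseChange]

theorem toDoldObj_map (P : Iᵒᵖ ⥤ E) {i' i : I} (f : i' ⟶ i) :
    P.map f.op ≫ toDoldObj F P i' = toDoldObj F P i ≫ doldMap 0 P f := by
  let X := constHCov F i
  rw [← augmentationMap_doldι P X, Category.assoc, doldι_map 0 P f (baseChangeMap f X),
    ← Category.assoc, augmentationMap_comp P (f := f) (totalMap (baseChangeMap f X))
      (Over.w ((baseChangeMap f X).app (op ⦋0⦌))), Category.assoc, augmentationMap_doldι]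

theorem isIso_toDoldObj {P : Iᵒᵖ ⥤ E} (hP : Presheaf.IsSheaf (topology F) P) (i : I) :
    IsIso (toDoldObj F P i) := by
  have (X : HCov F i) : IsIso (augmentationMap P X.obj) := isIso_augmentationMap hP X
  let r : doldObj F 0 P i ⟶ P.obj (op i) := doldDesc (fun X => inv (augmentationMap P X.obj))
    fun t => by rw [IsIso.comp_inv_eq, ← augmentationMap_map P t.hom, IsIso.inv_hom_id_assoc]
  have hr (X : HCov F i) : doldι F 0 P X ≫ r = inv (augmentationMap P X.obj) := doldι_desc _ _ X
  refine ⟨r, ?_, dold_hom_ext fun X => ?_⟩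
  · rw [toDoldObj, Category.assoc, hr, IsIso.hom_inv_id]
  · rw [← Category.assoc, hr, ← augmentationMap_doldι P X, IsIso.inv_hom_id_assoc,
      Category.comp_id]

variable (F E) in
/-- The canonical map from `P` to `D^0(P)`. -/
def toDold : 𝟭 (Iᵒᵖ ⥤ E) ⟶ doldDerived F E 0 where
  app P :=
    { app i := toDoldObj F P i.unop
      naturality _ _ f := toDoldObj_map P f.unop }
  naturality P Q η := by
    ext i
    exact toDoldObj_mapPresheaf η i.unop

theorem isIso_toDold_app {P : Iᵒᵖ ⥤ E} (hP : Presheaf.IsSheaf (topology F) P) :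
    IsIso ((toDold F E).app P) := by
  have (i : Iᵒᵖ) : IsIso (((toDold F E).app P).app i) := isIso_toDoldObj hP i.unop
  exact NatIso.isIso_of_isIso_app _

/-- The restriction of `D^0` to sheaves is the inclusion of sheaves into presheaves. -/
def doldZeroIso :
    sheafToPresheaf (topology F) E ≅ sheafToPresheaf (topology F) E ⋙ doldDerived F E 0 :=
  NatIso.ofComponents (fun P => @asIso _ _ _ _ _ (isIso_toDold_app P.property))
    (fun η => (toDold F E).naturality ((sheafToPresheaf (topology F) E).map η))

end DegreeZero

section Coproducts

variable {E : Type u} [Category.{w} E] [Preadditive E] [HasColimitsOfSize.{w, w} E] {A H : E}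

theorem exists_eq_sum_of_fintype {T : Type w} [Fintype T] (x : H ⟶ ∐ fun _ : T => A) :
    ∃ a : T → (H ⟶ A), x = ∑ t, a t ≫ Sigma.ι (fun _ : T => A) t := by
  classical
  let π (t : T) : (∐ fun _ : T => A) ⟶ A := Sigma.desc fun s => if s = t then 𝟙 A else 0
  have hπ : ∑ t, π t ≫ Sigma.ι (fun _ : T => A) t = 𝟙 _ := by
    refine Sigma.hom_ext _ _ fun s => ?_
    rw [Preadditive.comp_sum, Finset.sum_eq_single s]
    · simp [π]
    · intro t _ ht
      simp [π, ht.symm]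
    · simp
  refine ⟨fun t => x ≫ π t, ?_⟩
  simp only [Category.assoc, ← Preadditive.comp_sum, hπ, Category.comp_id]

theorem exists_eq_sum_of_isFinitelyPresentable {α : Type w} [IsFinitelyPresentable.{w} H]
    (x : H ⟶ ∐ fun _ : α => A) :
    ∃ (T : Type w) (_ : Fintype T) (f : T → α) (a : T → (H ⟶ A)),
      x = ∑ t, a t ≫ Sigma.ι (fun _ : α => A) (f t) := by
  classical
  obtain ⟨S, p, rfl⟩ := IsFinitelyPresentable.exists_hom_of_isColimit
    (CoproductsFromFiniteFiltered.isColimitFiniteSubproductsCocone fun _ : α => A) x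
  obtain ⟨a, rfl⟩ : ∃ a : {x // x ∈ S} → (H ⟶ A), p = _ :=
    exists_eq_sum_of_fintype (T := {x // x ∈ S}) p
  refine ⟨_, inferInstance, fun s => s.1.as, a, ?_⟩
  refine (Preadditive.sum_comp _ _ _).trans (Finset.sum_congr rfl fun s _ => ?_)
  exact (Category.assoc _ _ _).trans (congrArg (a s ≫ ·) (Sigma.ι_desc _ s))

end Coproducts

noncomputable section FreePresheaf

variable {I : Type w} [SmallCategory I] {E : Type u} [Category.{w} E]
  [HasColimitsOfSize.{w, w} E]

/-- The presheaf freely generated by `A` at the object `X`, left adjoint to evaluation at `X`. -/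
def freePresheaf (A : E) (X : I) : Iᵒᵖ ⥤ E where
  obj T := ∐ fun _ : T.unop ⟶ X => A
  map {T T'} g := Sigma.desc fun f => Sigma.ι (fun _ : T'.unop ⟶ X => A) (g.unop ≫ f)

/-- The inclusion of the summand of the free presheaf indexed by `f`. -/
def freeι (A : E) {X T : I} (f : T ⟶ X) : A ⟶ (freePresheaf A X).obj (op T) :=
  Sigma.ι (fun _ : T ⟶ X => A) f

theorem exists_free_desc {A B : E} {X T : I} (b : (T ⟶ X) → (A ⟶ B)) :
    ∃ d : (freePresheaf A X).obj (op T) ⟶ B, ∀ f, freeι A f ≫ d = b f :=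
  ⟨Sigma.desc b, fun _ => Sigma.ι_desc _ _⟩

theorem freeι_map (A : E) {X T T' : I} (f : T ⟶ X) (g : T' ⟶ T) :
    freeι A f ≫ (freePresheaf A X).map g.op = freeι A (g ≫ f) :=
  Sigma.ι_desc _ _

/-- The map from a free presheaf given by a section. -/
def freeDesc {A : E} {X : I} {P : Iᵒᵖ ⥤ E} (z : A ⟶ P.obj (op X)) : freePresheaf A X ⟶ P where
  app T := Sigma.desc fun f => z ≫ P.map f.op
  naturality T T' g := Sigma.hom_ext _ _ fun f => by
    simp [freePresheaf]

theorem freeι_desc {A : E} {X T : I} {P : Iᵒᵖ ⥤ E} (z : A ⟶ P.obj (op X)) (f : T ⟶ X) :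
    freeι A f ≫ (freeDesc z).app (op T) = z ≫ P.map f.op :=
  Sigma.ι_desc _ _

theorem freeι_id_desc {A : E} {X : I} {P : Iᵒᵖ ⥤ E} (z : A ⟶ P.obj (op X)) :
    freeι A (𝟙 X) ≫ (freeDesc z).app (op X) = z := by
  rw [freeι_desc, op_id, P.map_id, Category.comp_id]

theorem freePresheaf_hom_ext {A : E} {X : I} {P : Iᵒᵖ ⥤ E} {a b : freePresheaf A X ⟶ P}
    (h : freeι A (𝟙 X) ≫ a.app (op X) = freeι A (𝟙 X) ≫ b.app (op X)) : a = b := by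
  ext ⟨T⟩
  refine Sigma.hom_ext _ _ fun f => ?_
  change freeι A f ≫ a.app (op T) = freeι A f ≫ b.app (op T)
  rw [← Category.comp_id f, ← freeι_map, Category.assoc, Category.assoc, NatTrans.naturality,
    NatTrans.naturality, reassoc_of% h]

variable [Abelian E]

/-- The differential of the complex of presheaves freely generated by `A` at `X`. -/
def freeD (A : E) (X : SimplicialObject I) (k : ℕ) :
    freePresheaf A (X.obj (op ⦋k + 1⦌)) ⟶ freePresheaf A (X.obj (op ⦋k⦌)) :=
  freeDesc (∑ j : Fin (k + 2), (-1 : ℤ) ^ (j : ℕ) • freeι A (X.δ j))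

theorem freeι_D (A : E) (X : SimplicialObject I) (k : ℕ) {T : I} (f : T ⟶ X.obj (op ⦋k + 1⦌)) :
    freeι A f ≫ (freeD A X k).app (op T) =
      ∑ j : Fin (k + 2), (-1 : ℤ) ^ (j : ℕ) • freeι A (f ≫ X.δ j) := by
  simp only [freeD, freeι_desc, Preadditive.sum_comp, Preadditive.zsmul_comp, freeι_map]

theorem freeD_desc {A : E} (X : SimplicialObject I) (k : ℕ) {P : Iᵒᵖ ⥤ E}
    (z : A ⟶ P.obj (op (X.obj (op ⦋k⦌)))) :
    freeD A X k ≫ freeDesc z = freeDesc (z ≫ coboundary P X k) := by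
  refine freePresheaf_hom_ext ?_
  rw [NatTrans.comp_app, ← Category.assoc, freeι_D, freeι_id_desc]
  simp only [coboundary, Preadditive.sum_comp, Preadditive.comp_sum, Preadditive.zsmul_comp,
    Preadditive.comp_zsmul, freeι_desc, Category.id_comp]

end FreePresheaf

section LocalExactness

variable {I : Type w} [SmallCategory I] {F : MorphismProperty I}
  [F.IsMultiplicative] [F.HasPullbacks] [F.IsStableUnderBaseChange]
  {E : Type u} [Category.{w} E] [Abelian E]

/- The complex of free presheaves splits into summands according to the composite `T ⟶ X_k ⟶ i`;
on the summand of `g`, finitely many generators are contracted by a local cone. -/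
theorem exists_local_contraction [HasColimitsOfSize.{w, w} E] {i : I}
    {X : SimplicialObject (Over i)} (hX : IsReedy (overClass F i) X) (A : E) {n : ℕ} {T : I}
    (g : T ⟶ i) {S : Set (T ⟶ ((total i).obj X).obj (op ⦋n + 1⦌))} (hS : S.Finite) :
    ∃ (T' : I) (c : T' ⟶ T)
      (r : (freePresheaf A (((total i).obj X).obj (op ⦋n⦌))).obj (op T) ⟶
        (freePresheaf A (((total i).obj X).obj (op ⦋n + 1⦌))).obj (op T')),
      F c ∧ ∀ f ∈ S,
        (f ≫ augmentation X (n + 1) ≠ g →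
          freeι A f ≫ (freeD A ((total i).obj X) n).app (op T) ≫ r = 0) ∧
        (f ≫ augmentation X (n + 1) = g → ∃ t,
          freeι A f ≫ (freePresheaf A _).map c.op =
            t ≫ (freeD A ((total i).obj X) (n + 1)).app (op T') +
              freeι A f ≫ (freeD A ((total i).obj X) n).app (op T) ≫ r) := by
  classical
  obtain ⟨S', hSS', T', c, v, s, hc, hs⟩ := exists_isLocalCone hX Over.mkIdTerminal
    (T := Over.mk g) (A := (fun x : Over.mk g ⟶ X.obj (op ⦋n + 1⦌) => x.left) ⁻¹' S)
    (hS.preimage fun _ _ _ _ h => Over.OverMorphism.ext h)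
  let s' (k : ℕ) (x : Over.mk g ⟶ X.obj (op ⦋k⦌)) :
      T'.left ⟶ ((total i).obj X).obj (op ⦋k + 1⦌) := (s k x).left
  obtain ⟨r, hr⟩ : ∃ r : (freePresheaf A (((total i).obj X).obj (op ⦋n⦌))).obj (op T) ⟶
      (freePresheaf A (((total i).obj X).obj (op ⦋n + 1⦌))).obj (op T'.left), ∀ f,
        freeι A f ≫ r =
          if h : f ≫ augmentation X n = g then freeι A (s' n (Over.homMk f h)) else 0 :=
    exists_free_desc _
  have hDr (f : T ⟶ ((total i).obj X).obj (op ⦋n + 1⦌)) :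
      freeι A f ≫ (freeD A ((total i).obj X) n).app (op T) ≫ r =
        ∑ j : Fin (n + 2), (-1 : ℤ) ^ (j : ℕ) • (freeι A (f ≫ ((total i).obj X).δ j) ≫ r) := by
    rw [← Category.assoc, freeι_D]
    simp only [Preadditive.sum_comp, Preadditive.zsmul_comp]
  refine ⟨T'.left, c.left, r, hc, fun f hf => ⟨fun hg => ?_, fun hg => ?_⟩⟩
  · rw [hDr]
    refine Finset.sum_eq_zero fun j _ => ?_
    rw [hr, dif_neg (by rwa [Category.assoc, δ_augmentation]), smul_zero]
  · let x : Over.mk g ⟶ X.obj (op ⦋n + 1⦌) := Over.homMk f hg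
    refine ⟨freeι A (s' (n + 1) x), ?_⟩
    have h := hs.comp_boundary_add (k := n + 1)
      (β := fun z : T' ⟶ X.obj (op ⦋n + 1⦌) =>
        freeι A (X := ((total i).obj X).obj (op ⦋n + 1⦌)) z.left)
      (β' := fun z : T' ⟶ X.obj (op ⦋n + 1 + 1⦌) =>
        freeι A (X := ((total i).obj X).obj (op ⦋n + 1 + 1⦌)) z.left)
      (d := Preadditive.rightComp _ ((freeD A ((total i).obj X) (n + 1)).app (op T'.left)))
      (fun z => freeι_D A ((total i).obj X) (n + 1) z.left) (Nat.lt_succ_self _)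
      (hSS' (show x.left ∈ S from hf))
    rw [freeι_map, hDr]
    refine h.symm.trans congr(_ + $(Finset.sum_congr rfl fun j _ => ?_))
    rw [hr, dif_pos (by rwa [Category.assoc, δ_augmentation])]
    rfl

variable [IsLocallyFinitelyPresentable.{w} E]

theorem sum_fiber_comp_eq_zero {P : Iᵒᵖ ⥤ E} (hP : Presheaf.IsSheaf (topology F) P) {i : I}
    {X : SimplicialObject (Over i)} (hX : IsReedy (overClass F i) X) {A H : E} {n : ℕ} {T : I}
    {y : freePresheaf A (((total i).obj X).obj (op ⦋n + 1⦌)) ⟶ P}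
    (hy : freeD A ((total i).obj X) (n + 1) ≫ y = 0) {τ : Type w} [Fintype τ]
    (f : τ → (T ⟶ ((total i).obj X).obj (op ⦋n + 1⦌))) (a : τ → (H ⟶ A))
    (hx : (∑ t, a t ≫ freeι A (f t)) ≫ (freeD A ((total i).obj X) n).app (op T) = 0)
    (g : T ⟶ i) [DecidablePred fun t => f t ≫ augmentation X (n + 1) = g] :
    (∑ t with f t ≫ augmentation X (n + 1) = g, a t ≫ freeι A (f t)) ≫ y.app (op T) = 0 := by
  obtain ⟨T', c, r, hc, h⟩ := exists_local_contraction hX A g (Set.finite_range f)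
  have hy' := NatTrans.congr_app hy (op T')
  rw [NatTrans.comp_app, zero_app] at hy'
  have hz (t : τ) : ∃ z, f t ≫ augmentation X (n + 1) = g →
      freeι A (f t) ≫ (freePresheaf A _).map c.op =
        z ≫ (freeD A ((total i).obj X) (n + 1)).app (op T') +
          freeι A (f t) ≫ (freeD A ((total i).obj X) n).app (op T) ≫ r := by
    by_cases hg : f t ≫ augmentation X (n + 1) = g
    · exact ((h _ ⟨t, rfl⟩).2 hg).imp fun _ hz _ => hz
    · exact ⟨0, fun h => absurd h hg⟩
  choose z hz using hz
  have hr : (∑ t with f t ≫ augmentation X (n + 1) = g, a t ≫ freeι A (f t)) ≫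
      (freeD A ((total i).obj X) n).app (op T) ≫ r = 0 := by
    rw [← zero_comp (f := r), ← hx, Category.assoc, Preadditive.sum_comp, Preadditive.sum_comp]
    refine Finset.sum_subset (Finset.filter_subset _ _) fun t _ ht => ?_
    rw [Category.assoc, (h _ ⟨t, rfl⟩).1 (by simpa using ht), comp_zero]
  refine eq_of_comp_cover_eq hP hc ?_
  rw [zero_comp, Category.assoc, ← y.naturality, ← Category.assoc]
  have hmap : (∑ t with f t ≫ augmentation X (n + 1) = g, a t ≫ freeι A (f t)) ≫
      (freePresheaf A _).map c.op =
        (∑ t with f t ≫ augmentation X (n + 1) = g, a t ≫ z t) ≫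
          (freeD A ((total i).obj X) (n + 1)).app (op T') := by
    rw [← add_zero (_ ≫ (freeD A ((total i).obj X) (n + 1)).app (op T')), ← hr]
    simp only [Preadditive.sum_comp, Category.assoc, ← Finset.sum_add_distrib]
    refine Finset.sum_congr rfl fun t ht => ?_
    rw [hz t (Finset.mem_filter.1 ht).2, Preadditive.comp_add]
  rw [hmap, Category.assoc, hy', comp_zero]

theorem kernel_ι_freeD_comp_eq_zero {P : Iᵒᵖ ⥤ E} (hP : Presheaf.IsSheaf (topology F) P) {i : I}
    {X : SimplicialObject (Over i)} (hX : IsReedy (overClass F i) X) {A : E} {n : ℕ}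
    {y : freePresheaf A (((total i).obj X).obj (op ⦋n + 1⦌)) ⟶ P}
    (hy : freeD A ((total i).obj X) (n + 1) ≫ y = 0) :
    kernel.ι (freeD A ((total i).obj X) n) ≫ y = 0 := by
  classical
  obtain ⟨Q, _, hQ, hs, _⟩ := exists_compactGenerator E
  ext ⟨T⟩
  refine hs _ _ fun H hH p => ?_
  have := hQ H hH
  obtain ⟨τ, _, f, a, hx⟩ := exists_eq_sum_of_isFinitelyPresentable
    (p ≫ (kernel.ι (freeD A ((total i).obj X) n)).app (op T))
  replace hx : p ≫ (kernel.ι (freeD A ((total i).obj X) n)).app (op T) =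
    ∑ t, a t ≫ freeι A (f t) := hx
  have hker : (∑ t, a t ≫ freeι A (f t)) ≫ (freeD A ((total i).obj X) n).app (op T) = 0 := by
    rw [← hx, Category.assoc, ← NatTrans.comp_app, kernel.condition]
    exact comp_zero
  rw [NatTrans.comp_app, ← Category.assoc, hx,
    ← Finset.sum_fiberwise_of_maps_to (g := fun t => f t ≫ augmentation X (n + 1))
      fun t _ => Finset.mem_image_of_mem _ (Finset.mem_univ t), Preadditive.sum_comp]
  exact (Finset.sum_eq_zero fun g _ => sum_fiber_comp_eq_zero hP hX hy f a hker g).trans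
    comp_zero.symm

theorem exists_comp_coboundary_eq {P : Iᵒᵖ ⥤ E} [Injective P]
    (hP : Presheaf.IsSheaf (topology F) P) {i : I} {X : SimplicialObject (Over i)}
    (hX : IsReedy (overClass F i) X) {n : ℕ} {A : E}
    {y : A ⟶ P.obj (op (((total i).obj X).obj (op ⦋n + 1⦌)))}
    (hy : y ≫ coboundary P ((total i).obj X) (n + 1) = 0) :
    ∃ z, z ≫ coboundary P ((total i).obj X) n = y := by
  have hDy : freeD A ((total i).obj X) (n + 1) ≫ freeDesc y = 0 := by
    rw [freeD_desc, hy]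
    refine freePresheaf_hom_ext ?_
    rw [freeι_id_desc]
    exact comp_zero.symm
  let D := freeD A ((total i).obj X) n
  obtain ⟨g, hg⟩ := Injective.factors
    (cokernel.desc (kernel.ι D) (freeDesc y) (kernel_ι_freeD_comp_eq_zero hP hX hDy))
    (Abelian.factorThruCoimage D)
  have hDg : D ≫ g = freeDesc y := by
    rw [← Abelian.coimage.fac D, Category.assoc, hg]
    exact cokernel.π_desc _ _ _
  obtain ⟨z, rfl⟩ : ∃ z, g = freeDesc z := ⟨_, freePresheaf_hom_ext (freeι_id_desc _).symm⟩
  refine ⟨z, ?_⟩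
  rw [← freeι_id_desc (z ≫ _), ← freeD_desc, ← freeι_id_desc y, ← hDg]

theorem isZero_doldDerived_injective (J : Sheaf (topology F) E) [Injective J] (n : ℕ) :
    IsZero ((doldDerived F E (n + 1)).obj ((sheafToPresheaf (topology F) E).obj J)) := by
  have hJ : Injective J.obj :=
    Injective.injective_of_adjoint (sheafificationAdjunction (topology F) E) J
  refine Functor.isZero _ fun i => (IsZero.iff_id_eq_zero _).2 (dold_hom_ext fun X => ?_)
  obtain ⟨z, hz⟩ := exists_comp_coboundary_eq J.property X.property
    (cocyclesι_coboundary J.obj _ (n + 1))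
  have hclass := comp_cocycleClass_eq_zero
    (P := J.obj) (y := 𝟙 _) (hz.trans (Category.id_comp _).symm)
  rw [Category.id_comp] at hclass
  have hι : doldι F (n + 1) J.obj X = 0 := by
    rw [← cancel_epi (cocycleClass _ _ _)]
    exact (congr($hclass ≫ _)).trans (zero_comp.trans comp_zero.symm)
  exact (congr($hι ≫ _)).trans (zero_comp.trans comp_zero.symm)

end LocalExactness

noncomputable section Cycles

variable {C : Type*} [Category* C] [Abelian C] {D : Type*} [Category* D] [Abelian D]

theorem isIso_of_isLimit_kernelFork {A A' X Y : D} {d : X ⟶ Y} {k : A ⟶ X} {k' : A' ⟶ X}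
    {w : k ≫ d = 0} {w' : k' ≫ d = 0} (h : IsLimit (KernelFork.ofι k w))
    (h' : IsLimit (KernelFork.ofι k' w')) (m : A ⟶ A') (hm : m ≫ k' = k) : IsIso m := by
  have hm' : m = (h.conePointUniqueUpToIso h').hom := by
    refine Fork.IsLimit.hom_ext h' (hm.trans ?_)
    exact (h.conePointUniqueUpToIso_hom_comp h' WalkingParallelPair.zero).symm
  rw [hm']
  infer_instance

/-- The short complex `Z^b ⟶ K^b ⟶ Z^{b+1}`. -/
def cyclesSC (K : CochainComplex C ℕ) (b : ℕ) : ShortComplex C where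
  X₁ := K.cycles b
  X₂ := K.X b
  X₃ := K.cycles (b + 1)
  f := K.iCycles b
  g := K.toCycles b (b + 1)
  zero := by
    rw [← cancel_mono (K.iCycles (b + 1)), Category.assoc, HomologicalComplex.toCycles_i,
      HomologicalComplex.iCycles_d, zero_comp]

/-- The functoriality of `cyclesSC`. -/
def cyclesSCMap {K L : CochainComplex C ℕ} (φ : K ⟶ L) (b : ℕ) : cyclesSC K b ⟶ cyclesSC L b where
  τ₁ := HomologicalComplex.cyclesMap φ b
  τ₂ := φ.f b
  τ₃ := HomologicalComplex.cyclesMap φ (b + 1)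
  comm₁₂ := HomologicalComplex.cyclesMap_i _ _
  comm₂₃ := by
    refine (cancel_mono (L.iCycles (b + 1))).1 ?_
    simp [cyclesSC]

theorem cyclesSC_shortExact {K : CochainComplex C ℕ} {b : ℕ} (hK : K.ExactAt (b + 1)) :
    (cyclesSC K b).ShortExact where
  exact := by
    let φ : cyclesSC K b ⟶ ShortComplex.mk _ _ (K.iCycles_d b (b + 1)) :=
      { τ₁ := 𝟙 (K.cycles b)
        τ₂ := 𝟙 (K.X b)
        τ₃ := K.iCycles (b + 1)
        comm₁₂ := (Category.id_comp _).trans (Category.comp_id _).symm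
        comm₂₃ := (Category.id_comp _).trans (K.toCycles_i _ _).symm }
    have : Epi φ.τ₁ := inferInstanceAs (Epi (𝟙 (K.cycles b)))
    have : IsIso φ.τ₂ := inferInstanceAs (IsIso (𝟙 (K.X b)))
    have : Mono φ.τ₃ := inferInstanceAs (Mono (K.iCycles (b + 1)))
    exact (ShortComplex.exact_iff_of_epi_of_isIso_of_mono φ).2
      (ShortComplex.exact_of_f_is_kernel _
        (K.cyclesIsKernel b (b + 1) (CochainComplex.next ℕ b)))
  mono_f := inferInstanceAs (Mono (K.iCycles b))
  epi_g := by
    have h := ShortComplex.exact_of_g_is_cokernel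
      (ShortComplex.mk _ _ (K.toCycles_comp_homologyπ b (b + 1)))
      (K.homologyIsCokernel b (b + 1) (CochainComplex.prev_nat_succ b))
    exact h.epi_f (hK.isZero_homology.eq_of_tgt _ _)

section

variable (e : C ⥤ D) [e.Additive]

/-- The inclusion of the cocycles of the image of a complex, with target the image of a term. -/
def mapCyclesι (K : CochainComplex C ℕ) (b : ℕ) :
    ((e.mapHomologicalComplex _).obj K).cycles b ⟶ e.obj (K.X b) :=
  ((e.mapHomologicalComplex _).obj K).iCycles b

instance (K : CochainComplex C ℕ) (b : ℕ) : Mono (mapCyclesι e K b) :=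
  inferInstanceAs (Mono (((e.mapHomologicalComplex _).obj K).iCycles b))

theorem cyclesMap_mapCyclesι {K L : CochainComplex C ℕ} (φ : K ⟶ L) (b : ℕ) :
    HomologicalComplex.cyclesMap ((e.mapHomologicalComplex _).map φ) b ≫ mapCyclesι e L b =
      mapCyclesι e K b ≫ e.map (φ.f b) :=
  HomologicalComplex.cyclesMap_i _ _

/-- The comparison map from the image of the cocycles to the cocycles of the image. -/
def mapCyclesHom (K : CochainComplex C ℕ) (b : ℕ) :
    e.obj (K.cycles b) ⟶ ((e.mapHomologicalComplex _).obj K).cycles b :=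
  HomologicalComplex.liftCycles _ (e.map (K.iCycles b)) (b + 1) (CochainComplex.next ℕ b)
    ((e.map_comp _ _).symm.trans (congr(e.map $(K.iCycles_d b (b + 1))).trans (e.map_zero _ _)))

theorem mapCyclesHom_ι (K : CochainComplex C ℕ) (b : ℕ) :
    mapCyclesHom e K b ≫ mapCyclesι e K b = e.map (K.iCycles b) :=
  HomologicalComplex.liftCycles_i _ _ _ _ _

instance [PreservesFiniteLimits e] (K : CochainComplex C ℕ) (b : ℕ) :
    IsIso (mapCyclesHom e K b) :=
  isIso_of_isLimit_kernelFork
    (isLimitForkMapOfIsLimit' e _ (K.cyclesIsKernel b (b + 1) (CochainComplex.next ℕ b)))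
    (HomologicalComplex.cyclesIsKernel _ b (b + 1) (CochainComplex.next ℕ b)) _
    (mapCyclesHom_ι e K b)

theorem mapCyclesHom_naturality {K L : CochainComplex C ℕ} (φ : K ⟶ L) (b : ℕ) :
    e.map (HomologicalComplex.cyclesMap φ b) ≫ mapCyclesHom e L b = mapCyclesHom e K b ≫
      HomologicalComplex.cyclesMap ((e.mapHomologicalComplex _).map φ) b := by
  rw [← cancel_mono (mapCyclesι e L b), Category.assoc, Category.assoc, mapCyclesHom_ι,
    cyclesMap_mapCyclesι, ← e.map_comp, HomologicalComplex.cyclesMap_i, e.map_comp,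
    ← Category.assoc, mapCyclesHom_ι]

theorem map_toCycles_mapCyclesHom (K : CochainComplex C ℕ) (b : ℕ) :
    e.map (K.toCycles b (b + 1)) ≫ mapCyclesHom e K (b + 1) =
      ((e.mapHomologicalComplex _).obj K).toCycles b (b + 1) := by
  refine (cancel_mono (mapCyclesι e K (b + 1))).1 ?_
  rw [Category.assoc, mapCyclesHom_ι, ← e.map_comp, HomologicalComplex.toCycles_i]
  exact (((e.mapHomologicalComplex _).obj K).toCycles_i b (b + 1)).symm

theorem map_toCycles_comp_homologyπ (K : CochainComplex C ℕ) (b : ℕ) :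
    e.map (K.toCycles b (b + 1)) ≫ mapCyclesHom e K (b + 1) ≫
      HomologicalComplex.homologyπ _ (b + 1) = 0 := by
  rw [← Category.assoc, map_toCycles_mapCyclesHom]
  exact HomologicalComplex.toCycles_comp_homologyπ ((e.mapHomologicalComplex (.up ℕ)).obj K) b _

theorem exact_map_toCycles_homologyπ [PreservesFiniteLimits e] (K : CochainComplex C ℕ) (b : ℕ) :
    (ShortComplex.mk _ _ (map_toCycles_comp_homologyπ e K b)).Exact := by
  let L : CochainComplex D ℕ := (e.mapHomologicalComplex _).obj K
  let S : ShortComplex D := ShortComplex.mk _ _ (L.toCycles_comp_homologyπ b (b + 1))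
  let φ : ShortComplex.mk _ _ (map_toCycles_comp_homologyπ e K b) ≅ S :=
    ShortComplex.isoMk (Iso.refl _) (asIso (mapCyclesHom e K (b + 1))) (Iso.refl _)
      ((Category.id_comp _).trans (map_toCycles_mapCyclesHom e K b).symm) (Category.comp_id _).symm
  exact ShortComplex.exact_of_iso φ.symm (S.exact_of_g_is_cokernel
    (L.homologyIsCokernel b (b + 1) (CochainComplex.prev_nat_succ b)))

end

end Cycles

noncomputable section Acyclic

variable (C : Type*) [Category* C] [Abelian C] {D : Type*} [Category* D] [Abelian D]

/-- The cochain complexes of injective objects that are exact in positive degrees, that is, the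
injective resolutions with the resolved object left implicit. -/
def IsInjectiveAcyclic : ObjectProperty (CochainComplex C ℕ) := fun K =>
  (∀ n, Injective (K.X n)) ∧ ∀ n, K.ExactAt (n + 1)

/-- The functor of `b`-cocycles on injective acyclic complexes. -/
abbrev acyclicCycles (b : ℕ) : (IsInjectiveAcyclic C).FullSubcategory ⥤ C :=
  (IsInjectiveAcyclic C).ι ⋙ HomologicalComplex.cyclesFunctor C _ b

variable {C}

/-- The natural transformation `K^b ⟶ Z^{b+1}` on injective acyclic complexes. -/
def acyclicToCycles (b : ℕ) : (IsInjectiveAcyclic C).ι ⋙ HomologicalComplex.eval C _ b ⟶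
    acyclicCycles C (b + 1) where
  app K := K.obj.toCycles b (b + 1)
  naturality _ _ φ := (cyclesSCMap φ.hom b).comm₂₃

variable (e : C ⥤ D) [e.Additive]

/-- The cohomology of the image of an injective acyclic complex under `e`. -/
abbrev acyclicMapHomology (b : ℕ) : (IsInjectiveAcyclic C).FullSubcategory ⥤ D :=
  (IsInjectiveAcyclic C).ι ⋙ e.mapHomologicalComplex _ ⋙ HomologicalComplex.homologyFunctor D _ b

/-- The projection from the image of the cocycles to the cohomology of the image. -/
def acyclicHomologyπ (b : ℕ) :
    acyclicCycles C b ⋙ e ⟶ acyclicMapHomology e b where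
  app K := mapCyclesHom e K.obj b ≫ HomologicalComplex.homologyπ _ b
  naturality K L φ := by
    change e.map (HomologicalComplex.cyclesMap φ.hom b) ≫ mapCyclesHom e L.obj b ≫ _ =
      (mapCyclesHom e K.obj b ≫ _) ≫ HomologicalComplex.homologyMap _ b
    rw [← Category.assoc, mapCyclesHom_naturality, Category.assoc, Category.assoc,
      HomologicalComplex.homologyπ_naturality]
    rfl

instance [PreservesFiniteLimits e] (b : ℕ) : Epi (acyclicHomologyπ e b) := by
  rw [NatTrans.epi_iff_epi_app]
  exact fun K => epi_comp (mapCyclesHom e K.obj b) (HomologicalComplex.homologyπ _ b)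

theorem acyclicToCycles_comp_homologyπ (b : ℕ) :
    Functor.whiskerRight (acyclicToCycles b) e ≫ acyclicHomologyπ (C := C) e (b + 1) = 0 := by
  ext K
  exact map_toCycles_comp_homologyπ e K.obj b

theorem exact_acyclicToCycles_homologyπ [PreservesFiniteLimits e] (b : ℕ) :
    (ShortComplex.mk _ _ (acyclicToCycles_comp_homologyπ (C := C) e b)).Exact :=
  exact_of_forall_evaluation _ fun K => exact_map_toCycles_homologyπ e K.obj b

end Acyclic

theorem comp_square {D : Type*} [Category* D] {A A' B B' M M' : D} {f : A ⟶ A'} {g : B ⟶ B'}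
    {h : M ⟶ M'} {a : A ⟶ B} {a' : A' ⟶ B'} {b : B ⟶ M} {b' : B' ⟶ M'} (h₁ : f ≫ a' = a ≫ g)
    (h₂ : g ≫ b' = b ≫ h) : f ≫ a' ≫ b' = (a ≫ b) ≫ h := by
  rw [reassoc_of% h₁, h₂, Category.assoc]

noncomputable section Universal

variable {C : Type*} [Category* C] [Abelian C] {D : Type*} [Category* D] [Abelian D]

namespace DeltaFunctor

variable {G : ℕ → C ⥤ D} (d : DeltaFunctor G)

/-- The connecting map `G^n(Z^{b+1}) ⟶ G^{n+1}(Z^b)`. -/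
def cyclesδ (n b : ℕ) : acyclicCycles C (b + 1) ⋙ G n ⟶ acyclicCycles C b ⋙ G (n + 1) where
  app K := d.δ (cyclesSC_shortExact (K.property.2 b)) n
  naturality K L φ := d.δ_naturality (cyclesSC_shortExact (K.property.2 b))
    (cyclesSC_shortExact (L.property.2 b)) (cyclesSCMap φ.hom b) n

theorem epi_cyclesδ (hd : ∀ (J : C) [Injective J] (n : ℕ), IsZero ((G (n + 1)).obj J))
    (n b : ℕ) : Epi (d.cyclesδ n b) := by
  rw [NatTrans.epi_iff_epi_app]
  intro K
  have := K.property.1 b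
  exact (d.exact₁ (cyclesSC_shortExact (K.property.2 b)) n).epi_f
    ((hd (K.obj.X b) n).eq_of_tgt _ _)

theorem isIso_cyclesδ (hd : ∀ (J : C) [Injective J] (n : ℕ), IsZero ((G (n + 1)).obj J))
    (n b : ℕ) : IsIso (d.cyclesδ (n + 1) b) := by
  have := d.epi_cyclesδ hd (n + 1) b
  have : Mono (d.cyclesδ (n + 1) b) := by
    rw [NatTrans.mono_iff_mono_app]
    intro K
    have := K.property.1 b
    exact (d.exact₃ (cyclesSC_shortExact (K.property.2 b)) (n + 1)).mono_g
      ((hd (K.obj.X b) n).eq_of_src _ _)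
  exact isIso_of_mono_of_epi _

theorem acyclicToCycles_comp_cyclesδ (n b : ℕ) :
    Functor.whiskerRight (acyclicToCycles b) (G n) ≫ d.cyclesδ n b = 0 := by
  ext K
  exact d.comp_δ (cyclesSC_shortExact (K.property.2 b)) n

theorem exact_acyclicToCycles_cyclesδ (n b : ℕ) :
    (ShortComplex.mk _ _ (d.acyclicToCycles_comp_cyclesδ n b)).Exact :=
  exact_of_forall_evaluation _ fun K => d.exact₃ (cyclesSC_shortExact (K.property.2 b)) n

variable {e : C ⥤ D} [e.Additive] [PreservesFiniteLimits e]

/- Both sides are the cokernel of `e(K^b) ⟶ e(Z^{b+1})`. -/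
theorem nonempty_cycles_one_iso (d : DeltaFunctor G) (i₀ : e ≅ G 0)
    (hd : ∀ (J : C) [Injective J] (n : ℕ), IsZero ((G (n + 1)).obj J)) (b : ℕ) :
    Nonempty (acyclicCycles C b ⋙ G 1 ≅ acyclicMapHomology e (b + 1)) := by
  let S := ShortComplex.mk _ _ (d.acyclicToCycles_comp_cyclesδ 0 b)
  let T := ShortComplex.mk _ _ (acyclicToCycles_comp_homologyπ e b)
  have hS : S.Exact := d.exact_acyclicToCycles_cyclesδ 0 b
  have hT : T.Exact := exact_acyclicToCycles_homologyπ e b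
  have : Epi S.g := d.epi_cyclesδ hd 0 b
  have : Epi T.g := inferInstanceAs (Epi (acyclicHomologyπ e (b + 1)))
  exact ⟨CokernelCofork.mapIsoOfIsColimit hS.gIsCokernel hT.gIsCokernel
    (Arrow.isoMk (Functor.isoWhiskerLeft _ i₀.symm) (Functor.isoWhiskerLeft _ i₀.symm)
      (by
        ext K
        exact (i₀.inv.naturality _).symm))⟩

theorem nonempty_cycles_iso (d : DeltaFunctor G) (i₀ : e ≅ G 0)
    (hd : ∀ (J : C) [Injective J] (n : ℕ), IsZero ((G (n + 1)).obj J)) (a b : ℕ) :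
    Nonempty (acyclicCycles C b ⋙ G (a + 1) ≅ acyclicMapHomology e (a + b + 1)) := by
  induction a generalizing b with
  | zero =>
    rw [Nat.zero_add b]
    exact d.nonempty_cycles_one_iso i₀ hd b
  | succ a ih =>
    obtain ⟨α⟩ := ih (b + 1)
    rw [Nat.add_right_comm a 1 b]
    have := d.isIso_cyclesδ hd a b
    exact ⟨(asIso (d.cyclesδ (a + 1) b)).symm ≪≫ α⟩

end DeltaFunctor

end Universal

noncomputable section Resolution

variable {C : Type*} [Category* C] [Abelian C] [HasInjectiveResolutions C]

/-- The chosen injective resolution as an object of the category of injective acyclic complexes. -/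
def acyclicResolution (X : C) : (IsInjectiveAcyclic C).FullSubcategory :=
  ⟨(injectiveResolution X).cocomplex, fun _ => inferInstance,
    (injectiveResolution X).cocomplex_exactAt_succ⟩

/-- The map of chosen injective resolutions lifting a map of objects. -/
def acyclicResolutionMap {X Y : C} (f : X ⟶ Y) : acyclicResolution X ⟶ acyclicResolution Y :=
  ObjectProperty.homMk
    (InjectiveResolution.desc f (injectiveResolution Y) (injectiveResolution X))

theorem acyclicResolutionMap_commutes {X Y : C} (f : X ⟶ Y) :
    (injectiveResolution X).ι.f 0 ≫ (acyclicResolutionMap f).hom.f 0 =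
      f ≫ (injectiveResolution Y).ι.f 0 :=
  InjectiveResolution.desc_commutes_zero f _ _

/-- The identification of an object with the zero-cocycles of its injective resolution. -/
def toCyclesResolution (X : C) : X ⟶ (acyclicResolution X).obj.cycles 0 :=
  (acyclicResolution X).obj.liftCycles ((injectiveResolution X).ι.f 0) 1 (CochainComplex.next ℕ 0)
    (injectiveResolution X).ι_f_zero_comp_complex_d

theorem toCyclesResolution_iCycles (X : C) :
    toCyclesResolution X ≫ (acyclicResolution X).obj.iCycles 0 = (injectiveResolution X).ι.f 0 :=
  HomologicalComplex.liftCycles_i _ _ _ _ _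

instance (X : C) : IsIso (toCyclesResolution X) :=
  isIso_of_isLimit_kernelFork (w := (injectiveResolution X).ι_f_zero_comp_complex_d)
    (injectiveResolution X).isLimitKernelFork
    ((acyclicResolution X).obj.cyclesIsKernel 0 1 (CochainComplex.next ℕ 0)) _
    (toCyclesResolution_iCycles X)

theorem toCyclesResolution_naturality {X Y : C} (f : X ⟶ Y) :
    f ≫ toCyclesResolution Y = toCyclesResolution X ≫
      HomologicalComplex.cyclesMap (acyclicResolutionMap f).hom 0 := by
  rw [← cancel_mono ((acyclicResolution Y).obj.iCycles 0), Category.assoc, Category.assoc,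
    HomologicalComplex.cyclesMap_i, toCyclesResolution_iCycles,
    ← Category.assoc (toCyclesResolution X), toCyclesResolution_iCycles]
  exact (acyclicResolutionMap_commutes f).symm

variable {D : Type*} [Category* D] [Abelian D]

theorem DeltaFunctor.nonempty_iso_rightDerived {G : ℕ → C ⥤ D} (d : DeltaFunctor G)
    (hd : ∀ (J : C) [Injective J] (n : ℕ), IsZero ((G (n + 1)).obj J))
    {e : C ⥤ D} [e.Additive] [PreservesFiniteLimits e] (i₀ : e ≅ G 0) (n : ℕ) :
    Nonempty (G n ≅ e.rightDerived n) := by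
  cases n with
  | zero => exact ⟨i₀.symm ≪≫ e.rightDerivedZeroIsoSelf.symm⟩
  | succ n =>
    obtain ⟨α⟩ := d.nonempty_cycles_iso i₀ hd n 0
    refine ⟨NatIso.ofComponents (fun X => (G (n + 1)).mapIso (asIso (toCyclesResolution X)) ≪≫
      α.app (acyclicResolution X) ≪≫
        ((injectiveResolution X).isoRightDerivedObj e (n + 1)).symm) fun {X Y} f => ?_⟩
    have hG : (G (n + 1)).map f ≫ (G (n + 1)).map (toCyclesResolution Y) =
        (G (n + 1)).map (toCyclesResolution X) ≫
          (G (n + 1)).map (HomologicalComplex.cyclesMap (acyclicResolutionMap f).hom 0) := by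
      rw [← Functor.map_comp, toCyclesResolution_naturality, Functor.map_comp]
    have hR := InjectiveResolution.isoRightDerivedObj_inv_naturality f _ _
      (acyclicResolutionMap f).hom (acyclicResolutionMap_commutes f) e (n + 1)
    exact comp_square hG (comp_square (α.hom.naturality (acyclicResolutionMap f)) hR.symm)

end Resolution

noncomputable section Restriction

theorem isIso_map_unit_app {A B : Type*} [Category* A] [Category* B] {e : A ⥤ B} {a : B ⥤ A}
    (adj : a ⊣ e) [IsIso adj.counit] (X : B) : IsIso (a.map (adj.unit.app X)) := by
  rw [(IsIso.eq_comp_inv _).2 (adj.left_triangle_components X), Category.id_comp]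
  infer_instance

/-- The factorization through a reflection `a` of a functor that inverts the maps inverted by
`a`. -/
def localizedIso {A B D : Type*} [Category* A] [Category* B] [Category* D] {e : A ⥤ B}
    {a : B ⥤ A} (adj : a ⊣ e) [IsIso adj.counit] (H : B ⥤ D)
    (hH : ∀ ⦃X Y : B⦄ (f : X ⟶ Y) [IsIso (a.map f)], IsIso (H.map f)) :
    H ≅ a ⋙ e ⋙ H :=
  NatIso.ofComponents (fun X =>
    have := isIso_map_unit_app adj X
    have := hH (adj.unit.app X)
    asIso (H.map (adj.unit.app X)))
    fun f => (Functor.whiskerRight adj.unit H).naturality f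

variable {A : Type*} [Category* A] [Abelian A] {B : Type*} [Category* B] [Abelian B]
  (e : A ⥤ B)

/-- The short complex `e(X₁) ⟶ e(X₂) ⟶ coker`. -/
abbrev cokernelSC (S : ShortComplex A) : ShortComplex B :=
  ShortComplex.mk (e.map S.f) (cokernel.π (e.map S.f)) (cokernel.condition _)

theorem cokernelSC_shortExact [PreservesFiniteLimits e] {S : ShortComplex A} (hS : S.ShortExact) :
    (cokernelSC e S).ShortExact :=
  have := hS.mono_f
  { exact := ShortComplex.exact_cokernel _ }

/-- The functoriality of `cokernelSC`. -/
abbrev cokernelSCMap {S S' : ShortComplex A} (φ : S ⟶ S') : cokernelSC e S ⟶ cokernelSC e S' :=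
  have h : e.map S.f ≫ e.map φ.τ₂ = e.map φ.τ₁ ≫ e.map S'.f := by
    rw [← Functor.map_comp, ← Functor.map_comp, φ.comm₁₂]
  ShortComplex.homMk (e.map φ.τ₁) (e.map φ.τ₂) (cokernel.map _ _ _ _ h) h.symm
    (cokernel.π_desc _ _ _).symm

variable [e.Additive]

/-- The comparison map from the cokernel of `e.map S.f` to `e.obj S.X₃`. -/
abbrev cokernelSCDesc (S : ShortComplex A) : (cokernelSC e S).X₃ ⟶ e.obj S.X₃ :=
  cokernel.desc _ (e.map S.g) (by rw [← Functor.map_comp, S.zero, Functor.map_zero])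

theorem map_cokernelπ_comp_map_cokernelSCDesc {D : Type*} [Category* D] (H : B ⥤ D)
    (S : ShortComplex A) :
    H.map (cokernel.π (e.map S.f)) ≫ H.map (cokernelSCDesc e S) = H.map (e.map S.g) := by
  rw [← Functor.map_comp, cokernel.π_desc]

theorem cokernelSCDesc_naturality {S S' : ShortComplex A} (φ : S ⟶ S') :
    cokernelSCDesc e S ≫ e.map φ.τ₃ = (cokernelSCMap e φ).τ₃ ≫ cokernelSCDesc e S' := by
  apply coequalizer.hom_ext
  simp [← Functor.map_comp, φ.comm₂₃]

theorem inv_map_cokernelSCDesc_naturality {D : Type*} [Category* D] (H : B ⥤ D)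
    {S S' : ShortComplex A} (φ : S ⟶ S') [IsIso (H.map (cokernelSCDesc e S))]
    [IsIso (H.map (cokernelSCDesc e S'))] :
    H.map (e.map φ.τ₃) ≫ inv (H.map (cokernelSCDesc e S')) =
      inv (H.map (cokernelSCDesc e S)) ≫ H.map (cokernelSCMap e φ).τ₃ := by
  rw [IsIso.comp_inv_eq, Category.assoc, IsIso.eq_inv_comp, ← H.map_comp, ← H.map_comp,
    cokernelSCDesc_naturality]

variable {e} {a : B ⥤ A}

theorem isIso_map_cokernelSCDesc (adj : a ⊣ e) [IsIso adj.counit] [PreservesFiniteLimits a]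
    [PreservesFiniteLimits e] {S : ShortComplex A} (hS : S.ShortExact) :
    IsIso (a.map (cokernelSCDesc e S)) := by
  have : Mono (cokernelSCDesc e S) := by
    have := hS.mono_f
    exact (S.map e).exact_iff_mono_cokernel_desc.1
      (hS.exact.map_of_mono_of_preservesKernel e inferInstance inferInstance)
  have : Epi (a.map (cokernelSCDesc e S)) := by
    have := hS.epi_g
    have hg : a.map (e.map S.g) = _ := (IsIso.eq_comp_inv _).2 (adj.counit.naturality S.g)
    have : Epi (a.map (e.map S.g)) := by
      rw [hg]
      infer_instance
    exact epi_of_epi_fac (map_cokernelπ_comp_map_cokernelSCDesc e a S)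
  exact isIso_of_mono_of_epi _

variable {D : Type*} [Category* D] [Abelian D] {G : ℕ → B ⥤ D}

/-- A δ-functor that inverts the maps inverted by an exact reflection restricts to the reflective
subcategory. -/
def DeltaFunctor.ofReflection (d : DeltaFunctor G) (adj : a ⊣ e) [IsIso adj.counit]
    [PreservesFiniteLimits a] [PreservesFiniteLimits e]
    (hG : ∀ ⦃X Y : B⦄ (f : X ⟶ Y) [IsIso (a.map f)] (n : ℕ), IsIso ((G n).map f)) :
    DeltaFunctor fun n => e ⋙ G n :=
  have hdesc {S : ShortComplex A} (hS : S.ShortExact) (n : ℕ) :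
      IsIso ((G n).map (cokernelSCDesc e S)) :=
    have := isIso_map_cokernelSCDesc adj hS
    hG _ n
  { δ {S} hS n :=
      have := hdesc hS n
      inv ((G n).map (cokernelSCDesc e S)) ≫ d.δ (cokernelSC_shortExact e hS) n
    δ_naturality {S S'} hS hS' φ n := by
      have := hdesc hS n
      have := hdesc hS' n
      exact comp_square (inv_map_cokernelSCDesc_naturality e (G n) φ)
        (d.δ_naturality (cokernelSC_shortExact e hS) (cokernelSC_shortExact e hS')
          (cokernelSCMap e φ) n)
    δ_comp {S} hS n := by
      have := hdesc hS n
      exact (Category.assoc _ _ _).trans ((congr(_ ≫ $(d.δ_comp _ n))).trans comp_zero)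
    map_comp {S} hS n := by
      have h := d.map_comp (cokernelSC_shortExact e hS) n
      change (G n).map (e.map S.f) ≫ (G n).map (e.map S.g) = 0
      rw [← map_cokernelπ_comp_map_cokernelSCDesc, reassoc_of% h, zero_comp]
    comp_δ {S} hS n := by
      have := hdesc hS n
      change (G n).map (e.map S.g) ≫ inv _ ≫ _ = 0
      rw [← map_cokernelπ_comp_map_cokernelSCDesc, Category.assoc, IsIso.hom_inv_id_assoc]
      exact d.comp_δ (cokernelSC_shortExact e hS) n
    exact₁ {S} hS n := by
      have := hdesc hS n
      refine ShortComplex.exact_of_iso ?_ (d.exact₁ (cokernelSC_shortExact e hS) n)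
      exact ShortComplex.isoMk (asIso ((G n).map (cokernelSCDesc e S))) (Iso.refl _) (Iso.refl _)
        (by simp) (by simp)
    exact₂ {S} hS n := by
      have := hdesc hS n
      refine ShortComplex.exact_of_iso ?_ (d.exact₂ (cokernelSC_shortExact e hS) n)
      exact ShortComplex.isoMk (Iso.refl _) (Iso.refl _) (asIso ((G n).map (cokernelSCDesc e S)))
        (by simp) (by simp [map_cokernelπ_comp_map_cokernelSCDesc])
    exact₃ {S} hS n := by
      have := hdesc hS n
      refine ShortComplex.exact_of_iso ?_ (d.exact₃ (cokernelSC_shortExact e hS) n)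
      exact ShortComplex.isoMk (Iso.refl _) (asIso ((G n).map (cokernelSCDesc e S))) (Iso.refl _)
        (by simp [map_cokernelπ_comp_map_cokernelSCDesc]) (by simp)
    mono_zero {S} hS := d.mono_zero (cokernelSC_shortExact e hS) }

end Restriction

noncomputable section Comparison

variable {I : Type w} [SmallCategory I] (F : MorphismProperty I)
  [F.IsMultiplicative] [F.HasPullbacks] [F.IsStableUnderBaseChange]
  (E : Type u) [Category.{w} E] [Abelian E] [IsLocallyFinitelyPresentable.{w} E]

theorem isIso_doldDerived_map {P Q : Iᵒᵖ ⥤ E} (f : P ⟶ Q)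
    [IsIso ((presheafToSheaf (topology F) E).map f)] (n : ℕ) :
    IsIso ((doldDerived F E n).map f) :=
  (doldDelta F E).isIso_map_of_exact (presheafToSheaf (topology F) E)
    (fun _ => isZero_doldDerived) f n

/-- The Dold-derived functors as a δ-functor on sheaves. -/
def sheafDoldDelta :
    DeltaFunctor fun n => sheafToPresheaf (topology F) E ⋙ doldDerived F E n :=
  (doldDelta F E).ofReflection (sheafificationAdjunction (topology F) E)
    fun _ _ f _ n => isIso_doldDerived_map F E f n

/-- The Dold-derived functors depend only on the associated sheaf. -/
def doldSheafifyIso (n : ℕ) : doldDerived F E n ≅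
    presheafToSheaf (topology F) E ⋙ sheafToPresheaf (topology F) E ⋙ doldDerived F E n :=
  localizedIso (sheafificationAdjunction (topology F) E) _
    fun _ _ f _ => isIso_doldDerived_map F E f n

end Comparison

end HyperDold

theorem mainTheorem3 {I : Type w} [SmallCategory I] (F : MorphismProperty I)
    [F.IsMultiplicative] [F.HasPullbacks] [F.IsStableUnderBaseChange]
    (E : Type u) [Category.{w} E] [Abelian E] [IsLocallyFinitelyPresentable.{w} E] (n : ℕ) :
    Nonempty (HyperDold.doldDerived F E n ≅
      presheafToSheaf (HyperDold.topology F) E ⋙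
        (sheafToPresheaf (HyperDold.topology F) E).rightDerived n) := by
  obtain ⟨α⟩ := (HyperDold.sheafDoldDelta F E).nonempty_iso_rightDerived
    HyperDold.isZero_doldDerived_injective HyperDold.doldZeroIso n
  exact ⟨HyperDold.doldSheafifyIso F E n ≪≫ Functor.isoWhiskerLeft _ α⟩
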